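/- Let $N\ge 1$, let $\Omega\subset\mathbb R^N$ be a bounded domain (nonempty, open, connected) whose boundary is of class $C^{4,\eta}$ for some $\eta\in(0,1)$, and let $X$ be either $W^{2,2}_0(\Omega)$ (Dirichlet boundary condition $u=\partial u/\partial\nu=0$ on $\partial\Omega$) or, assuming in addition that $\Omega$ satisfies a uniform outer ball condition, $W^{2,2}(\Omega)\cap W^{1,2}_0(\Omega)$ (Navier boundary condition $u=\Delta u=0$ on $\partial\Omega$). Put $Y=X$ if $N\le 3$ and $Y=X\cap W^{1,6}(\Omega)$ if $N\ge 4$. For $\omega\in\mathbb R$ and $\kappa>0$ consider the energy $$\mathcal E_2(u)=\frac12\int_\Omega|\Delta u|^2\,dx+\frac{\omega^2}{2}\int_\Omega|\nabla u|^2\,dx-\frac{\kappa}{4}\int_\Omega|\nabla u|^4\,dx+\frac{\kappa}{12}\int_\Omega|\nabla u|^6\,dx$$ associated with the equation $$\Delta^2u-\omega^2\Delta u+\kappa\,\mathrm{div}(|\nabla u|^2\nabla u)-\frac{\kappa}{2}\,\mathrm{div}(|\nabla u|^4\nabla u)=0\quad\text{in }\Omega.$$ Then all four integrals are finite for every $u\in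 Y$, and for every $\omega\in\mathbb R$ there is $\kappa_0>0$ such that for every $\kappa\ge\kappa_0$ there is a nonzero $u\in Y$ with $\mathcal E_2(u)\le\mathcal E_2(v)$ for all $v\in Y$ and $\mathcal E_2(u)<0$. -/

import Mathlib

open MeasureTheory TopologicalSpace
open scoped ENNReal NNReal

namespace Zakharov

noncomputable section

/-- The Euclidean space `ℝ^N`. -/
abbrev RN (N : ℕ) : Type := EuclideanSpace ℝ (Fin N)

/-- The classical partial derivative `∂^m f / ∂x_{I 0} ⋯ ∂x_{I (m-1)}` at `x`
(the function itself for `m = 0`). A multi-index of length `m` is presented by a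
list `I` of `m` coordinate directions. -/
def partialDeriv {N m : ℕ} (I : Fin m → Fin N) (f : RN N → ℝ) (x : RN N) : ℝ :=
  iteratedFDeriv ℝ m f x (fun j => EuclideanSpace.single (I j) (1 : ℝ))

/-- `v` is the weak partial derivative of `u` in `Ω` in the directions `I 0, …, I (m-1)`. -/
def HasWeakDeriv {N m : ℕ} (Ω : Opens (RN N)) (I : Fin m → Fin N) (u v : RN N → ℝ) : Prop :=
  LocallyIntegrableOn u Ω ∧ LocallyIntegrableOn v Ω ∧
    ∀ φ : TestFunction Ω ℝ ⊤,
      ∫ x in (Ω : Set (RN N)), u x * partialDeriv I φ x =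
        (-1) ^ m * ∫ x in (Ω : Set (RN N)), v x * φ x

open Classical in
/-- A chosen representative of the weak partial derivative of `u` in `Ω`, which is unique
almost everywhere in `Ω`; zero if there is no weak derivative. -/
def weakDeriv {N m : ℕ} (Ω : Opens (RN N)) (I : Fin m → Fin N) (u : RN N → ℝ) : RN N → ℝ :=
  if h : ∃ v, HasWeakDeriv Ω I u v then h.choose else 0

/-- `u ∈ W^{k,p}(Ω)`: all weak derivatives of order at most `k` exist and lie in `L^p(Ω)`. -/
def MemSobolev {N : ℕ} (Ω : Opens (RN N)) (k : ℕ) (p : ℝ≥0∞) (u : RN N → ℝ) : Prop :=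
  ∀ m ≤ k, ∀ I : Fin m → Fin N,
    ∃ v, HasWeakDeriv Ω I u v ∧ MemLp v p (volume.restrict (Ω : Set (RN N)))

/-- The norm of `W^{k,p}(Ω)`, the sum of the `L^p` norms of all weak derivatives of order at
most `k`; meaningful on `W^{k,p}(Ω)`. -/
def sobolevNorm {N : ℕ} (Ω : Opens (RN N)) (k : ℕ) (p : ℝ≥0∞) (u : RN N → ℝ) : ℝ≥0∞ :=
  ∑ m ∈ Finset.range (k + 1), ∑ I : Fin m → Fin N,
    eLpNorm (weakDeriv Ω I u) p (volume.restrict (Ω : Set (RN N)))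

/-- `u ∈ W^{k,p}_0(Ω)`: `u` belongs to the closure of `C_0^∞(Ω)` in `W^{k,p}(Ω)`. -/
def MemSobolevZero {N : ℕ} (Ω : Opens (RN N)) (k : ℕ) (p : ℝ≥0∞) (u : RN N → ℝ) : Prop :=
  MemSobolev Ω k p u ∧
    ∀ ε : ℝ≥0∞, 0 < ε → ∃ φ : TestFunction Ω ℝ ⊤, sobolevNorm Ω k p (fun x => u x - φ x) < ε

/-- The weak gradient of `u` in `Ω`. -/
def weakGrad {N : ℕ} (Ω : Opens (RN N)) (u : RN N → ℝ) (x : RN N) : RN N :=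
  WithLp.toLp 2 (fun i => weakDeriv Ω ![i] u x)

/-- The weak Laplacian of `u` in `Ω`. -/
def weakLaplacian {N : ℕ} (Ω : Opens (RN N)) (u : RN N → ℝ) (x : RN N) : ℝ :=
  ∑ i : Fin N, weakDeriv Ω ![i, i] u x

/-- `f ∈ C^{k,η}(U)` for an open set `U`: `f` is of class `C^k` in `U` and its derivative of
order `k` is locally Hölder continuous in `U` with exponent `η`. -/
def IsHolderClassOn {N : ℕ} (k : ℕ) (η : ℝ≥0) (f : RN N → RN N) (U : Set (RN N)) : Prop :=
  ContDiffOn ℝ k f U ∧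
    ∀ K ⊆ U, IsCompact K → ∃ C : ℝ≥0, HolderOnWith C η (iteratedFDeriv ℝ k f) K

/-- The boundary of `Ω` is of class `C^{k,η}`: near each boundary point it is straightened by a
`C^{k,η}` diffeomorphism of a ball which maps the part of the ball in `Ω` into a half-space
`{y_i > 0}` and the part of the ball in the boundary into the hyperplane `{y_i = 0}`. -/
def HasHolderBoundary {N : ℕ} (k : ℕ) (η : ℝ≥0) (Ω : Opens (RN N)) : Prop :=
  ∀ x₀ ∈ frontier (Ω : Set (RN N)),
    ∃ (ψ : OpenPartialHomeomorph (RN N) (RN N)) (r : ℝ) (i : Fin N),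
      0 < r ∧ ψ.source = Metric.ball x₀ r ∧
      IsHolderClassOn k η ψ ψ.source ∧ IsHolderClassOn k η ψ.symm ψ.target ∧
      (∀ x ∈ ψ.source, x ∈ Ω ↔ 0 < ψ x i) ∧
      (∀ x ∈ ψ.source, x ∈ frontier (Ω : Set (RN N)) ↔ ψ x i = 0)

/-- The uniform outer ball condition. -/
def UniformOuterBall {N : ℕ} (Ω : Opens (RN N)) : Prop :=
  ∃ r : ℝ, 0 < r ∧ ∀ y ∈ frontier (Ω : Set (RN N)),
    ∃ c : RN N, dist y c = r ∧ Disjoint (Metric.ball c r) (Ω : Set (RN N))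

/-- The two homogeneous boundary conditions: Dirichlet, `u = ∂u/∂ν = 0` on the boundary, and
Navier, `u = Δu = 0` on the boundary. -/
inductive BoundaryCondition
  | dirichlet
  | navier

/-- The working space `X`: `W^{2,2}_0(Ω)` for the Dirichlet boundary condition and
`W^{2,2}(Ω) ∩ W^{1,2}_0(Ω)` for the Navier boundary condition. -/
def spaceX {N : ℕ} (Ω : Opens (RN N)) : BoundaryCondition → Set (RN N → ℝ)
  | .dirichlet => {u | MemSobolevZero Ω 2 2 u}
  | .navier => {u | MemSobolev Ω 2 2 u ∧ MemSobolevZero Ω 1 2 u}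

/-- The space where the problem is posed: `X` if `N ≤ 3` and `X ∩ W^{1,6}(Ω)` if `N ≥ 4`. -/
def energySpace {N : ℕ} (Ω : Opens (RN N)) (bc : BoundaryCondition) : Set (RN N → ℝ) :=
  if N ≤ 3 then spaceX Ω bc else spaceX Ω bc ∩ {u | MemSobolev Ω 1 6 u}

/-- The energy functional `E₂`. -/
def energy₂ {N : ℕ} (Ω : Opens (RN N)) (κ ω : ℝ) (u : RN N → ℝ) : ℝ :=
  1 / 2 * (∫ x in (Ω : Set (RN N)), |weakLaplacian Ω u x| ^ 2)
    + ω ^ 2 / 2 * (∫ x in (Ω : Set (RN N)), ‖weakGrad Ω u x‖ ^ 2)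
    - κ / 4 * (∫ x in (Ω : Set (RN N)), ‖weakGrad Ω u x‖ ^ 4)
    + κ / 12 * (∫ x in (Ω : Set (RN N)), ‖weakGrad Ω u x‖ ^ 6)

/-- All the integrals in the energy of `u` are finite. -/
def EnergyWellDefined {N : ℕ} (Ω : Opens (RN N)) (u : RN N → ℝ) : Prop :=
  IntegrableOn (fun x => |weakLaplacian Ω u x| ^ 2) Ω ∧
    IntegrableOn (fun x => ‖weakGrad Ω u x‖ ^ 2) Ω ∧
    IntegrableOn (fun x => ‖weakGrad Ω u x‖ ^ 4) Ω ∧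
    IntegrableOn (fun x => ‖weakGrad Ω u x‖ ^ 6) Ω

end

end Zakharov

/-!
The minimizer is found by the direct method. By Young's inequality
`κ (t⁶ / 12 - t⁴ / 4) ≥ κ (t⁶ / 24 - 2)`, so a bound on the energy of `u` bounds `Δu` in `L²` and
`∇u` in `L⁶` (`exists_bound_of_energy`). A minimizing sequence therefore has a subsequence all of
whose derivatives up to the second order converge weakly in `L²`, and the limit satisfies the
boundary conditions since `W^{k,2}_0(Ω)` is weakly closed (`memSobolevZero_of_weak`). The functions
converge in `L²` by Rellich's theorem (`tendsto_of_weak`), their gradients by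
`∫ |∂_i v|² = -∫ v ∂_i∂_i v` (`tendsto_weakDeriv_of_weak`), and along a subsequence the gradients
converge almost everywhere. Weak lower semicontinuity of `∫ |Δu|²` and Fatou's lemma for the
gradient part of the energy, shifted by a constant so as to be nonnegative, show that the limit is a
minimizer (`energy₂_le_of_tendsto`, `exists_minimizer`). For large `κ` the energy is negative at a
small multiple of a bump function (`exists_energy₂_neg`), so the minimizer is not zero.

Two facts need the regularity of the boundary: the Hessian of `u ∈ W^{2,2}(Ω) ∩ W^{1,2}_0(Ω)` is
bounded in `L²` by `Δu` and `∇u` (`IsDefining.hessian_estimate`), and `W^{1,2}(Ω)` embeds into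
`L⁶(Ω)` for `N ≤ 3` (`IsDefining.memLp_six`), which makes the energy finite on the whole space.
Neither is proved in charts. Instead the local defining functions are glued to one global `C⁴`
function `ρ`, positive exactly in `Ω`, with `|∇ρ|² + ρ²` bounded below in `Ω`
(`exists_isDefining`), and all cut-offs are functions of `ρ`. No trace operator occurs: "zero trace"
means that the integration by parts formula in `Ω` holds for test functions which need not vanish on
the boundary (`IsH1 Ω univ`).

For the Hessian, put `Q = |∇ρ|² + ρ²` and `v = ∇ρ · ∇u`. The tangential derivatives `∂_iρ ∂_j u -
∂_jρ ∂_i u` have zero trace (`IsDefining.zeroExt_tangential`), hence so has `Q ∇u - v ∇ρ`. The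
minors `∂_i F_i ∂_j F_j - ∂_j F_i ∂_i F_j` are null Lagrangians, so their integrals are the same for
`F = Q ∇u` and `F = v ∇ρ`; here Hardy's inequality (`IsDefining.memLp_div`) controls the error of
the cut-offs (`IsDefining.integral_jacobian`). For the first field the sum of the minors is `Q²
((Δu)² - |D²u|²)`, for the second it vanishes, in both cases up to terms at most linear in `D²u`,
which are absorbed (`jacobian_pointwise`).

For the embedding, the inequality `W^{1,1} → L^{3/2}` on the whole space
(`sobolev_one_of_le_three`) is applied to the fourth power of a function times a cut-off. The
cut-off increases along `∇ρ`, so an integration by parts against `∇ρ` bounds the term with its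
derivative independently of the cut-off (`IsDefining.exists_integral_cut_pow_six_le`).
-/

open MeasureTheory TopologicalSpace
open scoped ENNReal NNReal

namespace Zakharov

noncomputable section

open Filter Set Metric Function
open scoped Topology ContDiff Convolution

variable {N : ℕ}

/-! ### Mollification -/

/-- The classical first partial derivative `∂f/∂x_i`. -/
def pd (i : Fin N) (f : RN N → ℝ) (x : RN N) : ℝ :=
  fderiv ℝ f x (EuclideanSpace.single i (1 : ℝ))

/-- The bump function of radius `1 / (n + 1)` centred at the origin. -/
def bump (N n : ℕ) : ContDiffBump (0 : RN N) where
  rIn := 1 / (2 * (n + 1))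
  rOut := 1 / (n + 1)
  rIn_pos := by positivity
  rIn_lt_rOut := by
    apply one_div_lt_one_div_of_lt <;> first | positivity | linarith [(n.cast_nonneg : (0 : ℝ) ≤ n)]

/-- The standard mollification of `f` at scale `1 / (n + 1)`. -/
def mollify (n : ℕ) (f : RN N → ℝ) : RN N → ℝ :=
  (bump N n).normed volume ⋆[ContinuousLinearMap.lsmul ℝ ℝ, volume] f

lemma mollify_apply (n : ℕ) (f : RN N → ℝ) (x : RN N) :
    mollify n f x = ∫ t, (bump N n).normed volume t * f (x - t) := rfl

lemma mollify_apply' (n : ℕ) (f : RN N → ℝ) (x : RN N) :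
    mollify n f x = ∫ t, (bump N n).normed volume (x - t) * f t := by
  rw [mollify, convolution_lsmul_swap]; rfl

lemma contDiff_mollify (n : ℕ) {f : RN N → ℝ} (hf : LocallyIntegrable f) :
    ContDiff ℝ ∞ (mollify n f) :=
  (bump N n).hasCompactSupport_normed.contDiff_convolution_left _
    (bump N n).contDiff_normed hf

lemma mollify_congr (n : ℕ) {f g : RN N → ℝ} (h : f =ᵐ[volume] g) : mollify n f = mollify n g := by
  ext x
  rw [mollify_apply', mollify_apply']
  exact integral_congr_ae (h.mono fun t ht => by simp only [ht])

/-- Jensen's inequality for powers. -/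
lemma rpow_lintegral_le {α : Type*} [MeasurableSpace α] {ν : Measure α} [IsProbabilityMeasure ν]
    {g : α → ℝ≥0∞} (hg : AEMeasurable g ν) {p : ℝ} (hp : 1 ≤ p) :
    (∫⁻ a, g a ∂ν) ^ p ≤ ∫⁻ a, g a ^ p ∂ν := by
  have h := eLpNorm'_le_eLpNorm'_of_exponent_le (f := g) zero_lt_one hp ν hg.aestronglyMeasurable
  simp only [eLpNorm', enorm_eq_self, ENNReal.rpow_one, div_one] at h
  have h2 := ENNReal.rpow_le_rpow h (zero_le_one.trans hp)
  rwa [← ENNReal.rpow_mul, one_div, inv_mul_cancel₀ (by linarith), ENNReal.rpow_one] at h2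

lemma lintegral_bump (n : ℕ) :
    ∫⁻ t, ENNReal.ofReal ((bump N n).normed volume t) = 1 := by
  rw [← ofReal_integral_eq_lintegral_ofReal (bump N n).integrable_normed
    (ae_of_all _ (bump N n).nonneg_normed), (bump N n).integral_normed, ENNReal.ofReal_one]

/-- Young's inequality `‖η * f‖_p ≤ ‖f‖_p` for a mollifier `η`. -/
lemma lintegral_mollify_le (n : ℕ) {f : RN N → ℝ} (hf : AEStronglyMeasurable f)
    {p : ℝ} (hp : 1 ≤ p) :
    ∫⁻ x, ‖mollify n f x‖ₑ ^ p ≤ ∫⁻ x, ‖f x‖ₑ ^ p := by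
  wlog hm : Measurable f generalizing f
  · have h1 := this hf.stronglyMeasurable_mk.aestronglyMeasurable hf.stronglyMeasurable_mk.measurable
    rw [mollify_congr n hf.ae_eq_mk]
    refine h1.trans_eq (lintegral_congr_ae ?_)
    filter_upwards [hf.ae_eq_mk] with x hx
    rw [hx]
  set k : RN N → ℝ≥0∞ := fun t => ENNReal.ofReal ((bump N n).normed volume t) with hk
  have hkm : Measurable k := ((bump N n).continuous_normed.measurable).ennreal_ofReal
  let ν : Measure (RN N) := volume.withDensity k
  have : IsProbabilityMeasure ν := ⟨by
    rw [withDensity_apply _ MeasurableSet.univ, Measure.restrict_univ]; exact lintegral_bump n⟩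
  have h1 : ∀ x, ‖mollify n f x‖ₑ ≤ ∫⁻ t, ‖f (x - t)‖ₑ ∂ν := fun x => by
    rw [mollify_apply]
    refine (enorm_integral_le_lintegral_enorm _).trans_eq ?_
    rw [lintegral_withDensity_eq_lintegral_mul _ hkm (by fun_prop)]
    refine lintegral_congr fun t => ?_
    rw [enorm_mul, Real.enorm_of_nonneg ((bump N n).nonneg_normed t)]; rfl
  calc ∫⁻ x, ‖mollify n f x‖ₑ ^ p
      ≤ ∫⁻ x, ∫⁻ t, ‖f (x - t)‖ₑ ^ p ∂ν := by
        refine lintegral_mono fun x => ?_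
        exact (ENNReal.rpow_le_rpow (h1 x) (zero_le_one.trans hp)).trans
          (rpow_lintegral_le (by fun_prop) hp)
    _ = ∫⁻ t, (∫⁻ x, ‖f (x - t)‖ₑ ^ p) ∂ν := by
        rw [lintegral_lintegral_swap]
        exact Measurable.aemeasurable (by fun_prop)
    _ = ∫⁻ _, (∫⁻ x, ‖f x‖ₑ ^ p) ∂ν := by
        refine lintegral_congr fun t => ?_
        exact lintegral_sub_right_eq_self (fun x => ‖f x‖ₑ ^ p) t
    _ = ∫⁻ x, ‖f x‖ₑ ^ p := by simp

lemma eLpNorm_mollify_le (n : ℕ) {f : RN N → ℝ} (hf : AEStronglyMeasurable f)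
    {p : ℝ≥0∞} (hp : 1 ≤ p) (hp' : p ≠ ⊤) :
    eLpNorm (mollify n f) p ≤ eLpNorm f p := by
  have h0 : p ≠ 0 := (zero_lt_one.trans_le hp).ne'
  rw [eLpNorm_eq_lintegral_rpow_enorm_toReal h0 hp', eLpNorm_eq_lintegral_rpow_enorm_toReal h0 hp']
  have : 1 ≤ p.toReal := by
    rw [← ENNReal.toReal_one]; exact ENNReal.toReal_mono hp' hp
  exact ENNReal.rpow_le_rpow (lintegral_mollify_le n hf this) (by positivity)

lemma tendsto_bump_rOut : Tendsto (fun n => (bump N n).rOut) atTop (𝓝 0) :=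
  tendsto_one_div_add_atTop_nhds_zero_nat

lemma mollify_tendsto_ae {f : RN N → ℝ} (hf : LocallyIntegrable f) :
    ∀ᵐ x, Tendsto (fun n => mollify n f x) atTop (𝓝 (f x)) := by
  refine ContDiffBump.ae_convolution_tendsto_right_of_locallyIntegrable (K := 2)
    tendsto_bump_rOut (Eventually.of_forall fun n => ?_) hf
  show (1 : ℝ) / (n + 1) ≤ 2 * (1 / (2 * (n + 1)))
  apply le_of_eq; field_simp

/-- A mollification vanishes outside a neighbourhood of the set carrying the function. -/
lemma mollify_eq_zero (n : ℕ) {f : RN N → ℝ} {K : Set (RN N)} (hf : ∀ x ∉ K, f x = 0)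
    {x : RN N} (hx : ∀ y ∈ K, 1 / ((n : ℝ) + 1) ≤ dist x y) : mollify n f x = 0 := by
  rw [mollify_apply', integral_eq_zero_of_ae]
  refine ae_of_all _ fun t => ?_
  by_cases ht : t ∈ K
  · have : (bump N n).normed volume (x - t) = 0 := by
      rw [← notMem_support, (bump N n).support_normed_eq]
      simpa [mem_ball, dist_eq_norm, bump] using hx t ht
    simp [this]
  · simp [hf t ht]

lemma tsupport_mollify_subset (n : ℕ) {f : RN N → ℝ} {K : Set (RN N)} (hf : ∀ x ∉ K, f x = 0) :
    tsupport (mollify n f) ⊆ cthickening (1 / ((n : ℝ) + 1)) K := by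
  refine closure_minimal ?_ isClosed_cthickening
  intro x hx
  by_contra h
  refine hx (mollify_eq_zero n hf fun y hy => ?_)
  by_contra h'
  push Not at h'
  exact h (mem_cthickening_of_dist_le x y _ K hy h'.le)

lemma hasCompactSupport_mollify (n : ℕ) {f : RN N → ℝ} {K : Set (RN N)} (hK : IsCompact K)
    (hf : ∀ x ∉ K, f x = 0) : HasCompactSupport (mollify n f) :=
  (hK.cthickening).of_isClosed_subset (isClosed_tsupport _) (tsupport_mollify_subset n hf)

lemma mollify_sub (n : ℕ) {f g : RN N → ℝ} (hf : LocallyIntegrable f) (hg : LocallyIntegrable g) :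
    mollify n (f - g) = mollify n f - mollify n g := by
  ext x
  have h : ∀ {f : RN N → ℝ}, LocallyIntegrable f → Integrable
      (fun t => (bump N n).normed volume t * f (x - t)) := fun hf =>
    ((bump N n).hasCompactSupport_normed.convolutionExists_left
      (ContinuousLinearMap.lsmul ℝ ℝ) (bump N n).continuous_normed hf x)
  simp only [mollify_apply, Pi.sub_apply, mul_sub]
  exact integral_sub (h hf) (h hg)

/-- Mollifications of an `L^p` function converge to it in `L^p`. -/
lemma mollify_tendsto_eLpNorm {f : RN N → ℝ} {p : ℝ≥0∞} (hp : 1 ≤ p) (hp' : p ≠ ⊤)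
    (hf : MemLp f p) :
    Tendsto (fun n => eLpNorm (mollify n f - f) p) atTop (𝓝 0) := by
  rw [ENNReal.tendsto_atTop_zero]
  intro ε hε
  have hε3 : ε / 3 ≠ 0 := (ENNReal.div_pos hε.ne' (by norm_num)).ne'
  obtain ⟨g, hgc, hfg, hgcont, hgL⟩ := hf.exists_hasCompactSupport_eLpNorm_sub_le hp' hε3
  set K := cthickening 1 (tsupport g)
  have hK : IsCompact K := IsCompact.cthickening hgc
  have huc := hgc.uniformContinuous_of_continuous hgcont
  obtain ⟨δ, hδ, hδ'⟩ : ∃ δ : ℝ, 0 < δ ∧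
      ENNReal.ofReal δ * volume K ^ (1 / p.toReal) ≤ ε / 3 := by
    have hv : volume K ^ (1 / p.toReal) ≠ ⊤ :=
      ENNReal.rpow_ne_top_of_nonneg (by positivity) hK.measure_lt_top.ne
    have : Tendsto (fun δ : ℝ => ENNReal.ofReal δ * volume K ^ (1 / p.toReal)) (𝓝[>] 0) (𝓝 0) := by
      have h1 : Tendsto (fun δ : ℝ => ENNReal.ofReal δ) (𝓝[>] 0) (𝓝 0) := by
        have := (ENNReal.continuous_ofReal.tendsto 0).mono_left (nhdsWithin_le_nhds (s := Ioi 0))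
        simpa using this
      simpa using ENNReal.Tendsto.mul_const h1 (Or.inr hv)
    have h2 := this.eventually (ge_mem_nhds (pos_iff_ne_zero.2 hε3))
    obtain ⟨δ, h3, h4⟩ := (h2.and self_mem_nhdsWithin).exists
    exact ⟨δ, h4, h3⟩
  obtain ⟨r, hr, hr'⟩ := Metric.uniformContinuous_iff.1 huc δ hδ
  obtain ⟨n₀, hn₀⟩ := exists_nat_one_div_lt hr
  refine ⟨n₀, fun n hn => ?_⟩
  have hnr : 1 / ((n : ℝ) + 1) < r := lt_of_le_of_lt (by gcongr) hn₀
  have hn1 : 1 / ((n : ℝ) + 1) ≤ 1 := by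
    rw [div_le_one (by positivity)]; linarith [(n.cast_nonneg : (0 : ℝ) ≤ n)]
  have hlf := hf.locallyIntegrable hp
  have hlg := hgL.locallyIntegrable hp
  have hgK : ∀ x ∉ tsupport g, g x = 0 := fun x hx => image_eq_zero_of_notMem_tsupport hx
  have e1 : mollify n f - f = mollify n (f - g) + ((mollify n g - g) + (g - f)) := by
    rw [mollify_sub n hlf hlg]; abel
  have hmg : eLpNorm (mollify n g - g) p ≤ ε / 3 := by
    have h1 : mollify n g - g = K.indicator (mollify n g - g) := by
      symm
      rw [indicator_eq_self]
      intro x hx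
      by_contra hxK
      refine hx ?_
      have h2 : mollify n g x = 0 := by
        by_contra h3
        exact hxK (cthickening_mono hn1 _ (tsupport_mollify_subset n hgK (subset_closure h3)))
      have h3 : g x = 0 := hgK x fun h => hxK (self_subset_cthickening _ h)
      simp [h2, h3]
    rw [h1]
    refine (eLpNorm_mono_real (g := K.indicator fun _ => δ) fun x => ?_).trans ?_
    · by_cases hx : x ∈ K
      · rw [indicator_of_mem hx, indicator_of_mem hx, Pi.sub_apply, ← dist_eq_norm]
        refine (bump N n).dist_normed_convolution_le hgcont.aestronglyMeasurable fun y hy => ?_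
        exact (hr' (lt_trans (mem_ball.1 hy) hnr)).le
      · rw [indicator_of_notMem hx, indicator_of_notMem hx, norm_zero]
    · rw [eLpNorm_indicator_const hK.measurableSet (zero_lt_one.trans_le hp).ne' hp',
        Real.enorm_of_nonneg hδ.le]
      exact hδ'
  rw [e1]
  have m1 : AEStronglyMeasurable (mollify n (f - g)) :=
    (contDiff_mollify n (hlf.sub hlg)).continuous.aestronglyMeasurable
  have m2 : AEStronglyMeasurable (mollify n g) :=
    (contDiff_mollify n hlg).continuous.aestronglyMeasurable
  have m3 := hgcont.aestronglyMeasurable (μ := (volume : Measure (RN N)))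
  calc _ ≤ eLpNorm (mollify n (f - g)) p + (eLpNorm (mollify n g - g) p + eLpNorm (g - f) p) := by
        refine (eLpNorm_add_le m1 ((m2.sub m3).add (m3.sub hf.1)) hp).trans ?_
        gcongr
        exact eLpNorm_add_le (m2.sub m3) (m3.sub hf.1) hp
    _ ≤ ε / 3 + (ε / 3 + ε / 3) := by
        gcongr
        · exact (eLpNorm_mollify_le n (hf.1.sub m3) hp hp').trans hfg
        · rw [eLpNorm_sub_comm]; exact hfg
    _ = ε := by rw [← add_assoc, ENNReal.add_thirds]

/-- If `g` is the weak derivative of `f` on the whole space then mollification commutes with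
differentiation. -/
lemma pd_mollify (n : ℕ) {f g : RN N → ℝ} (i : Fin N) (hf : LocallyIntegrable f)
    (h : ∀ φ : RN N → ℝ, ContDiff ℝ ∞ φ → HasCompactSupport φ →
      ∫ x, f x * pd i φ x = -∫ x, g x * φ x) :
    pd i (mollify n f) = mollify n g := by
  ext x
  have hc := (bump N n).hasCompactSupport_normed (μ := volume)
  have hs : ContDiff ℝ ∞ ((bump N n).normed volume) := (bump N n).contDiff_normed
  have h1 := hc.hasFDerivAt_convolution_left (ContinuousLinearMap.lsmul ℝ ℝ)
    (hs.of_le (by exact_mod_cast le_top)) hf x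
  have hφs : ContDiff ℝ ∞ fun t => (bump N n).normed volume (x - t) :=
    hs.comp (contDiff_const.sub contDiff_id)
  have hφc : HasCompactSupport fun t => (bump N n).normed volume (x - t) := by
    exact hc.comp_homeomorph (Homeomorph.subLeft x)
  have h2 := h _ hφs hφc
  have h3 : ∀ t, pd i (fun t => (bump N n).normed volume (x - t)) t
      = - pd i ((bump N n).normed volume) (x - t) := fun t => by
    simp only [pd]
    have hd : HasFDerivAt ((bump N n).normed volume) (fderiv ℝ ((bump N n).normed volume) (x - t))
        (x - t) := (hs.differentiable (by simp) _).hasFDerivAt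
    have := (hd.comp t ((hasFDerivAt_const x t).sub (hasFDerivAt_id t))).fderiv
    simp only [comp_def] at this
    erw [this]
    simp
  rw [pd, mollify, h1.fderiv, mollify_apply']
  have hex := (hc.fderiv ℝ).convolutionExists_left
    (ContinuousLinearMap.precompL (RN N) (ContinuousLinearMap.lsmul ℝ ℝ))
    (hs.continuous_fderiv (by simp)) hf x
  rw [convolution_eq_swap, ContinuousLinearMap.integral_apply hex.integrable_swap]
  simp only [h3, mul_neg, integral_neg, neg_inj] at h2
  rw [show (∫ t, (bump N n).normed volume (x - t) * g t)
    = ∫ t, g t * (bump N n).normed volume (x - t) by simp only [mul_comm], ← h2]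
  refine integral_congr_ae (ae_of_all _ fun t => ?_)
  exact mul_comm _ _

/-! ### Weak gradients in `L²` -/

/-- Lebesgue measure on `Ω`. -/
abbrev vol (Ω : Opens (RN N)) : Measure (RN N) := volume.restrict (Ω : Set (RN N))

/-- `φ ∈ C_c^1(U)`, extended by zero to the whole space. -/
structure IsTest (U : Set (RN N)) (φ : RN N → ℝ) : Prop where
  contDiff : ContDiff ℝ 1 φ
  compact : HasCompactSupport φ
  subset : tsupport φ ⊆ U

lemma pd_mul {f g : RN N → ℝ} (hf : ContDiff ℝ 1 f) (hg : ContDiff ℝ 1 g) (i : Fin N) (x : RN N) :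
    pd i (fun x => f x * g x) x = f x * pd i g x + pd i f x * g x := by
  simp only [pd]
  rw [fderiv_fun_mul (hf.differentiable one_ne_zero _) (hg.differentiable one_ne_zero _)]
  simp [mul_comm]

lemma contDiff_pd {f : RN N → ℝ} {m n : WithTop ℕ∞} (hf : ContDiff ℝ n f) (hmn : m + 1 ≤ n)
    (i : Fin N) : ContDiff ℝ m (pd i f) :=
  (hf.fderiv_right hmn).clm_apply contDiff_const

lemma hasCompactSupport_pd {f : RN N → ℝ} (hf : HasCompactSupport f) (i : Fin N) :
    HasCompactSupport (pd i f) :=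
  hf.fderiv_apply ℝ _

lemma tsupport_pd_subset (f : RN N → ℝ) (i : Fin N) : tsupport (pd i f) ⊆ tsupport f :=
  tsupport_fderiv_apply_subset ℝ _

/-- Symmetry of second derivatives. -/
lemma pd_comm {f : RN N → ℝ} (hf : ContDiff ℝ 2 f) (i j : Fin N) (x : RN N) :
    pd i (pd j f) x = pd j (pd i f) x := by
  have h1 : ContDiff ℝ 1 (fderiv ℝ f) := hf.fderiv_right (by norm_num)
  have h2 : ∀ v w : RN N, fderiv ℝ (fun y => fderiv ℝ f y v) x w = fderiv ℝ (fderiv ℝ f) x w v := by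
    intro v w
    have : HasFDerivAt (fun y => fderiv ℝ f y v) _ x :=
      (h1.differentiable one_ne_zero x).hasFDerivAt.clm_apply (hasFDerivAt_const v x)
    rw [this.fderiv]; simp
  have h3 : IsSymmSndFDerivAt ℝ f x :=
    (hf.contDiffAt).isSymmSndFDerivAt (by simp)
  unfold pd
  rw [h2, h2]
  exact h3 _ _

namespace IsTest

variable {U V : Set (RN N)} {φ ψ : RN N → ℝ}

lemma continuous_pd (h : IsTest U φ) (i : Fin N) : Continuous (pd i φ) :=
  (contDiff_pd h.contDiff (m := 0) (by norm_num) i).continuous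

lemma mono (h : IsTest U φ) (hUV : U ⊆ V) : IsTest V φ :=
  ⟨h.contDiff, h.compact, h.subset.trans hUV⟩

lemma toUniv (h : IsTest U φ) : IsTest univ φ := h.mono (subset_univ _)

lemma mul_left (h : IsTest U φ) (hψ : ContDiff ℝ 1 ψ) : IsTest U fun x => ψ x * φ x :=
  ⟨hψ.mul h.contDiff, h.compact.mul_left, (tsupport_mul_subset_right).trans h.subset⟩

lemma mul_right (h : IsTest U φ) (hψ : ContDiff ℝ 1 ψ) : IsTest U fun x => φ x * ψ x :=
  ⟨h.contDiff.mul hψ, h.compact.mul_right, (tsupport_mul_subset_left).trans h.subset⟩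

lemma add (h : IsTest U φ) (h' : IsTest U ψ) : IsTest U fun x => φ x + ψ x :=
  ⟨h.contDiff.add h'.contDiff, h.compact.add h'.compact,
    (tsupport_add φ ψ).trans (union_subset h.subset h'.subset)⟩

lemma sum {ι : Type*} {s : Finset ι} {φ : ι → RN N → ℝ} (h : ∀ j ∈ s, IsTest U (φ j)) :
    IsTest U fun x => ∑ j ∈ s, φ j x := by
  classical
  induction s using Finset.induction_on with
  | empty =>
    simp only [Finset.sum_empty]
    exact ⟨contDiff_const, HasCompactSupport.zero, by simp [tsupport]⟩
  | insert a s ha ih =>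
    simp only [Finset.sum_insert ha]
    exact (h a (by simp)).add (ih fun j hj => h j (by simp [hj]))

lemma pd_test (h : IsTest U φ) (h2 : ContDiff ℝ 2 φ) (i : Fin N) : IsTest U (pd i φ) :=
  ⟨contDiff_pd h2 (by norm_num) i, hasCompactSupport_pd h.compact i,
    (tsupport_pd_subset φ i).trans h.subset⟩

lemma memLp (h : IsTest U φ) (p : ℝ≥0∞) (μ : Measure (RN N)) [IsFiniteMeasureOnCompacts μ] :
    MemLp φ p μ :=
  h.contDiff.continuous.memLp_of_hasCompactSupport h.compact

lemma memLp_pd (h : IsTest U φ) (i : Fin N) (p : ℝ≥0∞) (μ : Measure (RN N))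
    [IsFiniteMeasureOnCompacts μ] : MemLp (pd i φ) p μ :=
  (h.continuous_pd i).memLp_of_hasCompactSupport (hasCompactSupport_pd h.compact i)

lemma bounded (h : IsTest U φ) : ∃ C, 0 ≤ C ∧ ∀ x, |φ x| ≤ C := by
  obtain ⟨C, hC⟩ := h.contDiff.continuous.bounded_above_of_compact_support h.compact
  exact ⟨C, (norm_nonneg _).trans (hC 0), hC⟩

lemma bounded_pd (h : IsTest U φ) : ∃ C, 0 ≤ C ∧ ∀ i x, |pd i φ x| ≤ C := by
  have : ∀ i, ∃ C, ∀ x, ‖pd i φ x‖ ≤ C := fun i =>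
    (h.continuous_pd i).bounded_above_of_compact_support (hasCompactSupport_pd h.compact i)
  choose C hC using this
  refine ⟨∑ i, |C i|, Finset.sum_nonneg fun _ _ => abs_nonneg _, fun i x => ?_⟩
  exact ((hC i x).trans (le_abs_self _)).trans
    (Finset.single_le_sum (f := fun i => |C i|) (fun _ _ => abs_nonneg _) (Finset.mem_univ i))

/-- Multiplication by a test function preserves `L^p`. -/
lemma memLp_mul (h : IsTest U φ) {f : RN N → ℝ} {p : ℝ≥0∞} {μ : Measure (RN N)}
    (hf : MemLp f p μ) : MemLp (fun x => φ x * f x) p μ := by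
  obtain ⟨C, -, hC⟩ := h.bounded
  refine hf.of_le_mul (c := C) (h.contDiff.continuous.aestronglyMeasurable.mul hf.1)
    (ae_of_all _ fun x => ?_)
  rw [norm_mul]; exact mul_le_mul_of_nonneg_right (hC x) (norm_nonneg _)

lemma memLp_pd_mul (h : IsTest U φ) (i : Fin N) {f : RN N → ℝ} {p : ℝ≥0∞} {μ : Measure (RN N)}
    (hf : MemLp f p μ) : MemLp (fun x => pd i φ x * f x) p μ := by
  obtain ⟨C, -, hC⟩ := h.bounded_pd
  refine hf.of_le_mul (c := C) ((h.continuous_pd i).aestronglyMeasurable.mul hf.1)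
    (ae_of_all _ fun x => ?_)
  rw [norm_mul]; exact mul_le_mul_of_nonneg_right (hC i x) (norm_nonneg _)

end IsTest

/-- Classical integration by parts. -/
lemma integral_mul_pd {φ ψ : RN N → ℝ} (hφ : ContDiff ℝ 1 φ) (hψ : IsTest univ ψ) (i : Fin N) :
    ∫ x, φ x * pd i ψ x = -∫ x, pd i φ x * ψ x := by
  have c1 : Continuous (pd i φ) := (contDiff_pd hφ (m := 0) (by norm_num) i).continuous
  refine integral_mul_fderiv_eq_neg_fderiv_mul_of_integrable ?_ ?_ ?_
    (fun x _ => hφ.differentiable one_ne_zero x)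
    (fun x _ => hψ.contDiff.differentiable one_ne_zero x)
  · exact (c1.mul hψ.contDiff.continuous).integrable_of_hasCompactSupport hψ.compact.mul_left
  · exact (hφ.continuous.mul (hψ.continuous_pd i)).integrable_of_hasCompactSupport
      (hasCompactSupport_pd hψ.compact i).mul_left
  · exact (hφ.continuous.mul hψ.contDiff.continuous).integrable_of_hasCompactSupport
      hψ.compact.mul_left

lemma integral_mul_eq_inner {α : Type*} [MeasurableSpace α] {μ : Measure α} {f g : α → ℝ}
    (hf : MemLp f 2 μ) (hg : MemLp g 2 μ) :
    ∫ x, f x * g x ∂μ = inner ℝ (hg.toLp g) (hf.toLp f) := by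
  rw [L2.inner_def]
  refine integral_congr_ae ?_
  filter_upwards [hf.coeFn_toLp, hg.coeFn_toLp] with x hx hx'
  rw [hx, hx']; simp

/-- The Cauchy-Schwarz inequality. -/
lemma integral_mul_sq_le {α : Type*} [MeasurableSpace α] {μ : Measure α} {f g : α → ℝ}
    (hf : MemLp f 2 μ) (hg : MemLp g 2 μ) :
    (∫ x, f x * g x ∂μ) ^ 2 ≤ (∫ x, f x ^ 2 ∂μ) * ∫ x, g x ^ 2 ∂μ := by
  simp only [sq (f _), sq (g _)]
  rw [integral_mul_eq_inner hf hg, integral_mul_eq_inner hf hf, integral_mul_eq_inner hg hg, sq,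
    mul_comm (inner ℝ (hf.toLp f) _)]
  exact real_inner_mul_inner_self_le _ _

/-- `∫ f_n g_n → ∫ f g` when `f_n → f` and `g_n → g` in `L²`. -/
lemma tendsto_integral_mul {α : Type*} [MeasurableSpace α] {μ : Measure α} {f g : α → ℝ}
    {F G : ℕ → α → ℝ} (hf : MemLp f 2 μ) (hg : MemLp g 2 μ) (hF : ∀ n, MemLp (F n) 2 μ)
    (hG : ∀ n, MemLp (G n) 2 μ) (h1 : Tendsto (fun n => eLpNorm (F n - f) 2 μ) atTop (𝓝 0))
    (h2 : Tendsto (fun n => eLpNorm (G n - g) 2 μ) atTop (𝓝 0)) :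
    Tendsto (fun n => ∫ x, F n x * G n x ∂μ) atTop (𝓝 (∫ x, f x * g x ∂μ)) := by
  rw [integral_mul_eq_inner hf hg]
  simp_rw [fun n => integral_mul_eq_inner (hF n) (hG n)]
  exact Tendsto.inner ((Lp.tendsto_Lp_iff_tendsto_eLpNorm'' _ hG _ hg).2 h2)
    ((Lp.tendsto_Lp_iff_tendsto_eLpNorm'' _ hF _ hf).2 h1)

lemma tendsto_integral_mul_const {α : Type*} [MeasurableSpace α] {μ : Measure α} {f g : α → ℝ}
    {G : ℕ → α → ℝ} (hf : MemLp f 2 μ) (hg : MemLp g 2 μ)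
    (hG : ∀ n, MemLp (G n) 2 μ) (h2 : Tendsto (fun n => eLpNorm (G n - g) 2 μ) atTop (𝓝 0)) :
    Tendsto (fun n => ∫ x, f x * G n x ∂μ) atTop (𝓝 (∫ x, f x * g x ∂μ)) :=
  tendsto_integral_mul hf hg (fun _ => hf) hG (by simp) h2

/-- Multiplication by a bounded function is continuous on `L^p`. -/
lemma tendsto_eLpNorm_mul {α : Type*} [MeasurableSpace α] {μ : Measure α} {a f : α → ℝ}
    {F : ℕ → α → ℝ} {C : ℝ} {p : ℝ≥0∞} (hC : ∀ x, |a x| ≤ C)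
    (hF : Tendsto (fun n => eLpNorm (F n - f) p μ) atTop (𝓝 0)) :
    Tendsto (fun n => eLpNorm ((fun x => a x * F n x) - fun x => a x * f x) p μ)
      atTop (𝓝 0) := by
  have h0 := ENNReal.Tendsto.const_mul (a := ENNReal.ofReal C) hF (Or.inr ENNReal.ofReal_ne_top)
  rw [mul_zero] at h0
  refine tendsto_of_tendsto_of_tendsto_of_le_of_le tendsto_const_nhds h0 (fun _ => zero_le)
    fun n => ?_
  refine eLpNorm_le_mul_eLpNorm_of_ae_le_mul (ae_of_all _ fun x => ?_) p
  simp only [Pi.sub_apply, ← mul_sub, norm_mul]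
  exact mul_le_mul_of_nonneg_right (hC x) (norm_nonneg _)

lemma integrable_mul_of_L2 {α : Type*} [MeasurableSpace α] {μ : Measure α} {f g : α → ℝ}
    (hf : MemLp f 2 μ) (hg : MemLp g 2 μ) : Integrable (fun x => f x * g x) μ :=
  hf.integrable_mul hg

/-- `f` and `g i` lie in `L²(Ω)` and `g i` is the weak derivative `∂f/∂x_i`, tested against
`C_c^1(U)`. For `U = Ω` this says `f ∈ W^{1,2}(Ω)` with gradient `g`; for `U` the whole space
it says that the extension of `f` by zero lies in `W^{1,2}(ℝ^N)`. -/
structure IsH1 (Ω : Opens (RN N)) (U : Set (RN N)) (f : RN N → ℝ) (g : Fin N → RN N → ℝ) :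
    Prop where
  memLp : MemLp f 2 (vol Ω)
  memLp_grad : ∀ i, MemLp (g i) 2 (vol Ω)
  rel : ∀ i φ, IsTest U φ → ∫ x, f x * pd i φ x ∂(vol Ω) = -∫ x, g i x * φ x ∂(vol Ω)

namespace IsH1

variable {Ω : Opens (RN N)} {U V : Set (RN N)} {f f' : RN N → ℝ} {g g' : Fin N → RN N → ℝ}

lemma mono (h : IsH1 Ω V f g) (hUV : U ⊆ V) : IsH1 Ω U f g :=
  ⟨h.memLp, h.memLp_grad, fun i φ hφ => h.rel i φ (hφ.mono hUV)⟩

lemma congr (h : IsH1 Ω U f g) (hf : f =ᵐ[vol Ω] f') (hg : ∀ i, g i =ᵐ[vol Ω] g' i) :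
    IsH1 Ω U f' g' := by
  refine ⟨h.memLp.ae_eq hf, fun i => (h.memLp_grad i).ae_eq (hg i), fun i φ hφ => ?_⟩
  have h1 := h.rel i φ hφ
  have e1 : ∫ x, f x * pd i φ x ∂(vol Ω) = ∫ x, f' x * pd i φ x ∂(vol Ω) :=
    integral_congr_ae (hf.mono fun x hx => by simp only [hx])
  have e2 : ∫ x, g i x * φ x ∂(vol Ω) = ∫ x, g' i x * φ x ∂(vol Ω) :=
    integral_congr_ae ((hg i).mono fun x hx => by simp only [hx])
  rw [← e1, ← e2, h1]

lemma add (h : IsH1 Ω U f g) (h' : IsH1 Ω U f' g') :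
    IsH1 Ω U (fun x => f x + f' x) (fun i x => g i x + g' i x) := by
  refine ⟨h.memLp.add h'.memLp, fun i => (h.memLp_grad i).add (h'.memLp_grad i), fun i φ hφ => ?_⟩
  have m1 := hφ.memLp_pd i 2 (vol Ω)
  have m2 := hφ.memLp 2 (vol Ω)
  simp only [add_mul]
  rw [integral_add (integrable_mul_of_L2 h.memLp m1) (integrable_mul_of_L2 h'.memLp m1),
    integral_add (integrable_mul_of_L2 (h.memLp_grad i) m2) (integrable_mul_of_L2
        (h'.memLp_grad i) m2),
    h.rel i φ hφ, h'.rel i φ hφ]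
  ring

lemma const_mul (h : IsH1 Ω U f g) (c : ℝ) :
    IsH1 Ω U (fun x => c * f x) (fun i x => c * g i x) := by
  refine ⟨h.memLp.const_mul c, fun i => (h.memLp_grad i).const_mul c, fun i φ hφ => ?_⟩
  simp only [mul_assoc, integral_const_mul, h.rel i φ hφ]
  ring

lemma sub (h : IsH1 Ω U f g) (h' : IsH1 Ω U f' g') :
    IsH1 Ω U (fun x => f x - f' x) (fun i x => g i x - g' i x) := by
  simpa [sub_eq_add_neg] using h.add (h'.const_mul (-1))

lemma zero : IsH1 Ω U (fun _ => 0) (fun _ _ => 0) :=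
  ⟨MemLp.zero, fun _ => MemLp.zero, by simp⟩

lemma sum {ι : Type*} {s : Finset ι} {f : ι → RN N → ℝ} {g : ι → Fin N → RN N → ℝ}
    (h : ∀ j ∈ s, IsH1 Ω U (f j) (g j)) :
    IsH1 Ω U (fun x => ∑ j ∈ s, f j x) (fun i x => ∑ j ∈ s, g j i x) := by
  classical
  induction s using Finset.induction_on with
  | empty => simpa using zero
  | insert a s ha ih =>
    simp only [Finset.sum_insert ha]
    exact (h a (by simp)).add (ih fun j hj => h j (by simp [hj]))

/-- The product rule. The class of test functions may change, which is how a cut-off turns an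
element of `W^{1,2}(Ω)` into one whose extension by zero is weakly differentiable. -/
lemma mul_of_forall {a : RN N → ℝ} (ha : IsTest univ a) (h : IsH1 Ω U f g)
    (hUV : ∀ φ, IsTest V φ → IsTest U fun x => a x * φ x) :
    IsH1 Ω V (fun x => a x * f x) (fun i x => a x * g i x + pd i a x * f x) := by
  refine ⟨ha.memLp_mul h.memLp, fun i => (ha.memLp_mul (h.memLp_grad i)).add
    (ha.memLp_pd_mul i h.memLp), fun i φ hφ => ?_⟩
  have h1 := h.rel i _ (hUV φ hφ)
  have m0 := integrable_mul_of_L2 (ha.memLp_mul h.memLp) (hφ.memLp_pd i 2 (vol Ω))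
  have m1 := integrable_mul_of_L2 (ha.memLp_pd_mul i h.memLp) (hφ.memLp 2 (vol Ω))
  have m2 := integrable_mul_of_L2 (ha.memLp_mul (h.memLp_grad i)) (hφ.memLp 2 (vol Ω))
  simp only [pd_mul ha.contDiff hφ.contDiff] at h1
  have e1 : ∫ x, f x * (a x * pd i φ x + pd i a x * φ x) ∂(vol Ω)
      = ∫ x, a x * f x * pd i φ x ∂(vol Ω) + ∫ x, pd i a x * f x * φ x ∂(vol Ω) := by
    rw [← integral_add m0 m1]; congr 1; ext x; ring
  have e2 : ∫ x, (a x * g i x + pd i a x * f x) * φ x ∂(vol Ω)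
      = ∫ x, g i x * (a x * φ x) ∂(vol Ω) + ∫ x, pd i a x * f x * φ x ∂(vol Ω) := by
    rw [show (fun x => g i x * (a x * φ x)) = fun x => a x * g i x * φ x by ext x; ring,
      ← integral_add m2 m1]; congr 1; ext x; ring
  rw [e2]
  linarith

lemma mul {a : RN N → ℝ} (ha : IsTest univ a) (h : IsH1 Ω U f g) :
    IsH1 Ω U (fun x => a x * f x) (fun i x => a x * g i x + pd i a x * f x) :=
  h.mul_of_forall ha fun _ hφ => hφ.mul_left ha.contDiff

lemma mul_cutoff {a : RN N → ℝ} (ha : IsTest U a) (h : IsH1 Ω U f g) :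
    IsH1 Ω univ (fun x => a x * f x) (fun i x => a x * g i x + pd i a x * f x) :=
  h.mul_of_forall ha.toUniv fun _ hφ => ha.mul_right hφ.contDiff

end IsH1

lemma contDiff_one_of_smooth {φ : RN N → ℝ} (h : ContDiff ℝ ∞ φ) : ContDiff ℝ 1 φ :=
  h.of_le (by exact_mod_cast le_top)

/-- The mollification of `f ∈ L²` carried by a compact set is a test function near that set. -/
lemma isTest_mollify {f : RN N → ℝ} {K U : Set (RN N)} (hK : IsCompact K) (hf : MemLp f 2 volume)
    (hfK : ∀ x ∉ K, f x = 0) {n : ℕ} (hU : cthickening (1 / ((n : ℝ) + 1)) K ⊆ U) :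
    IsTest U (mollify n f) :=
  ⟨contDiff_one_of_smooth (contDiff_mollify n (hf.locallyIntegrable one_le_two)),
    hasCompactSupport_mollify n hK hfK, (tsupport_mollify_subset n hfK).trans hU⟩

lemma eventually_cthickening_subset {K U : Set (RN N)} (hK : IsCompact K) (hU : IsOpen U)
    (hKU : K ⊆ U) : ∀ᶠ n : ℕ in atTop, cthickening (1 / ((n : ℝ) + 1)) K ⊆ U := by
  obtain ⟨δ, hδ, h⟩ := hK.exists_cthickening_subset_open hU hKU
  filter_upwards [(tendsto_one_div_add_atTop_nhds_zero_nat (𝕜 := ℝ)).eventually (ge_mem_nhds hδ)]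
    with n hn
  exact (cthickening_mono hn K).trans h

/-- Smooth test functions suffice to verify membership in `W^{1,2}(Ω)`. -/
lemma IsH1.of_smooth {Ω : Opens (RN N)} {f : RN N → ℝ} {g : Fin N → RN N → ℝ}
    (hf : MemLp f 2 (vol Ω)) (hg : ∀ i, MemLp (g i) 2 (vol Ω))
    (h : ∀ i φ, ContDiff ℝ ∞ φ → HasCompactSupport φ → tsupport φ ⊆ Ω →
      ∫ x, f x * pd i φ x ∂(vol Ω) = -∫ x, g i x * φ x ∂(vol Ω)) : IsH1 Ω Ω f g := by
  refine ⟨hf, hg, fun i φ hφ => ?_⟩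
  have hL := hφ.memLp 2 volume
  have hL' := hφ.memLp_pd i 2 volume
  have hK : IsCompact (tsupport φ) := hφ.compact
  have h0 : ∀ x ∉ tsupport φ, φ x = 0 := fun x hx => image_eq_zero_of_notMem_tsupport hx
  have hev := eventually_cthickening_subset hK Ω.isOpen hφ.subset
  have hpd : ∀ n, pd i (mollify n φ) = mollify n (pd i φ) := fun n =>
    pd_mollify n i (hL.locallyIntegrable one_le_two) fun ψ hψ hψc =>
      integral_mul_pd hφ.contDiff ⟨contDiff_one_of_smooth hψ, hψc, subset_univ _⟩ i
  have hT : ∀ n, IsTest univ (mollify n φ) := fun n => isTest_mollify hK hL h0 (subset_univ _)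
  have t1 := mollify_tendsto_eLpNorm one_le_two (by simp) hL
  have t2 := mollify_tendsto_eLpNorm one_le_two (by simp) hL'
  have r : ∀ {F : ℕ → RN N → ℝ}, Tendsto (fun n => eLpNorm (F n) 2 volume) atTop (𝓝 0) →
      Tendsto (fun n => eLpNorm (F n) 2 (vol Ω)) atTop (𝓝 0) := fun h =>
    tendsto_of_tendsto_of_tendsto_of_le_of_le tendsto_const_nhds h (fun _ => zero_le)
      fun n => eLpNorm_mono_measure _ Measure.restrict_le_self
  have l1 := tendsto_integral_mul_const hf (hφ.memLp_pd i 2 (vol Ω))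
    (fun n => by rw [← hpd]; exact (hT n).memLp_pd i 2 _) (r t2)
  have l2 := tendsto_integral_mul_const (hg i) (hφ.memLp 2 (vol Ω))
    (fun n => (hT n).memLp 2 _) (r t1)
  refine tendsto_nhds_unique (l1.congr' ?_) l2.neg
  filter_upwards [hev] with n hn
  rw [← hpd]
  exact h i _ (contDiff_mollify n (hL.locallyIntegrable one_le_two)) (hT n).compact
    ((tsupport_mollify_subset n h0).trans hn)

/-- If the extension of `f` by zero lies in `W^{1,2}(ℝ^N)` and is carried by the compact set `K`,
then its mollifications converge to `f` in `W^{1,2}(Ω)`. -/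
lemma IsH1.exists_approx {Ω : Opens (RN N)} {f : RN N → ℝ} {g : Fin N → RN N → ℝ}
    (h : IsH1 Ω univ f g) {K : Set (RN N)} (hK : IsCompact K)
    (hfK : ∀ x ∈ Ω, x ∉ K → f x = 0) :
    ∃ φ : ℕ → RN N → ℝ, (∀ n, ContDiff ℝ ∞ (φ n)) ∧ (∀ n, IsTest univ (φ n)) ∧
      (∀ n, tsupport (φ n) ⊆ cthickening (1 / ((n : ℝ) + 1)) K) ∧
      Tendsto (fun n => eLpNorm (φ n - f) 2 (vol Ω)) atTop (𝓝 0) ∧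
      (∀ i, Tendsto (fun n => eLpNorm (pd i (φ n) - g i) 2 (vol Ω)) atTop (𝓝 0)) ∧
      (∀ i p, 1 ≤ p → p ≠ ⊤ → ∀ n, eLpNorm (pd i (φ n)) p volume ≤ eLpNorm (g i) p (vol Ω)) ∧
      ∀ᵐ x ∂(vol Ω), Tendsto (fun n => φ n x) atTop (𝓝 (f x)) := by
  set F : RN N → ℝ := (Ω : Set (RN N)).indicator f with hF
  set G : Fin N → RN N → ℝ := fun i => (Ω : Set (RN N)).indicator (g i) with hG
  have mΩ : MeasurableSet (Ω : Set (RN N)) := Ω.isOpen.measurableSet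
  have hFL : MemLp F 2 volume := (memLp_indicator_iff_restrict mΩ).2 h.memLp
  have hGL : ∀ i, MemLp (G i) 2 volume := fun i =>
      (memLp_indicator_iff_restrict mΩ).2 (h.memLp_grad i)
  have hFl := hFL.locallyIntegrable one_le_two
  have h0 : ∀ x ∉ K, F x = 0 := fun x hx => by
    by_cases hxΩ : x ∈ (Ω : Set (RN N))
    · rw [hF, indicator_of_mem hxΩ]; exact hfK x hxΩ hx
    · rw [hF, indicator_of_notMem hxΩ]
  have hpd : ∀ i n, pd i (mollify n F) = mollify n (G i) := fun i n =>
    pd_mollify n i hFl fun ψ hψ hψc => by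
      have := h.rel i ψ ⟨contDiff_one_of_smooth hψ, hψc, subset_univ _⟩
      simp only [hF, hG, ← indicator_mul_left]
      rw [integral_indicator mΩ, integral_indicator mΩ]
      exact this
  have r : ∀ (φ : ℕ → RN N → ℝ) (f : RN N → ℝ),
      Tendsto (fun n => eLpNorm (φ n - (Ω : Set (RN N)).indicator f) 2 volume) atTop (𝓝 0) →
      Tendsto (fun n => eLpNorm (φ n - f) 2 (vol Ω)) atTop (𝓝 0) := fun φ f h =>
    tendsto_of_tendsto_of_tendsto_of_le_of_le tendsto_const_nhds h (fun _ => zero_le) fun n => by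
      rw [eLpNorm_congr_ae (g := φ n - (Ω : Set (RN N)).indicator f)]
      · exact eLpNorm_mono_measure _ Measure.restrict_le_self
      · filter_upwards [ae_restrict_mem mΩ] with x hx
        simp [indicator_of_mem hx]
  refine ⟨fun n => mollify n F, fun n => contDiff_mollify n hFl,
    fun n => isTest_mollify hK hFL h0 (subset_univ _), fun n => tsupport_mollify_subset n h0,
    r _ _ (mollify_tendsto_eLpNorm one_le_two (by simp) hFL), fun i => ?_,
        fun i p hp hp' n => ?_, ?_⟩
  · simp only [hpd]
    exact r _ _ (mollify_tendsto_eLpNorm one_le_two (by simp) (hGL i))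
  · rw [hpd, ← eLpNorm_indicator_eq_eLpNorm_restrict mΩ]
    exact eLpNorm_mollify_le n (hGL i).1 hp hp'
  · have := ae_restrict_of_ae (s := (Ω : Set (RN N))) (mollify_tendsto_ae hFl)
    filter_upwards [this, ae_restrict_mem mΩ] with x hx hxΩ
    rwa [hF, indicator_of_mem hxΩ] at hx

/-! ### A global defining function -/

/-- Near each point of the closure, `Ω` is the positivity set of a `C^4` function whose gradient
does not vanish at the boundary points of `Ω`. -/
lemma exists_local_definingFunction {Ω : Opens (RN N)} {η : ℝ≥0} (h : HasHolderBoundary 4 η Ω)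
    {x : RN N} (hx : x ∈ closure (Ω : Set (RN N))) :
    ∃ r : ℝ, 0 < r ∧ ∃ σ : RN N → ℝ, ContDiffOn ℝ 4 σ (ball x r) ∧
      (∀ y ∈ ball x r, y ∈ Ω ↔ 0 < σ y) ∧
      ∀ y ∈ ball x r, y ∈ frontier (Ω : Set (RN N)) → ∃ v, 0 < fderiv ℝ σ y v := by
  by_cases hxΩ : x ∈ (Ω : Set (RN N))
  · obtain ⟨r, hr, hrΩ⟩ := Metric.isOpen_iff.1 Ω.isOpen x hxΩ
    refine ⟨r, hr, fun _ => 1, contDiffOn_const, fun y hy => ?_, fun y hy hyf => ?_⟩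
    · simp only [zero_lt_one, iff_true]; exact hrΩ hy
    · rw [Ω.isOpen.frontier_eq] at hyf
      exact absurd (hrΩ hy) hyf.2
  · have hxf : x ∈ frontier (Ω : Set (RN N)) := by
      rw [Ω.isOpen.frontier_eq]; exact ⟨hx, hxΩ⟩
    obtain ⟨ψ, r, i, hr, hs, h1, h2, h3, -⟩ := h x hxf
    have hψ : ContDiffOn ℝ 4 ψ ψ.source := h1.1
    have hψ' : ContDiffOn ℝ 4 ψ.symm ψ.target := h2.1
    refine ⟨r, hr, fun y => ψ y i, ?_⟩
    rw [← hs]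
    refine ⟨fun y hy => (contDiffWithinAt_euclidean.1 (hψ y hy)) i, h3, fun y hy _ => ?_⟩
    have d1 : HasFDerivAt ψ (fderiv ℝ ψ y) y :=
      ((hψ.contDiffAt (ψ.open_source.mem_nhds hy)).differentiableAt (by norm_num)).hasFDerivAt
    have hy' := ψ.map_source hy
    have d2 : HasFDerivAt ψ.symm (fderiv ℝ ψ.symm (ψ y)) (ψ y) :=
      ((hψ'.contDiffAt (ψ.open_target.mem_nhds hy')).differentiableAt (by norm_num)).hasFDerivAt
    have d1' : HasFDerivAt ψ (fderiv ℝ ψ y) (ψ.symm (ψ y)) := by rwa [ψ.left_inv hy]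
    have d3 := d1'.comp (ψ y) d2
    have d4 : HasFDerivAt (ψ ∘ ψ.symm) (ContinuousLinearMap.id ℝ (RN N)) (ψ y) := by
      refine (hasFDerivAt_id (ψ y)).congr_of_eventuallyEq ?_
      filter_upwards [ψ.open_target.mem_nhds hy'] with z hz
      simp [ψ.right_inv hz]
    have d5 := d3.unique d4
    refine ⟨fderiv ℝ ψ.symm (ψ y) (EuclideanSpace.single i 1), ?_⟩
    have d6 : HasFDerivAt (fun y => ψ y i)
        ((EuclideanSpace.proj i : RN N →L[ℝ] ℝ).comp (fderiv ℝ ψ y)) y :=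
      (EuclideanSpace.proj i : RN N →L[ℝ] ℝ).hasFDerivAt.comp y d1
    rw [d6.fderiv]
    have := congrArg (fun L : RN N →L[ℝ] RN N => L (EuclideanSpace.single i 1) i) d5
    simp only [ContinuousLinearMap.comp_apply, ContinuousLinearMap.id_apply] at this
    simp only [ContinuousLinearMap.comp_apply, EuclideanSpace.coe_proj]
    rw [this]; simp

lemma nonneg_of_hasDerivAt {f : ℝ → ℝ} {d : ℝ} (hf : HasDerivAt f d 0) (h0 : f 0 = 0)
    (h : ∀ᶠ t in 𝓝[>] (0 : ℝ), 0 ≤ f t) : 0 ≤ d := by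
  refine ge_of_tendsto hf.tendsto_slope_zero_right ?_
  filter_upwards [h, self_mem_nhdsWithin] with t ht ht0
  have : (0 : ℝ) < t := ht0
  simp only [zero_add, h0, sub_zero, smul_eq_mul]
  positivity

lemma pos_of_hasDerivAt {f : ℝ → ℝ} {d : ℝ} (hf : HasDerivAt f d 0) (h0 : f 0 = 0) (hd : 0 < d) :
    ∀ᶠ t in 𝓝[>] (0 : ℝ), 0 < f t := by
  filter_upwards [hf.tendsto_slope_zero_right.eventually (lt_mem_nhds hd), self_mem_nhdsWithin]
    with t ht ht0
  have h1 : (0 : ℝ) < t := ht0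
  simp only [zero_add, h0, sub_zero, smul_eq_mul] at ht
  exact pos_of_mul_pos_right ht (by positivity)

lemma hasDerivAt_line {f : RN N → ℝ} {y v : RN N} (hf : DifferentiableAt ℝ f y) :
    HasDerivAt (fun t : ℝ => f (y + t • v)) (fderiv ℝ f y v) 0 := by
  have h1 : HasDerivAt (fun t : ℝ => y + t • v) v 0 := by
    simpa using ((hasDerivAt_id (0 : ℝ)).smul_const v).const_add y
  have h2 : HasFDerivAt f (fderiv ℝ f y) (y + (0 : ℝ) • v) := by simpa using hf.hasFDerivAt
  exact h2.comp_hasDerivAt 0 h1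

/-- A bounded domain with `C^4` boundary is the positivity set of a compactly supported `C^4`
function whose gradient does not vanish on the boundary. It is glued from local defining
functions with nonnegative cut-offs; the gradients do not cancel, since a direction which
enters `Ω` strictly for one local defining function cannot be decreasing for another one. -/
lemma exists_definingFunction {Ω : Opens (RN N)} (hbdd : Bornology.IsBounded (Ω : Set (RN N)))
    {η : ℝ≥0} (h : HasHolderBoundary 4 η Ω) :
    ∃ ρ : RN N → ℝ, ContDiff ℝ 4 ρ ∧ HasCompactSupport ρ ∧ (∀ x, x ∈ Ω ↔ 0 < ρ x) ∧
      ∀ x ∈ frontier (Ω : Set (RN N)), fderiv ℝ ρ x ≠ 0 := by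
  classical
  have hloc := fun (x : RN N) (hx : x ∈ closure (Ω : Set (RN N))) =>
    exists_local_definingFunction h hx
  choose! r hr σ hσ hσΩ hσf using hloc
  let R : RN N → ℝ := fun x => if x ∈ closure (Ω : Set (RN N)) then r x else 1
  have hR : ∀ x, 0 < R x := fun x => by
    by_cases hx : x ∈ closure (Ω : Set (RN N))
    · simp only [R, if_pos hx]; exact hr x hx
    · simp only [R, if_neg hx]; exact one_pos
  have hRr : ∀ x ∈ closure (Ω : Set (RN N)), R x = r x := fun x hx => if_pos hx
  let b : (x : RN N) → ContDiffBump x := fun x =>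
    { rIn := R x / 4
      rOut := R x / 2
      rIn_pos := by have := hR x; positivity
      rIn_lt_rOut := by have := hR x; linarith }
  have hKc : IsCompact (closure (Ω : Set (RN N))) := hbdd.isCompact_closure
  obtain ⟨t, htK, htc⟩ := hKc.elim_nhds_subcover (fun x => ball x (R x / 2))
    (fun x _ => ball_mem_nhds x (by have := hR x; positivity))
  let τ : RN N → RN N → ℝ := fun x y => b x y * σ x y
  have hbs : ∀ x ∈ closure (Ω : Set (RN N)), tsupport (b x) ⊆ ball x (r x) := fun x hx => by
    rw [(b x).tsupport_eq, ← hRr x hx]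
    exact closedBall_subset_ball (by have := hR x; show R x / 2 < R x; linarith)
  have hσd : ∀ x ∈ closure (Ω : Set (RN N)), ∀ y ∈ ball x (r x), ContDiffAt ℝ 4 (σ x) y :=
    fun x hx y hy => (hσ x hx).contDiffAt (isOpen_ball.mem_nhds hy)
  have hτd : ∀ x ∈ closure (Ω : Set (RN N)), ContDiff ℝ 4 (τ x) := fun x hx => by
    rw [contDiff_iff_contDiffAt]
    intro y
    by_cases hy : y ∈ ball x (r x)
    · exact (b x).contDiff.contDiffAt.mul (hσd x hx y hy)
    · have : y ∉ tsupport (b x) := fun h => hy (hbs x hx h)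
      refine (contDiffAt_const (c := (0 : ℝ))).congr_of_eventuallyEq ?_
      filter_upwards [notMem_tsupport_iff_eventuallyEq.1 this] with z hz
      simp [τ, hz]
  have hτc : ∀ x, HasCompactSupport (τ x) := fun x => (b x).hasCompactSupport.mul_right
  have hbpos : ∀ x y, y ∈ ball x (R x / 2) → 0 < b x y := fun x y hy =>
    (b x).pos_of_mem_ball hy
  have hbz : ∀ x y, y ∉ ball x (R x / 2) → b x y = 0 := fun x y hy => by
    rw [← notMem_support, (b x).support_eq]; exact hy
  have hsub : ∀ x ∈ closure (Ω : Set (RN N)), ball x (R x / 2) ⊆ ball x (r x) := fun x hx => by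
    rw [← hRr x hx]; exact ball_subset_ball (by have := hR x; linarith)
  have hτnn : ∀ x ∈ closure (Ω : Set (RN N)), ∀ y ∈ Ω, 0 ≤ τ x y := fun x hx y hy => by
    by_cases hb : y ∈ ball x (R x / 2)
    · exact mul_nonneg (b x).nonneg ((hσΩ x hx y (hsub x hx hb)).1 hy).le
    · simp [τ, hbz x y hb]
  have hτnp : ∀ x ∈ closure (Ω : Set (RN N)), ∀ y ∉ Ω, τ x y ≤ 0 := fun x hx y hy => by
    by_cases hb : y ∈ ball x (R x / 2)
    · refine mul_nonpos_of_nonneg_of_nonpos (b x).nonneg ?_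
      by_contra! hc
      exact hy ((hσΩ x hx y (hsub x hx hb)).2 hc)
    · simp [τ, hbz x y hb]
  have hcov : ∀ y ∈ closure (Ω : Set (RN N)), ∃ x ∈ t, y ∈ ball x (R x / 2) := fun y hy => by
    simpa using htc hy
  set ρ : RN N → ℝ := fun y => ∑ x ∈ t, τ x y with hρdef
  have hρd : ContDiff ℝ 4 ρ := ContDiff.sum fun x hx => hτd x (htK x hx)
  have hρΩ : ∀ x, x ∈ Ω ↔ 0 < ρ x := by
    intro y
    constructor
    · intro hy
      obtain ⟨x, hxt, hxy⟩ := hcov y (subset_closure hy)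
      refine Finset.sum_pos' (fun x hx => hτnn x (htK x hx) y hy) ⟨x, hxt, ?_⟩
      exact mul_pos (hbpos x y hxy) ((hσΩ x (htK x hxt) y (hsub x (htK x hxt) hxy)).1 hy)
    · intro hy
      by_contra hc
      exact absurd hy (not_lt.2 (Finset.sum_nonpos fun x hx => hτnp x (htK x hx) y hc))
  refine ⟨ρ, hρd, ?_, hρΩ, fun y hy => ?_⟩
  · have hK : IsCompact (⋃ x ∈ t, tsupport (τ x)) := t.isCompact_biUnion fun x _ => hτc x
    refine HasCompactSupport.intro hK fun y hy => Finset.sum_eq_zero fun x hx => ?_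
    refine image_eq_zero_of_notMem_tsupport fun hc => hy ?_
    exact mem_biUnion (t := fun x => tsupport (τ x)) hx hc
  · have hyc : y ∈ closure (Ω : Set (RN N)) := frontier_subset_closure hy
    have hyn : y ∉ Ω := by rw [Ω.isOpen.frontier_eq] at hy; exact hy.2
    have hzero : ∀ f : RN N → ℝ, ContinuousAt f y → f y ≤ 0 →
        (∀ᶠ z in 𝓝 y, z ∈ Ω → 0 ≤ f z) → f y = 0 := by
      intro f hf h1 h2
      refine le_antisymm h1 ?_
      have : (𝓝[(Ω : Set (RN N))] y).NeBot := mem_closure_iff_nhdsWithin_neBot.1 hyc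
      refine ge_of_tendsto
        (hf.mono_left nhdsWithin_le_nhds : Tendsto f (𝓝[(Ω : Set (RN N))] y) _) ?_
      filter_upwards [nhdsWithin_le_nhds h2, self_mem_nhdsWithin] with z hz hzΩ
      exact hz hzΩ
    obtain ⟨x, hxt, hxy⟩ := hcov y hyc
    have hxK := htK x hxt
    have hyr := hsub x hxK hxy
    have hσ0 : σ x y = 0 := by
      refine hzero _ (hσd x hxK y hyr).continuousAt ?_ ?_
      · by_contra! hc
        exact hyn ((hσΩ x hxK y hyr).2 hc)
      · filter_upwards [isOpen_ball.mem_nhds hyr] with z hz hzΩ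
        exact ((hσΩ x hxK z hz).1 hzΩ).le
    have hρ0 : ρ y = 0 := by
      refine hzero _ hρd.continuous.continuousAt ?_ ?_
      · by_contra! hc
        exact hyn ((hρΩ y).2 hc)
      · exact Eventually.of_forall fun z hz => ((hρΩ z).1 hz).le
    obtain ⟨v, hv⟩ := hσf x hxK y hyr hy
    have hσl := hasDerivAt_line (v := v) ((hσd x hxK y hyr).differentiableAt (by norm_num))
    have hρl := hasDerivAt_line (v := v) (hρd.differentiable (by norm_num) y)
    have hτl := hasDerivAt_line (v := v) ((hτd x hxK).differentiable (by norm_num) y)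
    have hτv : fderiv ℝ (τ x) y v = b x y * fderiv ℝ (σ x) y v := by
      have := fderiv_fun_mul ((b x).contDiff (n := 1) |>.differentiable one_ne_zero y)
        ((hσd x hxK y hyr).differentiableAt (by norm_num))
      simp only [τ]
      rw [this]; simp [hσ0]
    have hpos := pos_of_hasDerivAt hσl (by simpa using hσ0) hv
    have hmem : ∀ᶠ s in 𝓝[>] (0 : ℝ), y + s • v ∈ ball x (r x) := by
      have hc : ContinuousAt (fun s : ℝ => y + s • v) 0 := by fun_prop
      exact nhdsWithin_le_nhds (hc.preimage_mem_nhds (isOpen_ball.mem_nhds (by simpa using hyr)))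
    have hnn := nonneg_of_hasDerivAt (hρl.sub hτl)
      (by simp [hρ0, τ, hσ0]) (by
        filter_upwards [hpos, hmem] with s hs hs'
        have hsΩ := (hσΩ x hxK _ hs').2 hs
        simp only [Pi.sub_apply, sub_nonneg]
        exact Finset.single_le_sum (f := fun x => τ x (y + s • v))
          (fun x hx => hτnn x (htK x hx) _ hsΩ) hxt)
    rw [hτv] at hnn
    intro hc
    rw [hc] at hnn
    have := mul_pos (hbpos x y hxy) hv
    simp at hnn
    linarith

/-- The data of a `C^4` defining function of `Ω`; the constant `c` quantifies that its gradient
does not vanish on the boundary. -/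
structure IsDefining (Ω : Opens (RN N)) (ρ : RN N → ℝ) (c : ℝ) : Prop where
  contDiff : ContDiff ℝ 4 ρ
  compact : HasCompactSupport ρ
  mem_iff : ∀ x, x ∈ Ω ↔ 0 < ρ x
  pos : 0 < c
  le : ∀ x ∈ Ω, c ≤ ∑ i, pd i ρ x ^ 2 + ρ x ^ 2

lemma exists_isDefining {Ω : Opens (RN N)} (hbdd : Bornology.IsBounded (Ω : Set (RN N)))
    {η : ℝ≥0} (h : HasHolderBoundary 4 η Ω) : ∃ ρ c, IsDefining Ω ρ c := by
  obtain ⟨ρ, h1, h2, h3, h4⟩ := exists_definingFunction hbdd h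
  have hcont : Continuous fun x => ∑ i, pd i ρ x ^ 2 + ρ x ^ 2 := by
    have : ∀ i, Continuous (pd i ρ) := fun i =>
      (contDiff_pd h1 (m := 0) (by norm_num) i).continuous
    have := h1.continuous
    fun_prop
  rcases (Ω : Set (RN N)).eq_empty_or_nonempty with he | hne
  · refine ⟨ρ, 1, h1, h2, h3, one_pos, fun x hx => ?_⟩
    have : x ∈ (Ω : Set (RN N)) := hx
    rw [he] at this; exact this.elim
  obtain ⟨x₀, hx₀, hmin⟩ := hbdd.isCompact_closure.exists_isMinOn hne.closure hcont.continuousOn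
  refine ⟨ρ, _, h1, h2, h3, ?_, fun x hx => hmin (subset_closure hx)⟩
  have hs : 0 ≤ ∑ i, pd i ρ x₀ ^ 2 := Finset.sum_nonneg fun _ _ => sq_nonneg _
  by_cases hx : x₀ ∈ (Ω : Set (RN N))
  · have := (h3 x₀).1 hx
    positivity
  · have hf : x₀ ∈ frontier (Ω : Set (RN N)) := by
      rw [Ω.isOpen.frontier_eq]; exact ⟨hx₀, hx⟩
    have : ∃ i, pd i ρ x₀ ≠ 0 := by
      by_contra! hc
      refine h4 x₀ hf ?_
      ext v
      have hv : v = ∑ i, v i • EuclideanSpace.single i (1 : ℝ) := by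
        ext j; simp [Finset.sum_apply, Pi.single_apply]
      rw [hv, map_sum]
      simp only [map_smul]
      exact Finset.sum_eq_zero fun i _ => by
        have := hc i
        rw [pd] at this; rw [this]; simp
    obtain ⟨i, hi⟩ := this
    have h5 : 0 < ∑ i, pd i ρ x₀ ^ 2 :=
      Finset.sum_pos' (fun _ _ => sq_nonneg _) ⟨i, Finset.mem_univ _, by positivity⟩
    positivity

/-! ### Cut-offs and zero traces -/

/-- The cut-off `x ↦ h((n + 1) ρ(x) - 1)` where `h` is a smooth step. -/
def cut (ρ : RN N → ℝ) (n : ℕ) (x : RN N) : ℝ :=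
  Real.smoothTransition ((n + 1) * ρ x - 1)

/-- The derivative of the cut-off with respect to the value of `ρ`. -/
def cutD (ρ : RN N → ℝ) (n : ℕ) (x : RN N) : ℝ :=
  (n + 1) * deriv Real.smoothTransition ((n + 1) * ρ x - 1)

lemma cut_nonneg (ρ : RN N → ℝ) (n : ℕ) (x : RN N) : 0 ≤ cut ρ n x :=
  Real.smoothTransition.nonneg _

lemma cut_le_one (ρ : RN N → ℝ) (n : ℕ) (x : RN N) : cut ρ n x ≤ 1 :=
  Real.smoothTransition.le_one _

lemma abs_cut_le (ρ : RN N → ℝ) (n : ℕ) (x : RN N) : |cut ρ n x| ≤ 1 := by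
  rw [abs_of_nonneg (cut_nonneg ρ n x)]; exact cut_le_one ρ n x

lemma cutD_nonneg (ρ : RN N → ℝ) (n : ℕ) (x : RN N) : 0 ≤ cutD ρ n x :=
  mul_nonneg (by positivity) Real.smoothTransition.monotone.deriv_nonneg

lemma contDiff_smoothTransition {m : ℕ} : ContDiff ℝ m Real.smoothTransition := by
  exact_mod_cast Real.smoothTransition.contDiff (n := m)

lemma deriv_smoothTransition_of_one_lt {t : ℝ} (ht : 1 < t) :
    deriv Real.smoothTransition t = 0 := by
  have : Real.smoothTransition =ᶠ[𝓝 t] fun _ => 1 := by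
    filter_upwards [lt_mem_nhds ht] with s hs using Real.smoothTransition.one_of_one_le hs.le
  rw [this.deriv_eq, deriv_const]

lemma deriv_smoothTransition_of_neg {t : ℝ} (ht : t < 0) :
    deriv Real.smoothTransition t = 0 := by
  have : Real.smoothTransition =ᶠ[𝓝 t] fun _ => 0 := by
    filter_upwards [gt_mem_nhds ht] with s hs using Real.smoothTransition.zero_of_nonpos hs.le
  rw [this.deriv_eq, deriv_const]

lemma exists_mul_deriv_smoothTransition_le :
    ∃ C, ∀ t, |(t + 1) * deriv Real.smoothTransition t| ≤ C := by
  have hc : Continuous fun t => (t + 1) * deriv Real.smoothTransition t :=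
    (by fun_prop : Continuous fun t : ℝ => t + 1).mul
      ((contDiff_smoothTransition (m := 1)).continuous_deriv (by norm_num))
  refine hc.bounded_above_of_compact_support (HasCompactSupport.intro (isCompact_Icc (a := 0)
      (b := 1))
    fun t ht => ?_)
  rw [mem_Icc, not_and_or, not_le, not_le] at ht
  rcases ht with ht | ht
  · rw [deriv_smoothTransition_of_neg ht, mul_zero]
  · rw [deriv_smoothTransition_of_one_lt ht, mul_zero]

namespace IsDefining

variable {Ω : Opens (RN N)} {ρ : RN N → ℝ} {c : ℝ}

lemma test (h : IsDefining Ω ρ c) : IsTest univ ρ :=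
  ⟨h.contDiff.of_le (by norm_num), h.compact, subset_univ _⟩

lemma test_pd (h : IsDefining Ω ρ c) (i : Fin N) : IsTest univ (pd i ρ) :=
  h.test.pd_test (h.contDiff.of_le (by norm_num)) i

lemma test_pd_pd (h : IsDefining Ω ρ c) (i j : Fin N) : IsTest univ (pd i (pd j ρ)) :=
  (h.test_pd j).pd_test (contDiff_pd h.contDiff (by norm_num) j) i

lemma contDiff_cut (h : IsDefining Ω ρ c) (n : ℕ) : ContDiff ℝ 1 (cut ρ n) :=
  (contDiff_smoothTransition (m := 1)).comp
    ((contDiff_const.mul h.test.contDiff).sub contDiff_const)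

lemma test_cut (h : IsDefining Ω ρ c) (n : ℕ) : IsTest Ω (cut ρ n) := by
  have hcl : IsClosed {x | 1 / ((n : ℝ) + 1) ≤ ρ x} :=
    isClosed_le continuous_const h.contDiff.continuous
  have hsub : tsupport (cut ρ n) ⊆ {x | 1 / ((n : ℝ) + 1) ≤ ρ x} := by
    refine closure_minimal (fun x hx => ?_) hcl
    by_contra hc
    refine hx (Real.smoothTransition.zero_of_nonpos ?_)
    simp only [mem_ofPred_eq, not_le] at hc
    rw [lt_div_iff₀ (by positivity)] at hc
    linarith
  have hpos : ∀ x, 1 / ((n : ℝ) + 1) ≤ ρ x → 0 < ρ x := fun x hx =>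
    lt_of_lt_of_le (by positivity) hx
  refine ⟨h.contDiff_cut n, ?_, fun x hx => (h.mem_iff x).2 (hpos x (hsub hx))⟩
  exact HasCompactSupport.of_support_subset_isCompact h.compact
    (subset_closure.trans (hsub.trans fun x hx => subset_closure (hpos x hx).ne'))

lemma pd_cut (h : IsDefining Ω ρ c) (n : ℕ) (i : Fin N) (x : RN N) :
    pd i (cut ρ n) x = cutD ρ n x * pd i ρ x := by
  have h1 : HasDerivAt Real.smoothTransition
      (deriv Real.smoothTransition ((n + 1) * ρ x - 1)) ((n + 1) * ρ x - 1) :=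
    ((contDiff_smoothTransition (m := 1)).differentiable (by norm_num) _).hasDerivAt
  have h2 : HasFDerivAt (fun x => ((n : ℝ) + 1) * ρ x - 1) (((n : ℝ) + 1) • fderiv ℝ ρ x) x :=
    ((h.test.contDiff.differentiable one_ne_zero x).hasFDerivAt.const_mul _).sub_const _
  have h3 := h1.comp_hasFDerivAt x h2
  have h4 : fderiv ℝ (cut ρ n) x = _ := h3.fderiv
  rw [pd, h4]
  simp [cutD, pd]; ring

lemma continuous_cutD (h : IsDefining Ω ρ c) (n : ℕ) : Continuous (cutD ρ n) :=
  continuous_const.mul (((contDiff_smoothTransition (m := 1)).continuous_deriv (by norm_num)).comp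
    ((continuous_const.mul h.contDiff.continuous).sub continuous_const))

lemma eventually_cut_eq_one (h : IsDefining Ω ρ c) {x : RN N} (hx : x ∈ Ω) :
    ∀ᶠ n in atTop, cut ρ n x = 1 ∧ cutD ρ n x = 0 := by
  have hρ := (h.mem_iff x).1 hx
  have h1 : Tendsto (fun n : ℕ => ((n : ℝ) + 1) * ρ x - 1) atTop atTop := by
    have : Tendsto (fun n : ℕ => ((n : ℝ) + 1)) atTop atTop :=
      tendsto_atTop_add_const_right _ _ tendsto_natCast_atTop_atTop
    exact tendsto_atTop_add_const_right _ (-1 : ℝ) (this.atTop_mul_const hρ)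
  filter_upwards [h1.eventually_gt_atTop 1] with n hn
  exact ⟨Real.smoothTransition.one_of_one_le hn.le, by
    rw [cutD, deriv_smoothTransition_of_one_lt hn, mul_zero]⟩

lemma tendsto_integral_cut (h : IsDefining Ω ρ c) {F : RN N → ℝ} (hF : Integrable F (vol Ω)) :
    Tendsto (fun n => ∫ x, cut ρ n x * F x ∂(vol Ω)) atTop (𝓝 (∫ x, F x ∂(vol Ω))) := by
  refine tendsto_integral_of_dominated_convergence (fun x => ‖F x‖)
    (fun n => (h.contDiff_cut n).continuous.aestronglyMeasurable.mul hF.1) hF.norm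
    (fun n => ae_of_all _ fun x => ?_) ?_
  · rw [norm_mul]
    exact mul_le_of_le_one_left (norm_nonneg _) (abs_cut_le ρ n x)
  · filter_upwards [ae_restrict_mem Ω.isOpen.measurableSet] with x hx
    refine tendsto_const_nhds.congr' ?_
    filter_upwards [h.eventually_cut_eq_one hx] with n hn
    rw [hn.1, one_mul]

lemma tendsto_integral_cutD (h : IsDefining Ω ρ c) {F : RN N → ℝ} (hF : Integrable F (vol Ω)) :
    Tendsto (fun n => ∫ x, ρ x * cutD ρ n x * F x ∂(vol Ω)) atTop (𝓝 0) := by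
  obtain ⟨C, hC⟩ := exists_mul_deriv_smoothTransition_le
  rw [← integral_zero (RN N) ℝ (μ := vol Ω)]
  refine tendsto_integral_of_dominated_convergence (fun x => C * ‖F x‖)
    (fun n => (h.contDiff.continuous.mul (h.continuous_cutD n)).aestronglyMeasurable.mul hF.1)
    (hF.norm.const_mul C) (fun n => ae_of_all _ fun x => ?_) ?_
  · rw [norm_mul]
    refine mul_le_mul_of_nonneg_right ?_ (norm_nonneg _)
    have := hC ((n + 1) * ρ x - 1)
    rwa [Real.norm_eq_abs, cutD, show ρ x * (((n : ℝ) + 1) *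
      deriv Real.smoothTransition ((n + 1) * ρ x - 1)) = ((n + 1) * ρ x - 1 + 1) *
      deriv Real.smoothTransition ((n + 1) * ρ x - 1) by ring]
  · filter_upwards [ae_restrict_mem Ω.isOpen.measurableSet] with x hx
    refine tendsto_const_nhds.congr' ?_
    filter_upwards [h.eventually_cut_eq_one hx] with n hn
    rw [hn.2, mul_zero, zero_mul]

/-- A criterion for the extension of `w ∈ W^{1,2}(Ω)` by zero to be weakly differentiable: the
boundary term produced by the cut-offs tends to zero. -/
lemma zeroExt_of_tendsto (h : IsDefining Ω ρ c) {w : RN N → ℝ} {w' : Fin N → RN N → ℝ}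
    (hw : IsH1 Ω Ω w w')
    (hlim : ∀ k φ, IsTest univ φ → Tendsto (fun n =>
      ∫ x, w x * (cutD ρ n x * pd k ρ x * φ x) ∂(vol Ω)) atTop (𝓝 0)) :
    IsH1 Ω univ w w' := by
  refine ⟨hw.memLp, hw.memLp_grad, fun k φ hφ => ?_⟩
  have i1 := integrable_mul_of_L2 hw.memLp (hφ.memLp_pd k 2 (vol Ω))
  have i2 := integrable_mul_of_L2 (hw.memLp_grad k) (hφ.memLp 2 (vol Ω))
  have l1 := h.tendsto_integral_cut i1
  have l2 := (h.tendsto_integral_cut i2).neg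
  have l3 := l1.add (hlim k φ hφ)
  rw [add_zero] at l3
  refine tendsto_nhds_unique (l3.congr fun n => ?_) l2
  have e := hw.rel k _ ((h.test_cut n).mul_right hφ.contDiff)
  simp only [pd_mul (h.contDiff_cut n) hφ.contDiff, h.pd_cut] at e
  have m1 := integrable_mul_of_L2 hw.memLp ((h.test_cut n).memLp_mul (hφ.memLp_pd k 2 (vol Ω)))
  have m2 := integrable_mul_of_L2 hw.memLp
    (((h.test_cut n).memLp_pd_mul k (hφ.memLp 2 (vol Ω))))
  simp only [h.pd_cut] at m2
  rw [show (fun x => w x * (cut ρ n x * pd k φ x + cutD ρ n x * pd k ρ x * φ x))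
    = fun x => w x * (cut ρ n x * pd k φ x) + w x * (cutD ρ n x * pd k ρ x * φ x) by
      ext x; ring, integral_add m1 m2] at e
  rw [show (fun x => cut ρ n x * (w x * pd k φ x)) = fun x => w x * (cut ρ n x * pd k φ x) by
    ext x; ring, show (fun x => cut ρ n x * (w' k x * φ x)) = fun x => w' k x * (cut ρ n x * φ x) by
    ext x; ring]
  exact e

/-- A function in `W^{1,2}(Ω)` multiplied by the defining function has zero trace. -/
lemma zeroExt_mul (h : IsDefining Ω ρ c) {f : RN N → ℝ} {g : Fin N → RN N → ℝ}
    (hf : IsH1 Ω Ω f g) :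
    IsH1 Ω univ (fun x => ρ x * f x) (fun i x => ρ x * g i x + pd i ρ x * f x) := by
  refine h.zeroExt_of_tendsto (hf.mul h.test) fun k φ hφ => ?_
  have i1 := integrable_mul_of_L2 hf.memLp ((h.test_pd k).memLp_mul (hφ.memLp 2 (vol Ω)))
  refine (h.tendsto_integral_cutD i1).congr fun n => ?_
  congr 1; ext x; ring

end IsDefining

/-- A test function is an element of `W^{1,2}` of the whole space. -/
lemma IsTest.isH1_top {φ : RN N → ℝ} (hφ : IsTest univ φ) :
    IsH1 (⊤ : Opens (RN N)) univ φ (fun i => pd i φ) := by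
  refine ⟨hφ.memLp _ _, fun i => hφ.memLp_pd i _ _, fun i ψ hψ => ?_⟩
  simp only [vol, Opens.coe_top, Measure.restrict_univ]
  exact integral_mul_pd hφ.contDiff hψ i

/-- The gradient of a function with zero trace is orthogonal to the divergence-free fields
`(∂_i F) e_j - (∂_j F) e_i`. -/
lemma integral_pd_mul_sub_eq_zero {Ω : Opens (RN N)} {u : RN N → ℝ} {g : Fin N → RN N → ℝ}
    (hu : IsH1 Ω univ u g) {F : RN N → ℝ} (hF : IsTest univ F) (i j : Fin N) :
    ∫ x, (g j x * pd i F x - g i x * pd j F x) ∂(vol Ω) = 0 := by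
  obtain ⟨φ, hs, ht, -, -, h2, -, -⟩ := hF.isH1_top.exists_approx hF.compact
    (fun x _ hx => image_eq_zero_of_notMem_tsupport hx)
  have key : ∀ n, ∫ x, g j x * pd i (φ n) x ∂(vol Ω) = ∫ x, g i x * pd j (φ n) x ∂(vol Ω) := by
    intro n
    have hs2 : ContDiff ℝ 2 (φ n) := contDiff_infty.1 (hs n) 2
    have e1 := hu.rel j _ ((ht n).pd_test hs2 i)
    have e2 := hu.rel i _ ((ht n).pd_test hs2 j)
    simp only [pd_comm hs2 j i] at e1
    linarith
  have r : ∀ i, Tendsto (fun n => eLpNorm (pd i (φ n) - pd i F) 2 (vol Ω)) atTop (𝓝 0) := fun i =>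
    tendsto_of_tendsto_of_tendsto_of_le_of_le tendsto_const_nhds (h2 i) (fun _ => zero_le)
      fun n => eLpNorm_mono_measure _ (Measure.restrict_mono (subset_univ _) le_rfl)
  have l1 := tendsto_integral_mul_const (hu.memLp_grad j) (hF.memLp_pd i 2 (vol Ω))
    (fun n => (ht n).memLp_pd i 2 _) (r i)
  have l2 := tendsto_integral_mul_const (hu.memLp_grad i) (hF.memLp_pd j 2 (vol Ω))
    (fun n => (ht n).memLp_pd j 2 _) (r j)
  rw [integral_sub (integrable_mul_of_L2 (hu.memLp_grad j) (hF.memLp_pd i 2 (vol Ω)))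
    (integrable_mul_of_L2 (hu.memLp_grad i) (hF.memLp_pd j 2 (vol Ω))), sub_eq_zero]
  exact tendsto_nhds_unique l1 (l2.congr fun n => (key n).symm)

/-- The tangential derivatives of a function with zero trace have zero trace: against the
derivative of the cut-off, `∂_iρ ∂_j u - ∂_jρ ∂_i u` is the pairing of `∇u` with a divergence-free
field up to terms which do not contain the derivative of the cut-off. -/
lemma IsDefining.zeroExt_tangential {Ω : Opens (RN N)} {ρ : RN N → ℝ} {c : ℝ}
    (h : IsDefining Ω ρ c) {u : RN N → ℝ} {g : Fin N → RN N → ℝ} {H : Fin N → Fin N → RN N → ℝ}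
    (hu : IsH1 Ω univ u g) (hg : ∀ i, IsH1 Ω Ω (g i) (H i)) (i j : Fin N) :
    IsH1 Ω univ (fun x => pd i ρ x * g j x - pd j ρ x * g i x)
      (fun k x => (pd i ρ x * H j k x + pd k (pd i ρ) x * g j x)
        - (pd j ρ x * H i k x + pd k (pd j ρ) x * g i x)) := by
  refine h.zeroExt_of_tendsto (((hg j).mul (h.test_pd i)).sub ((hg i).mul (h.test_pd j)))
    fun k φ hφ => ?_
  set ψ : RN N → ℝ := fun x => φ x * pd k ρ x with hψdef
  have hψ : IsTest univ ψ := hφ.mul_right (h.test_pd k).contDiff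
  have i1 := (integrable_mul_of_L2 (hg j).memLp (hψ.memLp_pd i 2 (vol Ω))).sub
    (integrable_mul_of_L2 (hg i).memLp (hψ.memLp_pd j 2 (vol Ω)))
  have l1 := h.tendsto_integral_cut i1
  have l2 := l1.sub_const (∫ x, (g j x * pd i ψ x - g i x * pd j ψ x) ∂(vol Ω))
  simp only [Pi.sub_apply, sub_self] at l2
  rw [← neg_zero]
  refine l2.neg.congr fun n => ?_
  -- orthogonality to the divergence-free field for `cut * ψ` and for `ψ` carries all
  -- derivatives off the cut-off
  have hc := h.test_cut n
  have e1 := integral_pd_mul_sub_eq_zero hu (hc.toUniv.mul_right hψ.contDiff) i j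
  have e2 := integral_pd_mul_sub_eq_zero hu hψ i j
  simp only [pd_mul hc.contDiff hψ.contDiff, h.pd_cut] at e1
  have m1 := hc.toUniv.memLp_mul (hψ.memLp_pd i 2 (vol Ω))
  have m2 := hc.toUniv.memLp_mul (hψ.memLp_pd j 2 (vol Ω))
  have m3 := hc.toUniv.memLp_pd_mul i (hψ.memLp 2 (vol Ω))
  have m4 := hc.toUniv.memLp_pd_mul j (hψ.memLp 2 (vol Ω))
  simp only [h.pd_cut] at m3 m4
  rw [e2, sub_zero]
  have e3 : ∫ x, (g j x * (cut ρ n x * pd i ψ x + cutD ρ n x * pd i ρ x * ψ x) -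
      g i x * (cut ρ n x * pd j ψ x + cutD ρ n x * pd j ρ x * ψ x)) ∂(vol Ω) =
      ∫ x, cut ρ n x * (g j x * pd i ψ x - g i x * pd j ψ x) ∂(vol Ω) +
      ∫ x, (pd i ρ x * g j x - pd j ρ x * g i x) * (cutD ρ n x * pd k ρ x * φ x) ∂(vol Ω) := by
    rw [← integral_add]
    · congr 1; ext x; simp only [hψdef]; ring
    · refine ((integrable_mul_of_L2 (hg j).memLp m1).sub
        (integrable_mul_of_L2 (hg i).memLp m2)).congr (ae_of_all _ fun x => ?_)
      simp only [Pi.sub_apply]; ring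
    · refine ((integrable_mul_of_L2 (hg j).memLp m3).sub
        (integrable_mul_of_L2 (hg i).memLp m4)).congr (ae_of_all _ fun x => ?_)
      simp only [Pi.sub_apply, hψdef]; ring
  linarith

/-! ### Hardy's inequality -/

lemma eLpNorm_two_eq {α : Type*} [MeasurableSpace α] {μ : Measure α} {f : α → ℝ}
    (hf : MemLp f 2 μ) : eLpNorm f 2 μ = ENNReal.ofReal (√(∫ x, f x ^ 2 ∂μ)) := by
  rw [hf.eLpNorm_eq_integral_rpow_norm (by simp) (by simp), Real.sqrt_eq_rpow]
  simp

lemma eLpNorm_two_le {α : Type*} [MeasurableSpace α] {μ : Measure α} {f : α → ℝ}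
    (hf : MemLp f 2 μ) {M : ℝ} (hM : ∫ x, f x ^ 2 ∂μ ≤ M) :
    eLpNorm f 2 μ ≤ ENNReal.ofReal (√M) := by
  rw [eLpNorm_two_eq hf]
  exact ENNReal.ofReal_le_ofReal (Real.sqrt_le_sqrt hM)

/-- Fatou's lemma for a sequence which is bounded in `L^p`. -/
lemma memLp_of_tendsto_ae {α : Type*} [MeasurableSpace α] {μ : Measure α} {f : α → ℝ}
    {F : ℕ → α → ℝ} {p C : ℝ≥0∞} (hF : ∀ n, AEStronglyMeasurable (F n) μ)
    (hb : ∀ n, eLpNorm (F n) p μ ≤ C) (hC : C ≠ ⊤)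
    (h : ∀ᵐ x ∂μ, Tendsto (fun n => F n x) atTop (𝓝 (f x))) :
    MemLp f p μ ∧ eLpNorm f p μ ≤ C := by
  have h1 : eLpNorm f p μ ≤ C := by
    refine (Lp.eLpNorm_lim_le_liminf_eLpNorm hF f h).trans ?_
    exact liminf_le_of_frequently_le' (Frequently.of_forall hb)
  exact ⟨⟨aestronglyMeasurable_of_tendsto_ae atTop hF h, h1.trans_lt hC.lt_top⟩, h1⟩

/-- Weak derivatives are unique almost everywhere. -/
lemma IsH1.grad_unique {Ω : Opens (RN N)} {f : RN N → ℝ} {g g' : Fin N → RN N → ℝ}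
    (h : IsH1 Ω Ω f g) (h' : IsH1 Ω Ω f g') (i : Fin N) : g i =ᵐ[vol Ω] g' i := by
  have hd := (h.memLp_grad i).sub (h'.memLp_grad i)
  have := Ω.isOpen.ae_eq_zero_of_integral_contDiff_smul_eq_zero (f := g i - g' i) (μ := volume)
    (locallyIntegrableOn_of_locallyIntegrable_restrict (hd.locallyIntegrable one_le_two)) fun φ hφ hc hs => by
      have ht : IsTest Ω φ := ⟨contDiff_one_of_smooth hφ, hc, hs⟩
      have e1 := h.rel i φ ht
      have e2 := h'.rel i φ ht
      have i1 := integrable_mul_of_L2 (h.memLp_grad i) (ht.memLp 2 (vol Ω))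
      have i2 := integrable_mul_of_L2 (h'.memLp_grad i) (ht.memLp 2 (vol Ω))
      have e3 : ∫ x, φ x • (g i - g' i) x ∂(vol Ω) = 0 := by
        rw [show (fun x => φ x • (g i - g' i) x) = fun x => g i x * φ x - g' i x * φ x by
          ext x; simp [smul_eq_mul]; ring, integral_sub i1 i2]
        linarith
      rw [← e3, setIntegral_eq_integral_of_forall_compl_eq_zero]
      intro x hx
      rw [image_eq_zero_of_notMem_tsupport fun hxs => hx (hs hxs), zero_smul]
  rw [EventuallyEq, ae_restrict_iff' Ω.isOpen.measurableSet]
  filter_upwards [this] with x hx hxΩ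
  have := hx hxΩ
  simpa [sub_eq_zero] using this

/-- Integration by parts for the square of a function with zero trace. -/
lemma IsH1.integral_sq_mul_pd {Ω : Opens (RN N)} (hbdd : Bornology.IsBounded (Ω : Set (RN N)))
    {w : RN N → ℝ} {w' : Fin N → RN N → ℝ} (hw : IsH1 Ω univ w w') {V : RN N → ℝ}
    (hV : IsTest univ V) (k : Fin N) :
    ∫ x, w x * (V x * w' k x + pd k V x * w x) ∂(vol Ω) = -∫ x, w' k x * (V x * w x) ∂(vol Ω) := by
  obtain ⟨φ, hs, ht, -, h1, h2, -, -⟩ := hw.exists_approx hbdd.isCompact_closure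
    (fun x hx hx' => absurd (subset_closure hx) hx')
  have key : ∀ n, ∫ x, w x * (V x * pd k (φ n) x + pd k V x * φ n x) ∂(vol Ω)
      = -∫ x, w' k x * (V x * φ n x) ∂(vol Ω) := fun n => by
    have := hw.rel k _ ((ht n).mul_left hV.contDiff)
    simpa only [pd_mul hV.contDiff (ht n).contDiff] using this
  obtain ⟨C, -, hC⟩ := hV.bounded
  obtain ⟨C', -, hC'⟩ := hV.bounded_pd
  have l2 := tendsto_integral_mul_const (hw.memLp_grad k) (hV.memLp_mul hw.memLp)
    (fun n => hV.memLp_mul ((ht n).memLp 2 _)) (tendsto_eLpNorm_mul hC h1)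
  have l1a := tendsto_integral_mul_const hw.memLp (hV.memLp_mul (hw.memLp_grad k))
    (fun n => hV.memLp_mul ((ht n).memLp_pd k 2 _)) (tendsto_eLpNorm_mul hC (h2 k))
  have l1b := tendsto_integral_mul_const hw.memLp (hV.memLp_pd_mul k hw.memLp)
    (fun n => hV.memLp_pd_mul k ((ht n).memLp 2 _)) (tendsto_eLpNorm_mul (hC' k) h1)
  have l1 := l1a.add l1b
  simp only [mul_add]
  rw [integral_add (integrable_mul_of_L2 hw.memLp (hV.memLp_mul (hw.memLp_grad k)))
    (integrable_mul_of_L2 hw.memLp (hV.memLp_pd_mul k hw.memLp))]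
  refine tendsto_nhds_unique (l1.congr fun n => ?_) l2.neg
  rw [← key, ← integral_add (integrable_mul_of_L2 hw.memLp (hV.memLp_mul ((ht n).memLp_pd k 2 _)))
    (integrable_mul_of_L2 hw.memLp (hV.memLp_pd_mul k ((ht n).memLp 2 _)))]
  simp only [mul_add]

/-- A smooth positive weight on the line, comparable to `1 / t` for `t ≥ ε` and satisfying
`G' ≤ -G²` for `t ≥ 0`. -/
def hardyWeight (ε t : ℝ) : ℝ := (√(t ^ 2 + ε ^ 2) + t)⁻¹

lemma hardyWeight_denom_pos {ε : ℝ} (hε : 0 < ε) (t : ℝ) : 0 < √(t ^ 2 + ε ^ 2) + t := by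
  have : |t| < √(t ^ 2 + ε ^ 2) := by
    rw [← Real.sqrt_sq_eq_abs]
    exact Real.sqrt_lt_sqrt (sq_nonneg t) (by linarith [pow_pos hε 2])
  linarith [neg_abs_le t]

lemma contDiff_hardyWeight {ε : ℝ} (hε : 0 < ε) : ContDiff ℝ 1 (hardyWeight ε) := by
  refine ContDiff.inv ?_ fun t => (hardyWeight_denom_pos hε t).ne'
  refine (ContDiff.sqrt (by fun_prop) fun t => ?_).add contDiff_id
  have := pow_pos hε 2; positivity

lemma deriv_hardyWeight_le {ε : ℝ} (hε : 0 < ε) {t : ℝ} (ht : 0 ≤ t) :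
    deriv (hardyWeight ε) t ≤ -hardyWeight ε t ^ 2 := by
  have hpos : 0 < t ^ 2 + ε ^ 2 := by have := pow_pos hε 2; positivity
  have h1 : HasDerivAt (fun t => √(t ^ 2 + ε ^ 2) + t)
      ((2 * t) / (2 * √(t ^ 2 + ε ^ 2)) + 1) t := by
    have := (((hasDerivAt_id t).pow 2).add_const (ε ^ 2)).sqrt hpos.ne'
    simp only [id, Nat.cast_ofNat, Nat.add_one_sub_one, pow_one, mul_one] at this
    exact this.add (hasDerivAt_id t)
  have h2 := h1.inv (hardyWeight_denom_pos hε t).ne'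
  rw [show hardyWeight ε = (fun t => √(t ^ 2 + ε ^ 2) + t)⁻¹ from rfl, h2.deriv]
  simp only [Pi.inv_apply]
  rw [neg_div, neg_le_neg_iff, inv_pow, ← one_div]
  gcongr
  have : 0 ≤ 2 * t / (2 * √(t ^ 2 + ε ^ 2)) := by positivity
  linarith

lemma hardyWeight_pos {ε : ℝ} (hε : 0 < ε) (t : ℝ) : 0 < hardyWeight ε t :=
  inv_pos.2 (hardyWeight_denom_pos hε t)

lemma mul_hardyWeight_le {ε : ℝ} (hε : 0 < ε) (t : ℝ) : t * hardyWeight ε t ≤ 1 := by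
  rw [hardyWeight, ← div_eq_mul_inv, div_le_one (hardyWeight_denom_pos hε t)]
  linarith [Real.sqrt_nonneg (t ^ 2 + ε ^ 2)]

lemma hardyWeight_le {ε : ℝ} (hε : 0 < ε) {t : ℝ} (ht : 0 ≤ t) : hardyWeight ε t ≤ ε⁻¹ := by
  refine inv_anti₀ hε ?_
  have : ε ≤ √(t ^ 2 + ε ^ 2) := Real.le_sqrt_of_sq_le (by nlinarith)
  linarith

/-- Hardy's inequality: a function with zero trace divided by the defining function is in `L²`.
With `G ε` the regularized weight, `∫ w² div (G ε(ρ) ∇ρ)` is integrated by parts. In `Ω`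
one has `div (G ε(ρ) ∇ρ) ≤ -|∇ρ|² (G ε(ρ))² + G ε(ρ) Δρ` and `|∇ρ|² ≥ c - ρ²`, where `ρ G ε(ρ) ≤ 1`,
so that the other terms bound `∫ (w G ε(ρ))²`, uniformly in `ε`. -/
lemma IsDefining.memLp_div {Ω : Opens (RN N)} (hbdd : Bornology.IsBounded (Ω : Set (RN N)))
    {ρ : RN N → ℝ} {c : ℝ} (h : IsDefining Ω ρ c) {w : RN N → ℝ} {w' : Fin N → RN N → ℝ}
    (hw : IsH1 Ω univ w w') : MemLp (fun x => w x / ρ x) 2 (vol Ω) := by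
  obtain ⟨A, hA⟩ : ∃ A, ∀ k x, |pd k (pd k ρ) x| ≤ A := by
    have : ∀ k, ∃ A, ∀ x, |pd k (pd k ρ) x| ≤ A := fun k => by
      obtain ⟨A, -, hA⟩ := (h.test_pd_pd k k).bounded
      exact ⟨A, hA⟩
    choose A hA using this
    exact ⟨∑ k, |A k|, fun k x => ((hA k x).trans (le_abs_self _)).trans
      (Finset.single_le_sum (f := fun k => |A k|) (fun _ _ => abs_nonneg _) (Finset.mem_univ k))⟩
  have hc := h.pos
  set P : RN N → ℝ := fun x => ∑ k, pd k ρ x * w' k x with hP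
  have hPL : MemLp P 2 (vol Ω) := memLp_finsetSum _ fun k _ =>
      (h.test_pd k).memLp_mul (hw.memLp_grad k)
  set L : RN N → ℝ := fun x => ∑ k, pd k (pd k ρ) x with hL
  have hLA : ∀ x, |L x| ≤ N * A := fun x =>
    (Finset.abs_sum_le_sum_abs _ _).trans ((Finset.sum_le_sum fun k _ => hA k x).trans (by simp))
  set B : RN N → ℝ := fun x => w x ^ 2 + 1 / c * (N * A) ^ 2 * w x ^ 2 + 4 / c * P x ^ 2 with hB
  have hBi : Integrable B (vol Ω) := by
    have i1 := hw.memLp.integrable_sq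
    have i2 := hPL.integrable_sq
    exact (i1.add (i1.const_mul _)).add (i2.const_mul _)
  have key : ∀ ε : ℝ, 0 < ε → MemLp (fun x => w x * hardyWeight ε (ρ x)) 2 (vol Ω) ∧
      ∫ x, (w x * hardyWeight ε (ρ x)) ^ 2 ∂(vol Ω) ≤ 2 / c * ∫ x, B x ∂(vol Ω) := by
    intro ε hε
    set G : RN N → ℝ := fun x => hardyWeight ε (ρ x) with hG
    have hGc : ContDiff ℝ 1 G := (contDiff_hardyWeight hε).comp h.test.contDiff
    have hGL : MemLp (fun x => w x * G x) 2 (vol Ω) := by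
      refine hw.memLp.of_le_mul (c := ε⁻¹)
        (hw.memLp.1.mul hGc.continuous.aestronglyMeasurable) ?_
      filter_upwards [ae_restrict_mem Ω.isOpen.measurableSet] with x hx
      have hx0 := ((h.mem_iff x).1 hx).le
      rw [norm_mul, mul_comm]
      refine mul_le_mul_of_nonneg_right ?_ (norm_nonneg _)
      rw [Real.norm_of_nonneg (hardyWeight_pos hε _).le]
      exact hardyWeight_le hε hx0
    refine ⟨hGL, ?_⟩
    have hVt : ∀ k, IsTest univ fun x => pd k ρ x * G x := fun k => (h.test_pd k).mul_right hGc
    have hpdG : ∀ k x, pd k G x = deriv (hardyWeight ε) (ρ x) * pd k ρ x := fun k x => by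
      have h1 := (((contDiff_hardyWeight hε).differentiable one_ne_zero
        (ρ x)).hasDerivAt.comp_hasFDerivAt x
        (h.test.contDiff.differentiable one_ne_zero x).hasFDerivAt).fderiv
      have h2 : fderiv ℝ G x = _ := h1
      rw [pd, h2]; simp [pd]
    have hpdV : ∀ k x, pd k (fun x => pd k ρ x * G x) x
        = pd k (pd k ρ) x * G x + pd k ρ x ^ 2 * deriv (hardyWeight ε) (ρ x) := fun k x => by
      rw [pd_mul (h.test_pd k).contDiff hGc, hpdG]; ring
    -- the `k`-th part of the divergence of `w² G(ρ) ∇ρ`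
    set X : Fin N → RN N → ℝ := fun k x =>
      w x * (pd k ρ x * G x * w' k x + pd k (fun x => pd k ρ x * G x) x * w x)
        + w' k x * (pd k ρ x * G x * w x) with hX
    have hXi : ∀ k, Integrable (X k) (vol Ω) := fun k =>
      (integrable_mul_of_L2 hw.memLp (((hVt k).memLp_mul (hw.memLp_grad k)).add
        ((hVt k).memLp_pd_mul k hw.memLp))).add
        (integrable_mul_of_L2 (hw.memLp_grad k) ((hVt k).memLp_mul hw.memLp))
    have hX0 : ∀ k, ∫ x, X k x ∂(vol Ω) = 0 := fun k => by
      have := hw.integral_sq_mul_pd hbdd (hVt k) k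
      have i1 : Integrable (fun x => w x * (pd k ρ x * G x * w' k x
          + pd k (fun x => pd k ρ x * G x) x * w x)) (vol Ω) :=
        integrable_mul_of_L2 hw.memLp (((hVt k).memLp_mul (hw.memLp_grad k)).add
          ((hVt k).memLp_pd_mul k hw.memLp))
      have e := integral_add i1
        (integrable_mul_of_L2 (hw.memLp_grad k) ((hVt k).memLp_mul hw.memLp))
      rw [this, neg_add_cancel] at e
      exact e
    have hsum : ∫ x, ∑ k, X k x ∂(vol Ω) = 0 := by
      rw [integral_finsetSum _ fun k _ => hXi k]; simp [hX0]
    have hle : ∀ x ∈ Ω, ∑ k, X k x ≤ B x - c / 2 * (w x * G x) ^ 2 := by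
      intro x hx
      have hx0 := ((h.mem_iff x).1 hx).le
      have e : ∑ k, X k x = 2 * (w x * G x) * P x + (w x * G x) * (L x * w x)
          + w x ^ 2 * (∑ k, pd k ρ x ^ 2) * deriv (hardyWeight ε) (ρ x) := by
        simp only [hX, hP, hL, hpdV, Finset.mul_sum, Finset.sum_mul, ← Finset.sum_add_distrib]
        refine Finset.sum_congr rfl fun k _ => ?_
        ring
      have hq := h.le x hx
      set q := ∑ k, pd k ρ x ^ 2
      have hq0 : 0 ≤ q := Finset.sum_nonneg fun _ _ => sq_nonneg _
      have h1 : w x ^ 2 * q * deriv (hardyWeight ε) (ρ x) ≤ -(c * (w x * G x) ^ 2) + w x ^ 2 := by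
        have s1 : w x ^ 2 * q * deriv (hardyWeight ε) (ρ x) ≤ w x ^ 2 * q * (-(G x) ^ 2) :=
          mul_le_mul_of_nonneg_left (deriv_hardyWeight_le hε hx0) (by positivity)
        have s2 : w x ^ 2 * q * (-(G x) ^ 2) ≤ w x ^ 2 * G x ^ 2 * (ρ x ^ 2 - c) := by
          have : w x ^ 2 * G x ^ 2 * (c - ρ x ^ 2) ≤ w x ^ 2 * G x ^ 2 * q :=
            mul_le_mul_of_nonneg_left (by linarith) (by positivity)
          linarith
        have s3 : w x ^ 2 * (ρ x * G x) ^ 2 ≤ w x ^ 2 * 1 := by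
          refine mul_le_mul_of_nonneg_left ?_ (sq_nonneg _)
          exact pow_le_one₀ (mul_nonneg hx0 (hardyWeight_pos hε _).le) (mul_hardyWeight_le hε _)
        nlinarith
      have h2 : 2 * (w x * G x) * P x ≤ c / 4 * (w x * G x) ^ 2 + 4 / c * P x ^ 2 := by
        have : 0 ≤ c / 4 * (w x * G x - 4 / c * P x) ^ 2 := by positivity
        have e2 : c / 4 * (w x * G x - 4 / c * P x) ^ 2 = c / 4 * (w x * G x) ^ 2
          - 2 * (w x * G x) * P x + 4 / c * P x ^ 2 := by field_simp; ring
        linarith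
      have h3 : (w x * G x) * (L x * w x) ≤ c / 4 * (w x * G x) ^ 2
          + 1 / c * (N * A) ^ 2 * w x ^ 2 := by
        have t1 : 0 ≤ c / 4 * (w x * G x - 2 / c * (L x * w x)) ^ 2 := by positivity
        have e2 : c / 4 * (w x * G x - 2 / c * (L x * w x)) ^ 2 = c / 4 * (w x * G x) ^ 2
          - (w x * G x) * (L x * w x) + 1 / c * L x ^ 2 * w x ^ 2 := by field_simp; ring
        have t2 : L x ^ 2 ≤ (N * A) ^ 2 := sq_le_sq' (by linarith [neg_abs_le (L x), hLA x])
          ((le_abs_self _).trans (hLA x))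
        have t3 : 1 / c * L x ^ 2 * w x ^ 2 ≤ 1 / c * (N * A) ^ 2 * w x ^ 2 := by gcongr
        linarith
      rw [e]
      simp only [hB]
      linarith
    have hint : ∫ x, ∑ k, X k x ∂(vol Ω) ≤ ∫ x, (B x - c / 2 * (w x * G x) ^ 2) ∂(vol Ω) := by
      refine integral_mono_ae (integrable_finsetSum _ fun k _ => hXi k)
        (hBi.sub (hGL.integrable_sq.const_mul _)) ?_
      filter_upwards [ae_restrict_mem Ω.isOpen.measurableSet] with x hx using hle x hx
    rw [hsum, integral_sub hBi (hGL.integrable_sq.const_mul _), integral_const_mul] at hint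
    rw [div_mul_eq_mul_div, le_div_iff₀ hc]
    linarith
  -- on `Ω` the weights tend to `1 / (2ρ)`
  have hlim : ∀ᵐ x ∂(vol Ω),
      Tendsto (fun n : ℕ => w x * hardyWeight (1 / ((n : ℝ) + 1)) (ρ x)) atTop
      (𝓝 (w x * (2 * ρ x)⁻¹)) := by
    filter_upwards [ae_restrict_mem Ω.isOpen.measurableSet] with x hx
    have hx0 := (h.mem_iff x).1 hx
    refine Tendsto.const_mul _ ?_
    have h1 : Tendsto (fun ε : ℝ => √(ρ x ^ 2 + ε ^ 2) + ρ x) (𝓝 0)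
        (𝓝 (√(ρ x ^ 2 + 0 ^ 2) + ρ x)) := by
      have : Continuous fun ε : ℝ => √(ρ x ^ 2 + ε ^ 2) + ρ x := by fun_prop
      exact this.tendsto 0
    have e1 : √(ρ x ^ 2 + 0 ^ 2) + ρ x = 2 * ρ x := by
      rw [zero_pow two_ne_zero, add_zero, Real.sqrt_sq hx0.le]; ring
    rw [e1] at h1
    exact (h1.comp (tendsto_one_div_add_atTop_nhds_zero_nat (𝕜 := ℝ))).inv₀ (by positivity)
  have hfin := (memLp_of_tendsto_ae (fun n => (key (1 / ((n : ℝ) + 1)) (by positivity)).1.1)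
    (fun n => eLpNorm_two_le (key (1 / ((n : ℝ) + 1)) (by positivity)).1
      (key (1 / ((n : ℝ) + 1)) (by positivity)).2) ENNReal.ofReal_ne_top hlim).1
  refine (hfin.const_mul 2).congr_norm ?_ (ae_of_all _ fun x => ?_)
  · exact hw.memLp.1.mul (h.contDiff.continuous.measurable.inv.aestronglyMeasurable)
  · rw [mul_inv]; congr 1; rw [div_eq_mul_inv]; ring

/-! ### The Jacobian identity -/

/-- The pairing identity for `w` carried by a compact subset of `Ω`. -/
lemma IsH1.integral_jacobian_of_compact {Ω : Opens (RN N)} {w b : RN N → ℝ}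
    {w' b' : Fin N → RN N → ℝ} (hw : IsH1 Ω univ w w') (hb : IsH1 Ω Ω b b') {K : Set (RN N)}
    (hK : IsCompact K) (hKΩ : K ⊆ Ω) (hwK : ∀ x ∈ Ω, x ∉ K → w x = 0) (k l : Fin N) :
    ∫ x, (b' l x * w' k x - b' k x * w' l x) ∂(vol Ω) = 0 := by
  obtain ⟨φ, hs, ht, hsub, -, h2, -, -⟩ := hw.exists_approx hK hwK
  have hev := eventually_cthickening_subset hK Ω.isOpen hKΩ
  rw [integral_sub (integrable_mul_of_L2 (hb.memLp_grad l) (hw.memLp_grad k))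
    (integrable_mul_of_L2 (hb.memLp_grad k) (hw.memLp_grad l)), sub_eq_zero]
  refine tendsto_nhds_unique (tendsto_integral_mul_const (hb.memLp_grad l) (hw.memLp_grad k)
    (fun n => (ht n).memLp_pd k 2 _) (h2 k)) ((tendsto_integral_mul_const (hb.memLp_grad k)
      (hw.memLp_grad l) (fun n => (ht n).memLp_pd l 2 _) (h2 l)).congr' ?_)
  filter_upwards [hev] with n hn
  have hs2 : ContDiff ℝ 2 (φ n) := contDiff_infty.1 (hs n) 2
  have hφ : IsTest Ω (φ n) := ⟨(ht n).contDiff, (ht n).compact, (hsub n).trans hn⟩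
  have e1 := hb.rel l _ (hφ.pd_test hs2 k)
  have e2 := hb.rel k _ (hφ.pd_test hs2 l)
  simp only [pd_comm hs2 l k] at e1
  linarith

/-- The null Lagrangian `∂_k w ∂_l b - ∂_l w ∂_k b` integrates to zero if `w` has zero trace and
`b` is any element of `W^{1,2}(Ω)`; Hardy's inequality controls the error of the cut-offs. -/
lemma IsDefining.integral_jacobian {Ω : Opens (RN N)}
    (hbdd : Bornology.IsBounded (Ω : Set (RN N))) {ρ : RN N → ℝ} {c : ℝ} (h : IsDefining Ω ρ c)
    {w b : RN N → ℝ} {w' b' : Fin N → RN N → ℝ} (hw : IsH1 Ω univ w w') (hb : IsH1 Ω Ω b b')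
    (k l : Fin N) :
    ∫ x, (b' l x * w' k x - b' k x * w' l x) ∂(vol Ω) = 0 := by
  have hH := h.memLp_div hbdd hw
  have i1 := (integrable_mul_of_L2 (hb.memLp_grad l) (hw.memLp_grad k)).sub
    (integrable_mul_of_L2 (hb.memLp_grad k) (hw.memLp_grad l))
  have i2 := (integrable_mul_of_L2 (hb.memLp_grad l) ((h.test_pd k).memLp_mul hH)).sub
    (integrable_mul_of_L2 (hb.memLp_grad k) ((h.test_pd l).memLp_mul hH))
  have l1 := (h.tendsto_integral_cut i1).add (h.tendsto_integral_cutD i2)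
  rw [add_zero] at l1
  refine tendsto_nhds_unique l1 (tendsto_const_nhds.congr fun n => ?_)
  have hc := h.test_cut n
  have e := ((hw.mono (subset_univ _)).mul_cutoff hc).integral_jacobian_of_compact hb hc.compact
    hc.subset (fun x _ hx => by simp [image_eq_zero_of_notMem_tsupport hx]) k l
  rw [← e]
  have m1 : Integrable (fun x => cut ρ n x * (b' l x * w' k x - b' k x * w' l x)) (vol Ω) := by
    refine ((integrable_mul_of_L2 (hc.memLp_mul (hb.memLp_grad l)) (hw.memLp_grad k)).sub
      (integrable_mul_of_L2 (hc.memLp_mul (hb.memLp_grad k)) (hw.memLp_grad l))).congr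
      (ae_of_all _ fun x => ?_)
    simp only [Pi.sub_apply]; ring
  have m2 : Integrable (fun x => b' l x * (pd k (cut ρ n) x * w x)
      - b' k x * (pd l (cut ρ n) x * w x)) (vol Ω) :=
    (integrable_mul_of_L2 (hb.memLp_grad l) (hc.memLp_pd_mul k hw.memLp)).sub
      (integrable_mul_of_L2 (hb.memLp_grad k) (hc.memLp_pd_mul l hw.memLp))
  rw [show ∫ x, (b' l x * (cut ρ n x * w' k x + pd k (cut ρ n) x * w x) - b' k x *
      (cut ρ n x * w' l x + pd l (cut ρ n) x * w x)) ∂(vol Ω) =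
      ∫ x, cut ρ n x * (b' l x * w' k x - b' k x * w' l x) ∂(vol Ω) +
      ∫ x, (b' l x * (pd k (cut ρ n) x * w x) - b' k x * (pd l (cut ρ n) x * w x)) ∂(vol Ω) by
    rw [← integral_add m1 m2]; congr 1; ext x; ring]
  congr 1
  refine integral_congr_ae ?_
  filter_upwards [ae_restrict_mem Ω.isOpen.measurableSet] with x hx
  have hx0 := ((h.mem_iff x).1 hx).ne'
  simp only [h.pd_cut, Pi.sub_apply]
  field_simp

/-- The pointwise algebra of the second-order estimate. Here `H` and `g` stand for the Hessian
and the gradient of the solution, `r` and `R` for those of the defining function. In the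
Jacobians of the fields `r i * v` with `v = ∑ r l * g l` the terms quadratic in `H` cancel. -/
lemma jacobian_pointwise {M c : ℝ} (hM : 0 ≤ M) (hc : 0 < c) (N : ℕ) :
    ∃ C : ℝ, 0 ≤ C ∧ ∀ (H R : Fin N → Fin N → ℝ) (g r Q' : Fin N → ℝ) (Q : ℝ),
      (∀ i j, H i j = H j i) → (∀ i j, |R i j| ≤ M) → (∀ i, |r i| ≤ M) → (∀ i, |Q' i| ≤ M) →
      |Q| ≤ M → c ≤ Q →
      c ^ 2 / 2 * ∑ i, ∑ j, H i j ^ 2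
        + ∑ i, ∑ j, (((Q * H i i + Q' i * g i) * (Q * H j j + Q' j * g j)
          - (Q * H i j + Q' j * g i) * (Q * H j i + Q' i * g j))
        - ((r i * (∑ l, (r l * H l i + R i l * g l)) + R i i * ∑ l, r l * g l)
          * (r j * (∑ l, (r l * H l j + R j l * g l)) + R j j * ∑ l, r l * g l)
          - (r i * (∑ l, (r l * H l j + R j l * g l)) + R j i * ∑ l, r l * g l)
          * (r j * (∑ l, (r l * H l i + R i l * g l)) + R i j * ∑ l, r l * g l)))
      ≤ M ^ 2 * (∑ i, H i i) ^ 2 + C * ∑ i, g i ^ 2 := by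
  set K : ℝ := N ^ 2 * (4 * M ^ 2 + (4 * M ^ 2 * (N * M) * (N * M)) + (2 * M ^ 2 * (N * M) ^ 2
    + 2 * M ^ 2 + 4 * M ^ 2 * (N * M) * (N * M))) with hK
  have hK0 : 0 ≤ K := by positivity
  refine ⟨K ^ 2 / (2 * c ^ 2) + K, by positivity, fun H R g r Q' Q hsym hR hr hQ' hQM hcQ => ?_⟩
  set S := ∑ i, ∑ j, H i j ^ 2 with hS
  set s := ∑ i, g i ^ 2 with hs
  have hS0 : 0 ≤ S := Finset.sum_nonneg fun _ _ => Finset.sum_nonneg fun _ _ => sq_nonneg _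
  have hs0 : 0 ≤ s := Finset.sum_nonneg fun _ _ => sq_nonneg _
  set X := √S with hX
  set Y := √s with hY
  have hX0 : 0 ≤ X := Real.sqrt_nonneg _
  have hY0 : 0 ≤ Y := Real.sqrt_nonneg _
  have hX2 : X ^ 2 = S := Real.sq_sqrt hS0
  have hY2 : Y ^ 2 = s := Real.sq_sqrt hs0
  have hH : ∀ i j, |H i j| ≤ X := fun i j => by
    rw [hX, ← Real.sqrt_sq_eq_abs]
    refine Real.sqrt_le_sqrt ((Finset.single_le_sum (f := fun j => H i j ^ 2)
      (fun _ _ => sq_nonneg _) (Finset.mem_univ j)).trans ?_)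
    exact Finset.single_le_sum (f := fun i => ∑ j, H i j ^ 2)
      (fun _ _ => Finset.sum_nonneg fun _ _ => sq_nonneg _) (Finset.mem_univ i)
  have hg : ∀ i, |g i| ≤ Y := fun i => by
    rw [hY, ← Real.sqrt_sq_eq_abs]
    exact Real.sqrt_le_sqrt (Finset.single_le_sum (f := fun i => g i ^ 2)
      (fun _ _ => sq_nonneg _) (Finset.mem_univ i))
  have mulb : ∀ {a b A B : ℝ}, |a| ≤ A → |b| ≤ B → |a * b| ≤ A * B := fun {a b A B} h1 h2 => by
    rw [abs_mul]; exact mul_le_mul h1 h2 (abs_nonneg _) ((abs_nonneg _).trans h1)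
  have addb : ∀ {a b A B : ℝ}, |a| ≤ A → |b| ≤ B → |a + b| ≤ A + B := fun {a b A B} h1 h2 =>
    (abs_add_le a b).trans (add_le_add h1 h2)
  have subb : ∀ {a b A B : ℝ}, |a| ≤ A → |b| ≤ B → |a - b| ≤ A + B := fun {a b A B} h1 h2 =>
    (abs_sub a b).trans (add_le_add h1 h2)
  set v := ∑ l, r l * g l with hv
  set d : Fin N → ℝ := fun i => ∑ l, (r l * H l i + R i l * g l) with hd
  have hvb : |v| ≤ N * M * Y :=
    (Finset.abs_sum_le_sum_abs _ _).trans ((Finset.sum_le_sum fun l _ => mulb (hr l) (hg l)).trans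
      (by simp [mul_assoc]))
  have hdb : ∀ i, |d i| ≤ N * M * (X + Y) := fun i =>
    (Finset.abs_sum_le_sum_abs _ _).trans ((Finset.sum_le_sum fun l _ =>
      addb (mulb (hr l) (hH l i)) (mulb (hR i l) (hg l))).trans
      (by simp [mul_assoc]; apply le_of_eq; ring))
  have term : ∀ i j, ((Q * H i i + Q' i * g i) * (Q * H j j + Q' j * g j)
          - (Q * H i j + Q' j * g i) * (Q * H j i + Q' i * g j))
        - ((r i * d i + R i i * v) * (r j * d j + R j j * v)
          - (r i * d j + R j i * v) * (r j * d i + R i j * v))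
      ≤ Q ^ 2 * (H i i * H j j) - Q ^ 2 * H i j ^ 2 + (4 * M ^ 2 + 4 * M ^ 2 * (N * M) * (N * M)) *
          (X * Y)
        + (2 * M ^ 2 * (N * M) ^ 2 + 2 * M ^ 2 + 4 * M ^ 2 * (N * M) * (N * M)) * Y ^ 2 := by
    intro i j
    have e : ((Q * H i i + Q' i * g i) * (Q * H j j + Q' j * g j)
          - (Q * H i j + Q' j * g i) * (Q * H j i + Q' i * g j))
        - ((r i * d i + R i i * v) * (r j * d j + R j j * v)
          - (r i * d j + R j i * v) * (r j * d i + R i j * v))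
        = Q ^ 2 * (H i i * H j j) - Q ^ 2 * (H i j * H j i) +
          (((Q * H i i) * (Q' j * g j) + (Q' i * g i) * (Q * H j j)
            - ((Q * H i j) * (Q' i * g j) + (Q' j * g i) * (Q * H j i)))
          - ((r i * d i) * (R j j * v) + (R i i * v) * (r j * d j)
            - ((r i * d j) * (R i j * v) + (R j i * v) * (r j * d i)))
          + ((Q' i * g i) * (Q' j * g j) - (Q' j * g i) * (Q' i * g j)
          - ((R i i * v) * (R j j * v) - (R j i * v) * (R i j * v)))) := by ring
    have b1 := fun i j => mulb hQM (hH i j)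
    have b2 := fun i j => mulb (hQ' i) (hg j)
    have b3 := fun i j => mulb (hr i) (hdb j)
    have b4 := fun i j => mulb (hR i j) hvb
    have hb := addb (subb
      (subb (addb (mulb (b1 i i) (b2 j j)) (mulb (b2 i i) (b1 j j)))
        (addb (mulb (b1 i j) (b2 i j)) (mulb (b2 j i) (b1 j i))))
      (subb (addb (mulb (b3 i i) (b4 j j)) (mulb (b4 i i) (b3 j j)))
        (addb (mulb (b3 i j) (b4 i j)) (mulb (b4 j i) (b3 j i)))))
      (subb (subb (mulb (b2 i i) (b2 j j)) (mulb (b2 j i) (b2 i j)))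
        (subb (mulb (b4 i i) (b4 j j)) (mulb (b4 j i) (b4 i j))))
    have hb' := (le_abs_self _).trans hb
    rw [e, show H i j * H j i = H i j ^ 2 by rw [← hsym i j, sq]]
    refine (add_le_add_right hb' _).trans (le_of_eq ?_)
    ring
  have htot := Finset.sum_le_sum fun i (_ : i ∈ Finset.univ) =>
    Finset.sum_le_sum fun j (_ : j ∈ Finset.univ) => term i j
  have e2 : ∑ i : Fin N, ∑ j : Fin N, (Q ^ 2 * (H i i * H j j) - Q ^ 2 * H i j ^ 2
      + (4 * M ^ 2 + 4 * M ^ 2 * (N * M) * (N * M)) * (X * Y)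
        + (2 * M ^ 2 * (N * M) ^ 2 + 2 * M ^ 2 + 4 * M ^ 2 * (N * M) * (N * M)) * Y ^ 2)
      = Q ^ 2 * (∑ i, H i i) ^ 2 - Q ^ 2 * S
        + N ^ 2 * ((4 * M ^ 2 + 4 * M ^ 2 * (N * M) * (N * M)) * (X * Y)
        + (2 * M ^ 2 * (N * M) ^ 2 + 2 * M ^ 2 + 4 * M ^ 2 * (N * M) * (N * M)) * Y ^ 2) := by
    simp only [Finset.sum_add_distrib, Finset.sum_sub_distrib, ← Finset.mul_sum, Finset.sum_const,
      Finset.card_univ, Fintype.card_fin, nsmul_eq_mul, ← Finset.sum_mul, sq (∑ i, H i i)]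
    ring
  rw [e2] at htot
  have hQ2 : Q ^ 2 ≤ M ^ 2 := sq_le_sq' (by linarith [neg_abs_le Q]) ((le_abs_self Q).trans hQM)
  have hQ2' : c ^ 2 ≤ Q ^ 2 := by gcongr
  have t1 : Q ^ 2 * (∑ i, H i i) ^ 2 ≤ M ^ 2 * (∑ i, H i i) ^ 2 := by gcongr
  have t2 : c ^ 2 * S ≤ Q ^ 2 * S := by gcongr
  have t3 : N ^ 2 * ((4 * M ^ 2 + 4 * M ^ 2 * (N * M) * (N * M)) * (X * Y)
        + (2 * M ^ 2 * (N * M) ^ 2 + 2 * M ^ 2 + 4 * M ^ 2 * (N * M) * (N * M)) * Y ^ 2)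
      ≤ K * (X * Y) + K * Y ^ 2 := by
    have hXY : 0 ≤ X * Y := by positivity
    have hYY : 0 ≤ Y ^ 2 := by positivity
    have f1 : N ^ 2 * (4 * M ^ 2 + 4 * M ^ 2 * (N * M) * (N * M)) ≤ K := by
      rw [hK]; apply mul_le_mul_of_nonneg_left _ (by positivity)
      have : 0 ≤ 2 * M ^ 2 * (N * M) ^ 2 + 2 * M ^ 2 + 4 * M ^ 2 * (N * M) * (N * M) := by
        positivity
      linarith
    have f2 : N ^ 2 * (2 * M ^ 2 * (N * M) ^ 2 + 2 * M ^ 2 + 4 * M ^ 2 * (N * M) *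
        (N * M)) ≤ K := by
      rw [hK]; apply mul_le_mul_of_nonneg_left _ (by positivity)
      have : 0 ≤ 4 * M ^ 2 + 4 * M ^ 2 * (N * M) * (N * M) := by positivity
      linarith
    nlinarith [mul_le_mul_of_nonneg_right f1 hXY, mul_le_mul_of_nonneg_right f2 hYY]
  have t4 : K * (X * Y) ≤ c ^ 2 / 2 * S + K ^ 2 / (2 * c ^ 2) * s := by
    rw [← hX2, ← hY2]
    have h1 : 0 ≤ c ^ 2 / 2 * (X - K / c ^ 2 * Y) ^ 2 := by positivity
    have h2 : c ^ 2 / 2 * (X - K / c ^ 2 * Y) ^ 2 = c ^ 2 / 2 * X ^ 2 - K * (X * Y)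
      + K ^ 2 / (2 * c ^ 2) * Y ^ 2 := by field_simp; ring
    linarith
  rw [hY2] at t3 htot
  linarith

/-! ### The Hessian estimate -/

/-- Up to a multiple of `∇ρ`, the gradient of a function with zero trace has zero trace:
`(|∇ρ|² + ρ²) ∂_i u - ∂_iρ (∇ρ · ∇u) = ∑_k ∂_kρ (∂_kρ ∂_i u - ∂_iρ ∂_k u) + ρ² ∂_i u`. -/
lemma IsDefining.zeroExt_grad_sub {Ω : Opens (RN N)} {ρ : RN N → ℝ} {c : ℝ}
    (h : IsDefining Ω ρ c) {u : RN N → ℝ} {g : Fin N → RN N → ℝ} {H : Fin N → Fin N → RN N → ℝ}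
    (hu : IsH1 Ω univ u g) (hg : ∀ i, IsH1 Ω Ω (g i) (H i)) (i : Fin N)
    {W' : Fin N → RN N → ℝ}
    (hW : IsH1 Ω Ω (fun x => (∑ k, pd k ρ x * pd k ρ x + ρ x * ρ x) * g i x
      - pd i ρ x * ∑ k, pd k ρ x * g k x) W') :
    IsH1 Ω univ (fun x => (∑ k, pd k ρ x * pd k ρ x + ρ x * ρ x) * g i x
      - pd i ρ x * ∑ k, pd k ρ x * g k x) W' := by
  have h1 := (IsH1.sum (s := Finset.univ) fun k _ =>
    (h.zeroExt_tangential hu hg k i).mul (h.test_pd k)).add (h.zeroExt_mul ((hg i).mul h.test))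
  have e : (fun x => ∑ k, pd k ρ x * (pd k ρ x * g i x - pd i ρ x * g k x) + ρ x * (ρ x * g i x))
      = fun x => (∑ k, pd k ρ x * pd k ρ x + ρ x * ρ x) * g i x
      - pd i ρ x * ∑ k, pd k ρ x * g k x := by
    ext x
    simp only [add_mul, Finset.sum_mul, Finset.mul_sum, mul_sub, Finset.sum_sub_distrib]
    rw [show ∑ k, pd k ρ x * (pd k ρ x * g i x) = ∑ k, pd k ρ x * pd k ρ x * g i x from
      Finset.sum_congr rfl fun _ _ => by ring,
      show ∑ k, pd k ρ x * (pd i ρ x * g k x) = ∑ k, pd i ρ x * (pd k ρ x * g k x) from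
      Finset.sum_congr rfl fun _ _ => by ring]
    ring
  rw [e] at h1
  exact h1.congr (EventuallyEq.refl _ _) ((h1.mono (subset_univ _)).grad_unique hW)

/-- The second-order a priori estimate: for `u ∈ W^{2,2}(Ω) ∩ W^{1,2}_0(Ω)` the Hessian is
controlled in `L²` by the Laplacian and the gradient. With `Q = |∇ρ|² + ρ²` and `v = ∇ρ · ∇u` the
fields `Q ∇u` and `v ∇ρ` differ by a field with zero trace, so that the sums of the `2 × 2` minors
of their derivatives have the same integral. For `Q ∇u` this sum is `Q² ((Δu)² - |D²u|²)` and for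
`v ∇ρ` it is zero, both up to terms which are at most linear in `D²u`. -/
lemma IsDefining.hessian_estimate {Ω : Opens (RN N)}
    (hbdd : Bornology.IsBounded (Ω : Set (RN N))) {ρ : RN N → ℝ} {c : ℝ}
    (h : IsDefining Ω ρ c) :
    ∃ C : ℝ, 0 ≤ C ∧ ∀ (u : RN N → ℝ) (g : Fin N → RN N → ℝ) (H : Fin N → Fin N → RN N → ℝ),
      IsH1 Ω univ u g → (∀ i, IsH1 Ω Ω (g i) (H i)) → (∀ i j, H i j =ᵐ[vol Ω] H j i) →
      ∑ i, ∑ j, ∫ x, H i j x ^ 2 ∂(vol Ω)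
        ≤ C * (∫ x, (∑ i, H i i x) ^ 2 ∂(vol Ω) + ∑ i, ∫ x, g i x ^ 2 ∂(vol Ω)) := by
  set Q : RN N → ℝ := fun x => ∑ k, pd k ρ x * pd k ρ x + ρ x * ρ x with hQ
  have hQt : IsTest univ Q :=
    (IsTest.sum fun k _ => (h.test_pd k).mul_left (h.test_pd k).contDiff).add
      (h.test.mul_left h.test.contDiff)
  obtain ⟨M, hM0, hMQ, hMQ', hMr, hMR⟩ : ∃ M : ℝ, 0 ≤ M ∧ (∀ x, |Q x| ≤ M) ∧
      (∀ i x, |pd i Q x| ≤ M) ∧ (∀ i x, |pd i ρ x| ≤ M) ∧ ∀ i j x, |pd i (pd j ρ) x| ≤ M := by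
    obtain ⟨M1, p1, h1⟩ := hQt.bounded
    obtain ⟨M2, p2, h2⟩ := hQt.bounded_pd
    obtain ⟨M3, p3, h3⟩ := h.test.bounded_pd
    have : ∀ j, ∃ C, 0 ≤ C ∧ ∀ i x, |pd i (pd j ρ) x| ≤ C := fun j => (h.test_pd j).bounded_pd
    choose M4 p4 h4 using this
    have p5 : 0 ≤ ∑ j, M4 j := Finset.sum_nonneg fun j _ => p4 j
    refine ⟨M1 + M2 + M3 + ∑ j, M4 j, by positivity, fun x => ?_, fun i x => ?_, fun i x => ?_,
      fun i j x => ?_⟩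
    · linarith [h1 x]
    · linarith [h2 i x]
    · linarith [h3 i x]
    · have := Finset.single_le_sum (f := M4) (fun j _ => p4 j) (Finset.mem_univ j)
      linarith [h4 j i x]
  obtain ⟨C, hC0, hC⟩ := jacobian_pointwise hM0 h.pos N
  have hc := h.pos
  refine ⟨2 / c ^ 2 * (M ^ 2 + C), by positivity, fun u g H hu hg hsym => ?_⟩
  set v : RN N → ℝ := fun x => ∑ l, pd l ρ x * g l x with hv
  set d : Fin N → RN N → ℝ := fun k x => ∑ l, (pd l ρ x * H l k x + pd k (pd l ρ) x * g l x) with hd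
  have hvH : IsH1 Ω Ω v d := IsH1.sum fun l _ => (hg l).mul (h.test_pd l)
  set a' : Fin N → Fin N → RN N → ℝ := fun i k x => Q x * H i k x + pd k Q x * g i x with ha'
  set b' : Fin N → Fin N → RN N → ℝ := fun i k x =>
      pd i ρ x * d k x + pd k (pd i ρ) x * v x with hb'
  have ha : ∀ i, IsH1 Ω Ω (fun x => Q x * g i x) (a' i) := fun i => (hg i).mul hQt
  have hb : ∀ i, IsH1 Ω Ω (fun x => pd i ρ x * v x) (b' i) := fun i => hvH.mul (h.test_pd i)
  have hW : ∀ i, IsH1 Ω univ (fun x => Q x * g i x - pd i ρ x * v x)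
      (fun k x => a' i k x - b' i k x) := fun i =>
    h.zeroExt_grad_sub hu hg i ((ha i).sub (hb i))
  -- the difference of the minors of the two fields
  set J : Fin N → Fin N → RN N → ℝ := fun i j x =>
    (a' i i x * a' j j x - a' i j x * a' j i x) - (b' i i x * b' j j x - b' i j x * b' j i x) with hJ
  have ma := fun i k => (ha i).memLp_grad k
  have mb := fun i k => (hb i).memLp_grad k
  have mW := fun i k => (hW i).memLp_grad k
  have hJi : ∀ i j, Integrable (J i j) (vol Ω) := fun i j =>
    ((integrable_mul_of_L2 (ma i i) (ma j j)).sub (integrable_mul_of_L2 (ma i j) (ma j i))).sub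
    ((integrable_mul_of_L2 (mb i i) (mb j j)).sub (integrable_mul_of_L2 (mb i j) (mb j i)))
  have hJ0 : ∀ i j, ∫ x, J i j x ∂(vol Ω) = 0 := fun i j => by
    -- a difference of two products is split so that each summand contains the zero trace field
    have e1 := h.integral_jacobian hbdd (hW i) (ha j) i j
    have e2 := h.integral_jacobian hbdd (hW j) (hb i) j i
    have i1 := (integrable_mul_of_L2 (ma j j) (mW i i)).sub (integrable_mul_of_L2 (ma j i) (mW i j))
    have i2 := (integrable_mul_of_L2 (mb i i) (mW j j)).sub (integrable_mul_of_L2 (mb i j) (mW j i))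
    have e3 := integral_add i1 i2
    simp only [Pi.sub_apply] at e3
    rw [e1, e2, add_zero] at e3
    rw [← e3]
    congr 1; ext x; simp only [hJ]; ring
  have hsumJ : ∫ x, ∑ i, ∑ j, J i j x ∂(vol Ω) = 0 := by
    rw [integral_finsetSum _ fun i _ => integrable_finsetSum _ fun j _ => hJi i j]
    refine Finset.sum_eq_zero fun i _ => ?_
    rw [integral_finsetSum _ fun j _ => hJi i j]
    exact Finset.sum_eq_zero fun j _ => hJ0 i j
  have iH : ∀ i j, Integrable (fun x => H i j x ^ 2) (vol Ω) := fun i j =>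
    ((hg i).memLp_grad j).integrable_sq
  have iHH : Integrable (fun x => ∑ i, ∑ j, H i j x ^ 2) (vol Ω) :=
    integrable_finsetSum _ fun i _ => integrable_finsetSum _ fun j _ => iH i j
  have iJ : Integrable (fun x => ∑ i, ∑ j, J i j x) (vol Ω) :=
    integrable_finsetSum _ fun i _ => integrable_finsetSum _ fun j _ => hJi i j
  have iΔ : Integrable (fun x => (∑ i, H i i x) ^ 2) (vol Ω) :=
    (memLp_finsetSum _ fun i _ => (hg i).memLp_grad i).integrable_sq
  have ig : Integrable (fun x => ∑ i, g i x ^ 2) (vol Ω) :=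
    integrable_finsetSum _ fun i _ => (hg i).memLp.integrable_sq
  have hint := integral_mono_ae (μ := vol Ω)
    (f := fun x => c ^ 2 / 2 * ∑ i, ∑ j, H i j x ^ 2 + ∑ i, ∑ j, J i j x)
    (g := fun x => M ^ 2 * (∑ i, H i i x) ^ 2 + C * ∑ i, g i x ^ 2)
    ((iHH.const_mul _).add iJ) ((iΔ.const_mul _).add (ig.const_mul _)) (by
      have hs : ∀ᵐ x ∂(vol Ω), ∀ i j, H i j x = H j i x :=
        ae_all_iff.2 fun i => ae_all_iff.2 fun j => hsym i j
      filter_upwards [ae_restrict_mem Ω.isOpen.measurableSet, hs] with x hx hsx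
      refine hC (fun i j => H i j x) (fun i j => pd i (pd j ρ) x) (fun i => g i x)
        (fun i => pd i ρ x) (fun i => pd i Q x) (Q x) hsx (fun i j => hMR i j x)
        (fun i => hMr i x) (fun i => hMQ' i x) (hMQ x) ?_
      have := h.le x hx
      simp only [hQ, ← sq]; exact this)
  rw [integral_add (iHH.const_mul _) iJ, integral_add (iΔ.const_mul _) (ig.const_mul _),
    integral_const_mul, integral_const_mul, integral_const_mul, hsumJ, add_zero,
    integral_finsetSum _ fun i _ => (hg i).memLp.integrable_sq,
    integral_finsetSum _ fun i _ => integrable_finsetSum _ fun j _ => iH i j] at hint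
  simp only [fun i => integral_finsetSum (μ := vol Ω) Finset.univ fun j _ => iH i j] at hint
  have p1 : 0 ≤ ∫ x, (∑ i, H i i x) ^ 2 ∂(vol Ω) := integral_nonneg fun _ => sq_nonneg _
  have p2 : 0 ≤ ∑ i, ∫ x, g i x ^ 2 ∂(vol Ω) :=
    Finset.sum_nonneg fun _ _ => integral_nonneg fun _ => sq_nonneg _
  rw [show 2 / c ^ 2 * (M ^ 2 + C) * (∫ x, (∑ i, H i i x) ^ 2 ∂(vol Ω) +
    ∑ i, ∫ x, g i x ^ 2 ∂(vol Ω)) = ((M ^ 2 + C) * (∫ x, (∑ i, H i i x) ^ 2 ∂(vol Ω) +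
    ∑ i, ∫ x, g i x ^ 2 ∂(vol Ω))) / (c ^ 2 / 2) by field_simp, le_div_iff₀ (by positivity)]
  have q1 := mul_nonneg hC0 p1
  have q2 := mul_nonneg (sq_nonneg M) p2
  linarith

/-! ### A Sobolev inequality in dimension at most three -/

lemma norm_le_sum_abs (L : RN N →L[ℝ] ℝ) :
    ‖L‖ ≤ ∑ k, |L (EuclideanSpace.single k (1 : ℝ))| := by
  refine L.opNorm_le_bound (Finset.sum_nonneg fun _ _ => abs_nonneg _) fun v => ?_
  have hv : v = ∑ i, v i • EuclideanSpace.single i (1 : ℝ) := by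
    ext j; simp [Finset.sum_apply, Pi.single_apply]
  conv_lhs => rw [hv, map_sum]
  rw [Finset.sum_mul]
  refine (norm_sum_le _ _).trans (Finset.sum_le_sum fun k _ => ?_)
  rw [map_smul, smul_eq_mul, norm_mul, mul_comm]
  exact mul_le_mul_of_nonneg_left (PiLp.norm_apply_le v k) (norm_nonneg _)

/-- The Sobolev inequality `W^{1,1} → L^{3/2}` in dimension at most three. In dimension three it is
the Gagliardo-Nirenberg-Sobolev inequality, to which lower dimensions are reduced by multiplying
with a bump function in the missing variables. -/
lemma sobolev_one_of_le_three (hN : N ≤ 3) :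
    ∃ C : ℝ, 0 ≤ C ∧ ∀ ψ : RN N → ℝ, IsTest univ ψ →
      (∫ x, |ψ x| ^ (3 / 2 : ℝ)) ^ 2 ≤ C * (∫ x, (∑ k, |pd k ψ x| + |ψ x|)) ^ 3 := by
  let F := RN (3 - N)
  let μ : Measure (RN N × F) := (volume : Measure (RN N)).prod (volume : Measure F)
  let ζ : F → ℝ := bump (3 - N) 0
  have hζc : ContDiff ℝ 1 ζ := (bump (3 - N) 0).contDiff
  have hζs : HasCompactSupport ζ := (bump (3 - N) 0).hasCompactSupport
  have hdim : Module.finrank ℝ (RN N × F) = 3 := by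
    rw [Module.finrank_prod]; simp [F]; omega
  have hp : Real.HolderConjugate (Module.finrank ℝ (RN N × F)) (3 / 2) := by
    rw [hdim, Real.holderConjugate_iff]; norm_num
  set K : ℝ≥0 := lintegralPowLePowLIntegralFDerivConst μ (3 / 2)
  set b : ℝ≥0∞ := ∫⁻ y, ‖ζ y‖ₑ ^ (3 / 2 : ℝ) with hb
  set Z : F → ℝ := fun y => |ζ y| + ‖fderiv ℝ ζ y‖ with hZ
  have hZcont : Continuous Z :=
    hζc.continuous.abs.add (hζc.continuous_fderiv one_ne_zero).norm
  have hZc : HasCompactSupport Z := by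
    refine HasCompactSupport.add ?_ ((hζs.fderiv ℝ).norm)
    exact hζs.norm
  set z : ℝ≥0∞ := ∫⁻ y, ENNReal.ofReal (Z y) with hz
  have hz_top : z ≠ ⊤ := (hZcont.integrable_of_hasCompactSupport hZc).lintegral_lt_top.ne
  have hb0 : b ≠ 0 := by
    have hm : Measurable fun y => ‖ζ y‖ₑ ^ (3 / 2 : ℝ) := by
      have := hζc.continuous.measurable; fun_prop
    rw [hb, Ne, lintegral_eq_zero_iff hm]
    intro h0
    have h1 : (fun y => ‖ζ y‖ₑ ^ (3 / 2 : ℝ)) = 0 :=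
      (Continuous.ae_eq_iff_eq volume (by have := hζc.continuous; fun_prop) continuous_const).1 h0
    have h2 := congrFun h1 0
    have h3 : ζ 0 = 1 := (bump (3 - N) 0).one_of_mem_closedBall
      (mem_closedBall_self (bump (3 - N) 0).rIn_pos.le)
    rw [h3] at h2
    simp at h2
  have habs : ∀ {V : Type} [NormedAddCommGroup V] [InnerProductSpace ℝ V] [FiniteDimensional ℝ V]
      [MeasurableSpace V] [BorelSpace V] {f : V → ℝ}, Continuous f → HasCompactSupport f →
      Integrable (fun x => |f x| ^ (3 / 2 : ℝ)) ∧
      ∫⁻ x, ‖f x‖ₑ ^ (3 / 2 : ℝ) = ENNReal.ofReal (∫ x, |f x| ^ (3 / 2 : ℝ)) := by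
    intro V _ _ _ _ _ f hf hfc
    have hi : Integrable (fun x => |f x| ^ (3 / 2 : ℝ)) :=
      (hf.abs.rpow_const fun _ => Or.inr (by norm_num)).integrable_of_hasCompactSupport
        (hfc.mono fun x hx hx0 => hx (by simp [hx0]))
    refine ⟨hi, ?_⟩
    rw [ofReal_integral_eq_lintegral_ofReal hi (ae_of_all _ fun x => by positivity)]
    refine lintegral_congr fun x => ?_
    rw [← ENNReal.ofReal_rpow_of_nonneg (abs_nonneg _) (by norm_num), Real.enorm_eq_ofReal_abs]
  have hb_top : b ≠ ⊤ := by
    rw [hb, (habs hζc.continuous hζs).2]; exact ENNReal.ofReal_ne_top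
  refine ⟨(K * z.toReal ^ (3 / 2 : ℝ) / b.toReal) ^ 2, by positivity, fun ψ hψ => ?_⟩
  set S : RN N → ℝ := fun x => ∑ k, |pd k ψ x| + |ψ x| with hS
  have hS0 : ∀ x, 0 ≤ S x := fun x => by positivity
  have hScont : Continuous S :=
    (continuous_finsetSum _ fun k _ => (hψ.continuous_pd k).abs).add hψ.contDiff.continuous.abs
  have hSc : HasCompactSupport S := by
    refine HasCompactSupport.intro hψ.compact fun x hx => ?_
    have h1 : ∀ k, pd k ψ x = 0 := fun k =>
      image_eq_zero_of_notMem_tsupport fun h => hx (tsupport_pd_subset ψ k h)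
    simp [hS, h1, image_eq_zero_of_notMem_tsupport hx]
  have hSi := hScont.integrable_of_hasCompactSupport (μ := volume) hSc
  set u : RN N × F → ℝ := fun p => ψ p.1 * ζ p.2 with hu
  have huc : ContDiff ℝ 1 u := (hψ.contDiff.comp contDiff_fst).mul (hζc.comp contDiff_snd)
  have hus : HasCompactSupport u := by
    refine HasCompactSupport.intro (hψ.compact.isCompact.prod hζs.isCompact) fun p hp => ?_
    rw [mem_prod, not_and_or] at hp
    rcases hp with hp | hp
    · simp [hu, image_eq_zero_of_notMem_tsupport hp]
    · simp [hu, image_eq_zero_of_notMem_tsupport hp]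
  have hgns := lintegral_pow_le_pow_lintegral_fderiv μ huc hus hp
  have hA := (habs hψ.contDiff.continuous hψ.compact)
  set A : ℝ := ∫ x, |ψ x| ^ (3 / 2 : ℝ) with hAdef
  have hA0 : 0 ≤ A := integral_nonneg fun x => by positivity
  have e1 : ∫⁻ p, ‖u p‖ₑ ^ (3 / 2 : ℝ) ∂μ = ENNReal.ofReal A * b := by
    rw [← hA.2, hb, ← lintegral_prod_mul]
    · refine lintegral_congr fun p => ?_
      rw [hu, enorm_mul, ENNReal.mul_rpow_of_nonneg _ _ (by norm_num)]
    · have := hψ.contDiff.continuous.measurable; fun_prop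
    · have := hζc.continuous.measurable; fun_prop
  have e2 : ∫⁻ p, ‖fderiv ℝ u p‖ₑ ∂μ ≤ ENNReal.ofReal (∫ x, S x) * z := by
    rw [ofReal_integral_eq_lintegral_ofReal hSi (ae_of_all _ hS0), hz, ← lintegral_prod_mul]
    · refine lintegral_mono fun p => ?_
      rw [← ENNReal.ofReal_mul (hS0 _), ← ofReal_norm]
      refine ENNReal.ofReal_le_ofReal ?_
      have d1 : HasFDerivAt (fun p : RN N × F => ψ p.1)
          ((fderiv ℝ ψ p.1).comp (ContinuousLinearMap.fst ℝ (RN N) F)) p :=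
        (hψ.contDiff.differentiable one_ne_zero p.1).hasFDerivAt.comp p hasFDerivAt_fst
      have d2 : HasFDerivAt (fun p : RN N × F => ζ p.2)
          ((fderiv ℝ ζ p.2).comp (ContinuousLinearMap.snd ℝ (RN N) F)) p :=
        (hζc.differentiable one_ne_zero p.2).hasFDerivAt.comp p hasFDerivAt_snd
      rw [show fderiv ℝ u p = _ from (d1.mul d2).fderiv]
      have n1 : ‖(fderiv ℝ ψ p.1).comp (ContinuousLinearMap.fst ℝ (RN N) F)‖ ≤ ‖fderiv ℝ ψ p.1‖ :=
        (ContinuousLinearMap.opNorm_comp_le _ _).trans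
          (mul_le_of_le_one_right (norm_nonneg _) (ContinuousLinearMap.norm_fst_le ..))
      have n2 : ‖(fderiv ℝ ζ p.2).comp (ContinuousLinearMap.snd ℝ (RN N) F)‖ ≤ ‖fderiv ℝ ζ p.2‖ :=
        (ContinuousLinearMap.opNorm_comp_le _ _).trans
          (mul_le_of_le_one_right (norm_nonneg _) (ContinuousLinearMap.norm_snd_le ..))
      have n3 : ‖fderiv ℝ ψ p.1‖ ≤ ∑ k, |pd k ψ p.1| := norm_le_sum_abs _
      refine (norm_add_le _ _).trans ?_
      rw [norm_smul, norm_smul, Real.norm_eq_abs, Real.norm_eq_abs]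
      have p1 : 0 ≤ ∑ k, |pd k ψ p.1| := by positivity
      have q1 := mul_le_mul_of_nonneg_left n2 (abs_nonneg (ψ p.1))
      have q2 := mul_le_mul_of_nonneg_left (n1.trans n3) (abs_nonneg (ζ p.2))
      have q3 : 0 ≤ (∑ k, |pd k ψ p.1|) * ‖fderiv ℝ ζ p.2‖ := by positivity
      have q4 : 0 ≤ |ψ p.1| * |ζ p.2| := by positivity
      simp only [hS, hZ]
      linarith
    · exact hScont.measurable.ennreal_ofReal.aemeasurable
    · exact hZcont.measurable.ennreal_ofReal.aemeasurable
  rw [e1] at hgns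
  have hI0 : 0 ≤ ∫ x, S x := integral_nonneg hS0
  have h3 : ENNReal.ofReal A * b ≤ K * (ENNReal.ofReal (∫ x, S x) * z) ^ (3 / 2 : ℝ) :=
    hgns.trans (by gcongr)
  have h4 := ENNReal.toReal_mono (by finiteness) h3
  rw [ENNReal.toReal_mul, ENNReal.toReal_mul, ← ENNReal.toReal_rpow, ENNReal.toReal_mul,
    ENNReal.toReal_ofReal hA0, ENNReal.toReal_ofReal hI0, ENNReal.coe_toReal,
    Real.mul_rpow hI0 ENNReal.toReal_nonneg] at h4
  have hbpos : 0 < b.toReal := ENNReal.toReal_pos hb0 hb_top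
  have h5 : A ≤ K * z.toReal ^ (3 / 2 : ℝ) / b.toReal * (∫ x, S x) ^ (3 / 2 : ℝ) := by
    rw [div_mul_eq_mul_div, le_div_iff₀ hbpos]
    linarith
  have h6 := pow_le_pow_left₀ hA0 h5 2
  rw [mul_pow] at h6
  refine h6.trans (le_of_eq ?_)
  congr 1
  rw [← Real.rpow_natCast, ← Real.rpow_mul hI0, ← Real.rpow_natCast]
  norm_num

/-! ### The embedding of `W^{1,2}(Ω)` into `L⁶(Ω)` -/

lemma pd_pow {f : RN N → ℝ} (hf : ContDiff ℝ 1 f) (m : ℕ) (i : Fin N) (x : RN N) :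
    pd i (fun x => f x ^ m) x = m * f x ^ (m - 1) * pd i f x := by
  simp only [pd]
  rw [fderiv_fun_pow _ (hf.differentiable one_ne_zero _)]
  simp

lemma IsTest.pow {U : Set (RN N)} {f : RN N → ℝ} (hf : IsTest U f) (m : ℕ) :
    IsTest U fun x => f x ^ (m + 1) := by
  simp only [pow_succ]
  exact hf.mul_left (hf.contDiff.pow m)

/-- A Sobolev inequality on `Ω` with cut-offs, uniform in the cut-offs. It comes from the
`W^{1,1}` inequality for `(cut φ)^4`; the derivative of the cut-off is removed by integrating by
parts against the vector field `∇ρ`, along which the cut-off increases. -/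
lemma IsDefining.exists_integral_cut_pow_six_le (hN : N ≤ 3) {Ω : Opens (RN N)} {ρ : RN N → ℝ}
    {c : ℝ} (h : IsDefining Ω ρ c) :
    ∃ K : ℝ, 0 ≤ K ∧ ∃ n₀ : ℕ, ∀ n ≥ n₀, ∀ φ, IsTest univ φ →
      ∫ x, (cut ρ n x * φ x) ^ 6
        ≤ K * (∫ x, (cut ρ n x * (|φ x| + ∑ k, |pd k φ x|)) ^ 2) ^ 3 := by
  obtain ⟨C, hC0, hC⟩ := sobolev_one_of_le_three hN
  obtain ⟨A, hA0, hA1, hA2⟩ : ∃ A : ℝ, 0 ≤ A ∧ (∀ k x, |pd k ρ x| ≤ A) ∧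
      ∀ k x, |pd k (pd k ρ) x| ≤ A := by
    obtain ⟨M3, p3, h3⟩ := h.test.bounded_pd
    have : ∀ j, ∃ C, 0 ≤ C ∧ ∀ i x, |pd i (pd j ρ) x| ≤ C := fun j => (h.test_pd j).bounded_pd
    choose M4 p4 h4 using this
    have p5 : 0 ≤ ∑ j, M4 j := Finset.sum_nonneg fun j _ => p4 j
    refine ⟨M3 + ∑ j, M4 j, by positivity, fun i x => ?_, fun j x => ?_⟩
    · linarith [h3 i x]
    · have := Finset.single_le_sum (f := M4) (fun j _ => p4 j) (Finset.mem_univ j)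
      linarith [h4 j j x]
  have hc := h.pos
  obtain ⟨n₀, hn₀⟩ : ∃ n₀ : ℕ, ∀ n ≥ n₀, (2 * (1 / ((n : ℝ) + 1))) ^ 2 ≤ c / 2 := by
    have h1 : Tendsto (fun n : ℕ => (2 * (1 / ((n : ℝ) + 1))) ^ 2) atTop (𝓝 ((2 * 0) ^ 2)) :=
      ((tendsto_one_div_add_atTop_nhds_zero_nat (𝕜 := ℝ)).const_mul 2).pow 2
    have h2 : (2 * (0 : ℝ)) ^ 2 < c / 2 := by rw [mul_zero, zero_pow two_ne_zero]; positivity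
    exact eventually_atTop.1 (h1.eventually (ge_mem_nhds h2))
  set C₁ : ℝ := 5 + N * A * (2 / c * (4 * A * (N + 1))) with hC₁
  have hC₁0 : 0 ≤ C₁ := by positivity
  refine ⟨C ^ 2 * C₁ ^ 6, by positivity, n₀, fun n hn φ hφ => ?_⟩
  have hH := h.test_cut n
  set χ : RN N → ℝ := fun x => cut ρ n x * φ x with hχdef
  have hχ : IsTest univ χ := hH.toUniv.mul_right hφ.contDiff
  set G : RN N → ℝ := fun x => |φ x| + ∑ k, |pd k φ x| with hG
  have hG0 : ∀ x, 0 ≤ G x := fun x => by positivity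
  have hGc : Continuous G := hφ.contDiff.continuous.abs.add
    (continuous_finsetSum _ fun k _ => (hφ.continuous_pd k).abs)
  -- `∫ T` is estimated by the Cauchy-Schwarz inequality; `E` contains the derivative of the
  -- cut-off, which is of order `n`, and `∫ E` is bounded by a multiple of `∫ T`
  set T : RN N → ℝ := fun x => |χ x| ^ 3 * (cut ρ n x * G x) with hT
  set E : RN N → ℝ := fun x => 4 * cut ρ n x ^ 3 * cutD ρ n x * φ x ^ 4 with hE
  have hH0 := cut_nonneg ρ n
  have hE0 : ∀ x, 0 ≤ E x := fun x => by
    have := hH0 x; have := cutD_nonneg ρ n x; positivity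
  have hTc : Continuous T := (hχ.contDiff.continuous.abs.pow 3).mul (hH.contDiff.continuous.mul hGc)
  have hTi : Integrable T volume := hTc.integrable_of_hasCompactSupport
    (HasCompactSupport.intro hH.compact fun x hx => by
      simp [hT, image_eq_zero_of_notMem_tsupport hx])
  have hEi : Integrable E volume :=
    (((continuous_const.mul (hH.contDiff.continuous.pow 3)).mul (h.continuous_cutD n)).mul
      (hφ.contDiff.continuous.pow 4)).integrable_of_hasCompactSupport
    (HasCompactSupport.intro hH.compact fun x hx => by
      simp [image_eq_zero_of_notMem_tsupport hx])
  -- the cut-off is active only where `ρ` is small, hence where the gradient of `ρ` is large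
  have hEq : ∀ x, c / 2 * E x ≤ E x * ∑ k, pd k ρ x ^ 2 := fun x => by
    by_cases hD : cutD ρ n x = 0
    · simp [hE, hD]
    · have r1 : 0 ≤ (n + 1) * ρ x - 1 := by
        by_contra! hlt
        exact hD (by rw [cutD, deriv_smoothTransition_of_neg hlt, mul_zero])
      have r2 : (n + 1) * ρ x - 1 ≤ 1 := by
        by_contra! hlt
        exact hD (by rw [cutD, deriv_smoothTransition_of_one_lt hlt, mul_zero])
      have hn1 : (0 : ℝ) < n + 1 := by positivity
      have r3 : 0 < ρ x := by
        by_contra! hle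
        nlinarith
      have r4 : ρ x ≤ 2 * (1 / ((n : ℝ) + 1)) := by
        rw [mul_one_div, le_div_iff₀ hn1]; linarith
      have r5 : ρ x ^ 2 ≤ c / 2 := (pow_le_pow_left₀ r3.le r4 2).trans (hn₀ n hn)
      have r6 := h.le x ((h.mem_iff x).2 r3)
      rw [mul_comm]
      exact mul_le_mul_of_nonneg_left (by linarith) (hE0 x)
  have hΨ : IsTest univ fun x => cut ρ n x ^ 4 := hH.toUniv.pow 3
  have hφ4 : IsTest univ fun x => φ x ^ 4 := hφ.pow 3
  have hV : ∀ k, IsTest univ fun x => pd k ρ x * φ x ^ 4 := fun k =>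
    hφ4.mul_left (h.test_pd k).contDiff
  have hibp : ∀ k, ∫ x, pd k (fun x => cut ρ n x ^ 4) x * (pd k ρ x * φ x ^ 4) =
      ∫ x, -(cut ρ n x ^ 4 * pd k (fun x => pd k ρ x * φ x ^ 4) x) := fun k => by
    rw [integral_neg, integral_mul_pd hΨ.contDiff (hV k) k, neg_neg]
  have i1 : ∀ k, Integrable (fun x => pd k (fun x => cut ρ n x ^ 4) x * (pd k ρ x * φ x ^ 4))
      volume := fun k =>
    integrable_mul_of_L2 (hΨ.memLp_pd k 2 volume) ((hV k).memLp 2 volume)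
  have i2 : ∀ k, Integrable (fun x => -(cut ρ n x ^ 4 * pd k (fun x => pd k ρ x * φ x ^ 4) x))
      volume := fun k =>
    (integrable_mul_of_L2 (hΨ.memLp 2 volume) ((hV k).memLp_pd k 2 volume)).neg
  have hTx : ∀ x, T x = cut ρ n x ^ 4 * |φ x| ^ 3 * G x := fun x => by
    simp only [hT, hχdef, abs_mul, abs_of_nonneg (hH0 x)]; ring
  have hEint : ∫ x, E x ≤ 2 / c * (4 * A * (N + 1)) * ∫ x, T x := by
    have s1 : ∫ x, c / 2 * E x ≤
        ∫ x, ∑ k, pd k (fun x => cut ρ n x ^ 4) x * (pd k ρ x * φ x ^ 4) := by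
      refine integral_mono (hEi.const_mul _) (integrable_finsetSum _ fun k _ => i1 k) fun x => ?_
      refine (hEq x).trans (le_of_eq ?_)
      rw [Finset.mul_sum]
      refine Finset.sum_congr rfl fun k _ => ?_
      rw [pd_pow hH.contDiff, h.pd_cut]; simp only [hE]; push_cast; ring
    have s2 : ∫ x, ∑ k, pd k (fun x => cut ρ n x ^ 4) x * (pd k ρ x * φ x ^ 4) =
        ∫ x, ∑ k, -(cut ρ n x ^ 4 * pd k (fun x => pd k ρ x * φ x ^ 4) x) := by
      rw [integral_finsetSum _ fun k _ => i1 k, integral_finsetSum _ fun k _ => i2 k]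
      exact Finset.sum_congr rfl fun k _ => hibp k
    have s3 : ∫ x, ∑ k, -(cut ρ n x ^ 4 * pd k (fun x => pd k ρ x * φ x ^ 4) x) ≤
        ∫ x, 4 * A * (N + 1) * T x := by
      refine integral_mono (integrable_finsetSum _ fun k _ => i2 k) (hTi.const_mul _) fun x => ?_
      have t1 : ∀ k ∈ Finset.univ, -(cut ρ n x ^ 4 * pd k (fun x => pd k ρ x * φ x ^ 4) x) ≤
          cut ρ n x ^ 4 * |φ x| ^ 3 * (4 * A * |pd k φ x| + A * |φ x|) := fun k _ => by
        rw [pd_mul (h.test_pd k).contDiff hφ4.contDiff, pd_pow hφ.contDiff, ← mul_neg,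
          mul_assoc (cut ρ n x ^ 4)]
        refine mul_le_mul_of_nonneg_left ?_ (by positivity)
        refine (neg_le_abs _).trans ((abs_add_le _ _).trans ?_)
        rw [abs_mul, abs_mul, abs_mul, abs_mul, abs_pow, abs_pow]
        norm_num
        have u1 := mul_le_mul_of_nonneg_right (hA1 k x)
          (by positivity : 0 ≤ 4 * |φ x| ^ 3 * |pd k φ x|)
        have u2 := mul_le_mul_of_nonneg_right (hA2 k x) (pow_nonneg (abs_nonneg (φ x)) 4)
        have u3 : |φ x| ^ 3 * (4 * A * |pd k φ x| + A * |φ x|)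
          = A * (4 * |φ x| ^ 3 * |pd k φ x|) + A * |φ x| ^ 4 := by ring
        have u4 : φ x ^ 4 = |φ x| ^ 4 := by rw [← abs_pow, abs_of_nonneg (by positivity)]
        rw [u3]
        linarith
      refine (Finset.sum_le_sum t1).trans ?_
      rw [← Finset.mul_sum, Finset.sum_add_distrib, ← Finset.mul_sum, hTx]
      simp only [Finset.sum_const, Finset.card_univ, Fintype.card_fin, nsmul_eq_mul]
      rw [show 4 * A * ((N : ℝ) + 1) * (cut ρ n x ^ 4 * |φ x| ^ 3 * G x)
        = cut ρ n x ^ 4 * |φ x| ^ 3 * (4 * A * (N + 1) * G x) by ring]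
      refine mul_le_mul_of_nonneg_left ?_ (by positivity)
      simp only [hG]
      have v1 : 0 ≤ ∑ k, |pd k φ x| := by positivity
      have v2 : 0 ≤ A * N * ∑ k, |pd k φ x| := by positivity
      have v3 : 0 ≤ A * N * |φ x| := by positivity
      have v4 : 0 ≤ A * |φ x| := by positivity
      linarith
    rw [s2] at s1
    have s4 := s1.trans s3
    rw [integral_const_mul, integral_const_mul] at s4
    rw [show 2 / c * (4 * A * ((N : ℝ) + 1)) * ∫ x, T x
      = (4 * A * ((N : ℝ) + 1) * ∫ x, T x) / (c / 2) by field_simp, le_div_iff₀ (by positivity)]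
    linarith
  have hψ : IsTest univ fun x => χ x ^ 4 := hχ.pow 3
  have hS := hC _ hψ
  have hIi : Integrable (fun x => ∑ k, |pd k (fun x => χ x ^ 4) x| + |χ x ^ 4|) volume := by
    refine (integrable_finsetSum _ fun k _ => ?_).add ?_
    · exact (memLp_one_iff_integrable.1 (hψ.memLp_pd k 1 volume)).abs
    · exact (memLp_one_iff_integrable.1 (hψ.memLp 1 volume)).abs
  have hI : ∫ x, (∑ k, |pd k (fun x => χ x ^ 4) x| + |χ x ^ 4|) ≤ C₁ * ∫ x, T x := by
    have s1 : ∫ x, (∑ k, |pd k (fun x => χ x ^ 4) x| + |χ x ^ 4|) ≤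
        ∫ x, (5 * T x + N * A * E x) := by
      refine integral_mono hIi ((hTi.const_mul _).add (hEi.const_mul _)) fun x => ?_
      have t1 : ∀ k ∈ Finset.univ, |pd k (fun x => χ x ^ 4) x| ≤
          4 * (cut ρ n x ^ 4 * |φ x| ^ 3 * |pd k φ x|) + A * E x := fun k _ => by
        rw [pd_pow hχ.contDiff, hχdef]
        simp only
        rw [pd_mul hH.contDiff hφ.contDiff, h.pd_cut, abs_mul, abs_mul, abs_pow, abs_mul,
          abs_of_nonneg (hH0 x)]
        norm_num
        have w1 : |cut ρ n x * pd k φ x + cutD ρ n x * pd k ρ x * φ x| ≤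
            cut ρ n x * |pd k φ x| + cutD ρ n x * A * |φ x| := by
          refine (abs_add_le _ _).trans ?_
          rw [abs_mul, abs_mul, abs_mul, abs_of_nonneg (hH0 x), abs_of_nonneg (cutD_nonneg ρ n x)]
          have := cutD_nonneg ρ n x
          gcongr
          exact hA1 k x
        have w2 : 0 ≤ 4 * (cut ρ n x * |φ x|) ^ 3 := by have := hH0 x; positivity
        refine (mul_le_mul_of_nonneg_left w1 w2).trans (le_of_eq ?_)
        have u4 : φ x ^ 4 = |φ x| ^ 4 := by rw [← abs_pow, abs_of_nonneg (by positivity)]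
        simp only [hE, u4]; ring
      have t2 := Finset.sum_le_sum t1
      simp only [Finset.sum_add_distrib, ← Finset.mul_sum, Finset.sum_const, Finset.card_univ,
        Fintype.card_fin, nsmul_eq_mul] at t2
      have t3 : |χ x ^ 4| = cut ρ n x ^ 4 * |φ x| ^ 3 * |φ x| := by
        rw [abs_pow, hχdef, abs_mul, abs_of_nonneg (hH0 x)]; ring
      rw [hTx, t3]
      simp only [hG]
      have v1 : 0 ≤ cut ρ n x ^ 4 * |φ x| ^ 3 * |φ x| := by positivity
      have v2 : 0 ≤ cut ρ n x ^ 4 * |φ x| ^ 3 * ∑ k, |pd k φ x| := by positivity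
      rw [mul_add (cut ρ n x ^ 4 * |φ x| ^ 3)]
      linarith
    rw [integral_add (hTi.const_mul _) (hEi.const_mul _), integral_const_mul,
      integral_const_mul] at s1
    have s2 := mul_le_mul_of_nonneg_left hEint (by positivity : 0 ≤ N * A)
    rw [hC₁]
    linarith
  have hZ : ∫ x, |χ x ^ 4| ^ (3 / 2 : ℝ) = ∫ x, χ x ^ 6 := by
    congr 1; ext x
    rw [abs_pow, ← Real.rpow_natCast, ← Real.rpow_mul (abs_nonneg _),
      show ((4 : ℕ) : ℝ) * (3 / 2) = ((6 : ℕ) : ℝ) by norm_num, Real.rpow_natCast, ← abs_pow,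
      abs_of_nonneg (by positivity)]
  rw [hZ] at hS
  set Z := ∫ x, χ x ^ 6 with hZdef
  set D := ∫ x, (cut ρ n x * G x) ^ 2 with hD
  have hZ0 : 0 ≤ Z := integral_nonneg fun x => by positivity
  have hD0 : 0 ≤ D := integral_nonneg fun x => by positivity
  have hI0 : 0 ≤ ∫ x, (∑ k, |pd k (fun x => χ x ^ 4) x| + |χ x ^ 4|) :=
    integral_nonneg fun x => by positivity
  have hT0 : 0 ≤ ∫ x, T x := integral_nonneg fun x => by
    rw [hTx]; have := hG0 x; positivity
  have hCS : (∫ x, T x) ^ 2 ≤ Z * D := by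
    have m1 : MemLp (fun x => |χ x| ^ 3) 2 volume :=
      (hχ.contDiff.continuous.abs.pow 3).memLp_of_hasCompactSupport
        (HasCompactSupport.intro hχ.compact fun x hx => by
          simp [image_eq_zero_of_notMem_tsupport hx])
    have m2 : MemLp (fun x => cut ρ n x * G x) 2 volume :=
      (hH.contDiff.continuous.mul hGc).memLp_of_hasCompactSupport hH.compact.mul_right
    refine (integral_mul_sq_le m1 m2).trans (le_of_eq ?_)
    congr 1
    congr 1; ext x
    rw [show (|χ x| ^ 3) ^ 2 = (|χ x| ^ 2) ^ 3 by ring, sq_abs]; ring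
  -- `Z² ≤ C (C₁ ∫ T)³` and `(∫ T)² ≤ Z D` give `Z⁴ ≤ C² C₁⁶ Z³ D³`
  rcases hZ0.eq_or_lt with hz | hz
  · rw [← hz]; exact mul_nonneg (by positivity) (pow_nonneg hD0 3)
  have f1 : Z ^ 2 ≤ C * (C₁ * ∫ x, T x) ^ 3 :=
    hS.trans (mul_le_mul_of_nonneg_left (pow_le_pow_left₀ hI0 hI 3) hC0)
  have f2 : Z ^ 4 ≤ (C * (C₁ * ∫ x, T x) ^ 3) ^ 2 := by
    have := pow_le_pow_left₀ (by positivity) f1 2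
    rwa [← pow_mul] at this
  have f3 : (C * (C₁ * ∫ x, T x) ^ 3) ^ 2 ≤ C ^ 2 * C₁ ^ 6 * (Z * D) ^ 3 := by
    have := pow_le_pow_left₀ (sq_nonneg _) hCS 3
    rw [show (C * (C₁ * ∫ x, T x) ^ 3) ^ 2 = C ^ 2 * C₁ ^ 6 * ((∫ x, T x) ^ 2) ^ 3 by ring]
    exact mul_le_mul_of_nonneg_left this (by positivity)
  have f4 : Z ^ 3 * Z ≤ Z ^ 3 * (C ^ 2 * C₁ ^ 6 * D ^ 3) := by
    have := f2.trans f3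
    rw [mul_pow] at this
    linarith
  exact le_of_mul_le_mul_left f4 (by positivity)

lemma eLpNorm_six_le {α : Type*} [MeasurableSpace α] {μ : Measure α} {f : α → ℝ}
    (hf : MemLp f 6 μ) {M : ℝ} (hM : ∫ x, f x ^ 6 ∂μ ≤ M) :
    eLpNorm f 6 μ ≤ ENNReal.ofReal (M ^ (1 / 6 : ℝ)) := by
  rw [hf.eLpNorm_eq_integral_rpow_norm (by simp) (by simp)]
  have e : ∀ x, ‖f x‖ ^ (ENNReal.toReal 6) = f x ^ 6 := fun x => by
    rw [show ENNReal.toReal 6 = ((6 : ℕ) : ℝ) by norm_num, Real.rpow_natCast, Real.norm_eq_abs,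
      ← abs_pow, abs_of_nonneg (by positivity)]
  simp only [e]
  refine ENNReal.ofReal_le_ofReal ?_
  rw [show (ENNReal.toReal 6)⁻¹ = (1 / 6 : ℝ) by norm_num]
  exact Real.rpow_le_rpow (integral_nonneg fun x => by positivity) hM (by norm_num)

/-- The Sobolev embedding `W^{1,2}(Ω) ⊂ L^6(Ω)` in dimension at most three. No trace condition is
imposed: the function is approximated on the support of a cut-off only, and the bound does not
depend on the cut-off. -/
lemma IsDefining.memLp_six (hN : N ≤ 3) {Ω : Opens (RN N)} {ρ : RN N → ℝ} {c : ℝ}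
    (h : IsDefining Ω ρ c) {f : RN N → ℝ} {g : Fin N → RN N → ℝ} (hf : IsH1 Ω Ω f g) :
    MemLp f 6 (vol Ω) := by
  obtain ⟨K, hK0, n₀, hK⟩ := h.exists_integral_cut_pow_six_le hN
  set D : ℝ := (N + 1) * (∫ x, f x ^ 2 ∂(vol Ω) + ∑ k, ∫ x, g k x ^ 2 ∂(vol Ω)) + 1 with hD
  have key : ∀ n ≥ n₀, MemLp (fun x => cut ρ n x * f x) 6 (vol Ω) ∧
      eLpNorm (fun x => cut ρ n x * f x) 6 (vol Ω) ≤
          ENNReal.ofReal ((K * D ^ 3) ^ (1 / 6 : ℝ)) := by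
    intro n hn
    -- a larger cut-off, equal to one on the support of the given one
    have hone : ∀ x, cut ρ n x ≠ 0 → cut ρ (2 * n + 1) x = 1 ∧ cutD ρ (2 * n + 1) x = 0 := by
      intro x hx
      have h1 : 0 < (n + 1) * ρ x - 1 := by
        by_contra! hle
        exact hx (Real.smoothTransition.zero_of_nonpos hle)
      have h2 : 1 < ((2 * n + 1 : ℕ) + 1) * ρ x - 1 := by push_cast; linarith
      exact ⟨Real.smoothTransition.one_of_one_le h2.le, by
        rw [cutD, deriv_smoothTransition_of_one_lt h2, mul_zero]⟩
    have hH := h.test_cut n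
    have hH' := h.test_cut (2 * n + 1)
    obtain ⟨φ, -, ht, -, h1, h2, -, h3⟩ := (hf.mul_cutoff hH').exists_approx hH'.compact
      (fun x _ hx => by simp [image_eq_zero_of_notMem_tsupport hx])
    have e1 : (fun x => cut ρ n x * (cut ρ (2 * n + 1) x * f x)) = fun x => cut ρ n x * f x := by
      ext x
      by_cases hx : cut ρ n x = 0
      · simp [hx]
      · rw [(hone x hx).1, one_mul]
    have e2 : ∀ k, (fun x => cut ρ n x * (cut ρ (2 * n + 1) x * g k x
        + pd k (cut ρ (2 * n + 1)) x * f x)) = fun x => cut ρ n x * g k x := fun k => by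
      ext x
      by_cases hx : cut ρ n x = 0
      · simp [hx]
      · rw [h.pd_cut, (hone x hx).1, (hone x hx).2]; ring
    have l1 := tendsto_eLpNorm_mul (abs_cut_le ρ n) h1
    rw [e1] at l1
    have l2 := fun k => tendsto_eLpNorm_mul (abs_cut_le ρ n) (h2 k)
    simp only [e2] at l2
    have m1 := fun j => hH.memLp_mul ((ht j).memLp 2 (vol Ω))
    have m2 := fun k j => hH.memLp_mul ((ht j).memLp_pd k 2 (vol Ω))
    have m3 := hH.memLp_mul hf.memLp
    have m4 := fun k => hH.memLp_mul (hf.memLp_grad k)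
    have t1 := tendsto_integral_mul m3 m3 m1 m1 l1 l1
    have t2 := fun k => tendsto_integral_mul (m4 k) (m4 k) (m2 k) (m2 k) (l2 k) (l2 k)
    have t3 := (t1.add (tendsto_finsetSum Finset.univ fun k _ => t2 k)).const_mul ((N : ℝ) + 1)
    simp only [← sq] at t3
    have hcut : ∀ {a : RN N → ℝ}, MemLp a 2 (vol Ω) →
        ∫ x, (cut ρ n x * a x) ^ 2 ∂(vol Ω) ≤ ∫ x, a x ^ 2 ∂(vol Ω) := fun {a} ha => by
      refine integral_mono (hH.memLp_mul ha).integrable_sq ha.integrable_sq fun x => ?_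
      simp only
      rw [mul_pow]
      refine mul_le_of_le_one_left (sq_nonneg _) ?_
      exact pow_le_one₀ (cut_nonneg ρ n x) (cut_le_one ρ n x)
    have hlt : ((N : ℝ) + 1) * (∫ x, (cut ρ n x * f x) ^ 2 ∂(vol Ω)
        + ∑ k, ∫ x, (cut ρ n x * g k x) ^ 2 ∂(vol Ω)) < D := by
      have q1 := hcut hf.memLp
      have q2 := Finset.sum_le_sum fun k (_ : k ∈ Finset.univ) => hcut (hf.memLp_grad k)
      have := mul_le_mul_of_nonneg_left (add_le_add q1 q2) (by positivity : (0 : ℝ) ≤ N + 1)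
      rw [hD]; linarith
    obtain ⟨j₀, hj₀⟩ := eventually_atTop.1 (t3.eventually (gt_mem_nhds hlt))
    have hbound : ∀ j ≥ j₀, ∫ x, (cut ρ n x * φ j x) ^ 6 ∂(vol Ω) ≤ K * D ^ 3 := by
      intro j hj
      have s1 := hK n hn _ (ht j)
      have s2 : ∫ x, (cut ρ n x * (|φ j x| + ∑ k, |pd k (φ j) x|)) ^ 2 ≤ D := by
        refine le_trans ?_ (hj₀ j hj).le
        have z : ∀ x ∉ (Ω : Set (RN N)), cut ρ n x = 0 := fun x hx =>
          image_eq_zero_of_notMem_tsupport fun hc => hx (hH.subset hc)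
        rw [← setIntegral_eq_integral_of_forall_compl_eq_zero (s := (Ω : Set (RN N)))
          (fun x hx => by rw [z x hx]; ring), ← integral_finsetSum _ fun k _ =>
              (m2 k j).integrable_sq,
          ← integral_add (m1 j).integrable_sq (integrable_finsetSum _ fun k _ =>
              (m2 k j).integrable_sq),
          ← integral_const_mul]
        refine integral_mono_of_nonneg (ae_of_all _ fun x => by positivity)
          (((m1 j).integrable_sq.add (integrable_finsetSum _ fun k _ =>
            (m2 k j).integrable_sq)).const_mul _) (ae_of_all _ fun x => ?_)
        simp only [mul_pow, ← Finset.mul_sum, ← mul_add]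
        rw [mul_left_comm]
        refine mul_le_mul_of_nonneg_left ?_ (sq_nonneg _)
        have cs := sq_sum_le_card_mul_sum_sq (s := (Finset.univ : Finset (Option (Fin N))))
          (f := fun o => o.elim |φ j x| fun k => |pd k (φ j) x|)
        simpa [Fintype.sum_option] using cs
      have s3 : ∫ x, (cut ρ n x * φ j x) ^ 6 ∂(vol Ω) ≤ ∫ x, (cut ρ n x * φ j x) ^ 6 := by
        refine setIntegral_le_integral ?_ (ae_of_all _ fun x => by positivity)
        exact memLp_one_iff_integrable.1 (((hH.mul_right (ht j).contDiff).pow 5).memLp 1 volume)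
      refine s3.trans (s1.trans (mul_le_mul_of_nonneg_left ?_ hK0))
      exact pow_le_pow_left₀ (integral_nonneg fun x => by positivity) s2 3
    have hlim : ∀ᵐ x ∂(vol Ω), Tendsto (fun j => cut ρ n x * φ (j + j₀) x) atTop
        (𝓝 (cut ρ n x * f x)) := by
      filter_upwards [h3] with x hx
      have := (tendsto_add_atTop_iff_nat j₀).2 (hx.const_mul (cut ρ n x))
      rwa [congrFun e1 x] at this
    refine memLp_of_tendsto_ae (fun j => ?_) (fun j => ?_) ENNReal.ofReal_ne_top hlim
    · exact (hH.contDiff.continuous.mul (ht _).contDiff.continuous).aestronglyMeasurable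
    · exact eLpNorm_six_le ((hH.mul_right (ht _).contDiff).memLp 6 _) (hbound _ (by omega))
  refine (memLp_of_tendsto_ae (F := fun n x => cut ρ (n + n₀) x * f x) (fun n =>
      (key _ (by omega)).1.1)
    (fun n => (key _ (by omega)).2) ENNReal.ofReal_ne_top ?_).1
  filter_upwards [ae_restrict_mem Ω.isOpen.measurableSet] with x hx
  refine (tendsto_add_atTop_iff_nat (f := fun n =>
      cut ρ n x * f x) n₀).2 (tendsto_const_nhds.congr' ?_)
  filter_upwards [h.eventually_cut_eq_one hx] with n hn
  rw [hn.1, one_mul]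

/-! ### Poincaré's inequality and Rellich's theorem -/

/-- Young's inequality in the form used for Poincaré's inequality. -/
lemma neg_mul_pow_le (m : ℕ) {R t a b : ℝ} (ht : |t| ≤ R) :
    -(t * (((2 * (m + 1) : ℕ) : ℝ) * a ^ (2 * m + 1) * b)) ≤ 1 / 2 * a ^ (2 * (m + 1)) +
      2 ^ (2 * m + 1) * (2 * (m + 1) * R) ^ (2 * (m + 1)) * b ^ (2 * (m + 1)) := by
  have hR : 0 ≤ R := (abs_nonneg t).trans ht
  obtain ⟨B, hB⟩ : ∃ B, B = 2 * ((m : ℝ) + 1) * R * |b| := ⟨_, rfl⟩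
  have hB0 : 0 ≤ B := by rw [hB]; positivity
  have s1 : -(t * (((2 * (m + 1) : ℕ) : ℝ) * a ^ (2 * m + 1) * b)) ≤ |a| ^ (2 * m + 1) * B := by
    refine (neg_le_abs _).trans ?_
    rw [abs_mul, abs_mul, abs_mul, abs_pow, Nat.abs_cast]
    push_cast
    have := mul_le_mul_of_nonneg_right ht
      (by positivity : 0 ≤ 2 * ((m : ℝ) + 1) * |a| ^ (2 * m + 1) * |b|)
    rw [hB]; linarith
  have e1 : a ^ (2 * (m + 1)) = |a| ^ (2 * m + 1) * |a| := by
    rw [← pow_succ, show 2 * m + 1 + 1 = 2 * (m + 1) by ring, (even_two_mul _).pow_abs]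
  have e2 : 2 ^ (2 * m + 1) * (2 * (m + 1) * R) ^ (2 * (m + 1)) * b ^ (2 * (m + 1)) =
      (2 * B) ^ (2 * m + 1) * B := by
    rw [← (even_two_mul _).pow_abs b, mul_assoc, ← mul_pow, ← hB, mul_pow 2 B, mul_assoc,
      ← pow_succ]
    rfl
  rw [e1, e2]
  refine s1.trans ?_
  have ha : 0 ≤ |a| := abs_nonneg a
  rcases le_or_gt (2 * B) |a| with hab | hab
  · have : |a| ^ (2 * m + 1) * B ≤ |a| ^ (2 * m + 1) * (|a| / 2) := by gcongr; linarith
    have p2 : 0 ≤ (2 * B) ^ (2 * m + 1) * B := by positivity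
    linarith
  · have : |a| ^ (2 * m + 1) * B ≤ (2 * B) ^ (2 * m + 1) * B := by gcongr
    have p2 : 0 ≤ |a| ^ (2 * m + 1) * |a| := by positivity
    linarith

/-- Poincaré's inequality for test functions and even exponents, from
`∫ φ^p = -∫ x_i ∂_i(φ^p)`. -/
lemma poincare_test {R : ℝ} (i : Fin N) (m : ℕ) {φ : RN N → ℝ}
    (hφ : IsTest (closedBall 0 R) φ) :
    ∫ x, φ x ^ (2 * (m + 1)) ≤ 2 * (2 ^ (2 * m + 1) * (2 * (m + 1) * R) ^ (2 * (m + 1))) *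
      ∫ x, pd i φ x ^ (2 * (m + 1)) := by
  have hξc : ContDiff ℝ 1 fun x : RN N => x i :=
    (EuclideanSpace.proj i : RN N →L[ℝ] ℝ).contDiff
  have hξd : ∀ x, pd i (fun x : RN N => x i) x = 1 := fun x => by
    have : fderiv ℝ (fun x : RN N => x i) x = EuclideanSpace.proj i :=
      (EuclideanSpace.proj i : RN N →L[ℝ] ℝ).fderiv
    rw [pd, this]; simp
  have hψ : IsTest univ fun x => φ x ^ (2 * (m + 1)) := hφ.toUniv.pow (2 * m + 1)
  have h1 := integral_mul_pd hξc hψ i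
  simp only [hξd, one_mul] at h1
  have hi : Integrable (fun x => pd i φ x ^ (2 * (m + 1))) volume :=
    ((hφ.continuous_pd i).pow _).integrable_of_hasCompactSupport
      ((hasCompactSupport_pd hφ.compact i).comp_left (g := fun y => y ^ (2 * (m + 1))) (by simp))
  have hi' : Integrable (fun x => φ x ^ (2 * (m + 1))) volume :=
    memLp_one_iff_integrable.1 (hψ.memLp 1 volume)
  generalize hK : (2 : ℝ) ^ (2 * m + 1) * (2 * (m + 1) * R) ^ (2 * (m + 1)) = K
  have h2 : ∫ x, φ x ^ (2 * (m + 1)) ≤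
      ∫ x, (1 / 2 * φ x ^ (2 * (m + 1)) + K * pd i φ x ^ (2 * (m + 1))) := by
    rw [← neg_eq_iff_eq_neg.2 h1, ← integral_neg]
    refine integral_mono ?_ ((hi'.const_mul _).add (hi.const_mul _)) fun x => ?_
    · exact ((hξc.continuous.mul (hψ.continuous_pd i)).integrable_of_hasCompactSupport
        (hasCompactSupport_pd hψ.compact i).mul_left).neg
    · simp only
      rw [pd_pow hφ.contDiff]
      by_cases hx : x ∈ tsupport φ
      · have hxR : |x i| ≤ R := by
          have := hφ.subset hx
          rw [mem_closedBall_zero_iff] at this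
          exact (PiLp.norm_apply_le x i).trans this
        rw [← hK]
        exact neg_mul_pow_le m hxR
      · have : pd i φ x = 0 :=
          image_eq_zero_of_notMem_tsupport fun h => hx (tsupport_pd_subset φ i h)
        rw [this, image_eq_zero_of_notMem_tsupport hx]
        simp
  rw [integral_add (hi'.const_mul _) (hi.const_mul _), integral_const_mul, integral_const_mul] at h2
  linarith

lemma eLpNorm_even_eq {α : Type*} [MeasurableSpace α] {μ : Measure α} {f : α → ℝ} (m : ℕ)
    (hf : MemLp f ((2 * (m + 1) : ℕ) : ℝ≥0∞) μ) :
    eLpNorm f ((2 * (m + 1) : ℕ) : ℝ≥0∞) μ =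
      ENNReal.ofReal ((∫ x, f x ^ (2 * (m + 1)) ∂μ) ^ ((2 * (m + 1) : ℕ) : ℝ)⁻¹) := by
  rw [hf.eLpNorm_eq_integral_rpow_norm (by simp) (ENNReal.natCast_ne_top _)]
  have e : ∀ x, ‖f x‖ ^ (ENNReal.toReal ((2 * (m + 1) : ℕ) : ℝ≥0∞)) = f x ^ (2 * (m + 1)) :=
    fun x => by
      rw [ENNReal.toReal_natCast, Real.rpow_natCast, Real.norm_eq_abs, pow_mul, pow_mul, sq_abs]
  simp only [e]
  rw [ENNReal.toReal_natCast]

/-- Poincaré's inequality in `L^p`, `p` even, for functions with zero trace. No integrability of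
`u` beyond `L²` is presupposed. -/
lemma IsH1.poincare {Ω : Opens (RN N)} (hbdd : Bornology.IsBounded (Ω : Set (RN N))) (i : Fin N)
    (m : ℕ) : ∃ C : ℝ≥0, ∀ (u : RN N → ℝ) (g : Fin N → RN N → ℝ), IsH1 Ω univ u g →
      MemLp (g i) ((2 * (m + 1) : ℕ) : ℝ≥0∞) (vol Ω) →
      MemLp u ((2 * (m + 1) : ℕ) : ℝ≥0∞) (vol Ω) ∧ eLpNorm u ((2 * (m + 1) : ℕ) : ℝ≥0∞) (vol Ω)
        ≤ C * eLpNorm (g i) ((2 * (m + 1) : ℕ) : ℝ≥0∞) (vol Ω) := by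
  obtain ⟨R, hR⟩ := (hbdd.isCompact_closure.cthickening (r := 1)).isBounded.subset_closedBall 0
  have hR' : cthickening 1 (closure (Ω : Set (RN N))) ⊆ closedBall 0 (max R 0) :=
    hR.trans (closedBall_subset_closedBall (le_max_left _ _))
  set p : ℝ≥0∞ := ((2 * (m + 1) : ℕ) : ℝ≥0∞) with hp
  set K : ℝ := 2 * (2 ^ (2 * m + 1) * (2 * (m + 1) * max R 0) ^ (2 * (m + 1))) with hK
  have hK0 : 0 ≤ K := by have := le_max_right R 0; positivity
  refine ⟨(K ^ ((2 * (m + 1) : ℕ) : ℝ)⁻¹).toNNReal, fun u g h hg => ?_⟩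
  obtain ⟨φ, -, ht, hs, -, -, h3, h4⟩ := h.exists_approx hbdd.isCompact_closure
    (fun x hx hx' => absurd (subset_closure hx) hx')
  have hbound : ∀ n, eLpNorm (φ n) p (vol Ω) ≤
      (K ^ ((2 * (m + 1) : ℕ) : ℝ)⁻¹).toNNReal * eLpNorm (g i) p (vol Ω) := fun n => by
    have hn : (1 : ℝ) / ((n : ℝ) + 1) ≤ 1 := by
      rw [div_le_one (by positivity)]; linarith [(n.cast_nonneg : (0 : ℝ) ≤ n)]
    have hφ : IsTest (closedBall 0 (max R 0)) (φ n) :=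
      ⟨(ht n).contDiff, (ht n).compact, (hs n).trans ((cthickening_mono hn _).trans hR')⟩
    have h5 := poincare_test i m hφ
    calc eLpNorm (φ n) p (vol Ω) ≤ eLpNorm (φ n) p volume :=
          eLpNorm_mono_measure _ Measure.restrict_le_self
      _ ≤ (K ^ ((2 * (m + 1) : ℕ) : ℝ)⁻¹).toNNReal * eLpNorm (pd i (φ n)) p volume := by
          rw [eLpNorm_even_eq m ((ht n).memLp _ _), eLpNorm_even_eq m ((ht n).memLp_pd i _ _),
            ← ENNReal.ofReal, ← ENNReal.ofReal_mul (by positivity)]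
          refine ENNReal.ofReal_le_ofReal ?_
          rw [← Real.mul_rpow hK0 (integral_nonneg fun x => (even_two_mul _).pow_nonneg _)]
          exact Real.rpow_le_rpow (integral_nonneg fun x => (even_two_mul _).pow_nonneg _) h5
            (by positivity)
      _ ≤ _ := by
          gcongr
          refine h3 i p ?_ (ENNReal.natCast_ne_top _) n
          rw [hp]; exact_mod_cast (by omega : 1 ≤ 2 * (m + 1))
  exact memLp_of_tendsto_ae (fun n => (ht n).contDiff.continuous.aestronglyMeasurable) hbound
    (ENNReal.mul_ne_top ENNReal.coe_ne_top hg.2.ne) h4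

/-- The `L²` modulus of continuity of a test function is controlled by its gradient: integrate
the derivative along the segment from `x` to `x - t` and use Jensen's inequality. -/
lemma lintegral_translate_sub_le {φ : RN N → ℝ} (hφ : IsTest univ φ) (t : RN N) :
    ∫⁻ x, ‖φ (x - t) - φ x‖ₑ ^ (2 : ℝ) ≤ ‖t‖ₑ ^ (2 : ℝ) * ∫⁻ x, ‖fderiv ℝ φ x‖ₑ ^ (2 : ℝ) := by
  have hfc : Continuous (fderiv ℝ φ) := hφ.contDiff.continuous_fderiv one_ne_zero
  let ν : Measure ℝ := volume.restrict (Icc 0 1)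
  have : IsProbabilityMeasure ν := ⟨by simp [ν]⟩
  have h1 : ∀ x, ‖φ (x - t) - φ x‖ₑ ^ (2 : ℝ) ≤
      ‖t‖ₑ ^ (2 : ℝ) * ∫⁻ s, ‖fderiv ℝ φ (x - s • t)‖ₑ ^ (2 : ℝ) ∂ν := fun x => by
    have hd : ∀ s : ℝ, HasDerivAt (fun s : ℝ => φ (x - s • t)) (fderiv ℝ φ (x - s • t) (-t)) s := by
      intro s
      have h2 : HasDerivAt (fun s : ℝ => x - s • t) (-t) s := by
        simpa using ((hasDerivAt_id s).smul_const t).const_sub x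
      exact (hφ.contDiff.differentiable one_ne_zero _).hasFDerivAt.comp_hasDerivAt s h2
    have hcont : Continuous fun s : ℝ => fderiv ℝ φ (x - s • t) (-t) := by fun_prop
    have h3 := intervalIntegral.integral_eq_sub_of_hasDerivAt (fun s _ => hd s)
      (hcont.intervalIntegrable 0 1)
    simp only [one_smul, zero_smul, sub_zero] at h3
    rw [← h3, intervalIntegral.integral_of_le zero_le_one, ← integral_Icc_eq_integral_Ioc]
    have h4 : ‖∫ s in Icc (0 : ℝ) 1, fderiv ℝ φ (x - s • t) (-t)‖ₑ ≤
        ‖t‖ₑ * ∫⁻ s, ‖fderiv ℝ φ (x - s • t)‖ₑ ∂ν := by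
      rw [← lintegral_const_mul _ (by fun_prop)]
      refine (enorm_integral_le_lintegral_enorm _).trans (lintegral_mono fun s => ?_)
      have := (fderiv ℝ φ (x - s • t)).le_opENorm (-t)
      rwa [enorm_neg, mul_comm] at this
    refine (ENNReal.rpow_le_rpow h4 (by norm_num)).trans ?_
    rw [ENNReal.mul_rpow_of_nonneg _ _ (by norm_num)]
    gcongr
    exact rpow_lintegral_le (by fun_prop) (by norm_num)
  calc ∫⁻ x, ‖φ (x - t) - φ x‖ₑ ^ (2 : ℝ)
      ≤ ∫⁻ x, ‖t‖ₑ ^ (2 : ℝ) * ∫⁻ s, ‖fderiv ℝ φ (x - s • t)‖ₑ ^ (2 : ℝ) ∂ν := lintegral_mono h1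
    _ = ‖t‖ₑ ^ (2 : ℝ) * ∫⁻ s, (∫⁻ x, ‖fderiv ℝ φ (x - s • t)‖ₑ ^ (2 : ℝ)) ∂ν := by
        rw [lintegral_const_mul' _ _ (by finiteness), lintegral_lintegral_swap]
        exact Continuous.aemeasurable (by fun_prop)
    _ = ‖t‖ₑ ^ (2 : ℝ) * ∫⁻ _, (∫⁻ x, ‖fderiv ℝ φ x‖ₑ ^ (2 : ℝ)) ∂ν := by
        congr 1
        exact lintegral_congr fun s =>
          lintegral_sub_right_eq_self (fun x => ‖fderiv ℝ φ x‖ₑ ^ (2 : ℝ)) (s • t)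
    _ = _ := by simp

/-- The mollification error of a test function is controlled by its gradient. -/
lemma lintegral_mollify_sub_le (k : ℕ) {φ : RN N → ℝ} (hφ : IsTest univ φ) :
    ∫⁻ x, ‖mollify k φ x - φ x‖ₑ ^ (2 : ℝ) ≤
      ENNReal.ofReal (1 / ((k : ℝ) + 1)) ^ (2 : ℝ) * ∫⁻ x, ‖fderiv ℝ φ x‖ₑ ^ (2 : ℝ) := by
  set w : RN N → ℝ≥0∞ := fun t => ENNReal.ofReal ((bump N k).normed volume t) with hw
  have hwm : Measurable w := ((bump N k).continuous_normed.measurable).ennreal_ofReal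
  have hφc := hφ.contDiff.continuous
  let ν : Measure (RN N) := volume.withDensity w
  have : IsProbabilityMeasure ν := ⟨by
    rw [withDensity_apply _ MeasurableSet.univ, Measure.restrict_univ]; exact lintegral_bump k⟩
  have h1 : ∀ x, ‖mollify k φ x - φ x‖ₑ ≤ ∫⁻ t, ‖φ (x - t) - φ x‖ₑ ∂ν := fun x => by
    have e : mollify k φ x - φ x = ∫ t, (bump N k).normed volume t * (φ (x - t) - φ x) := by
      simp only [mul_sub]
      rw [integral_sub, integral_mul_const, (bump N k).integral_normed, one_mul, mollify_apply]
      · exact ((bump N k).continuous_normed.mul (by fun_prop)).integrable_of_hasCompactSupport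
          (bump N k).hasCompactSupport_normed.mul_right
      · exact (bump N k).integrable_normed.mul_const _
    rw [e]
    refine (enorm_integral_le_lintegral_enorm _).trans_eq ?_
    rw [lintegral_withDensity_eq_lintegral_mul _ hwm (Continuous.measurable (by fun_prop))]
    refine lintegral_congr fun t => ?_
    rw [enorm_mul, Real.enorm_of_nonneg ((bump N k).nonneg_normed t)]; rfl
  calc ∫⁻ x, ‖mollify k φ x - φ x‖ₑ ^ (2 : ℝ)
      ≤ ∫⁻ x, ∫⁻ t, ‖φ (x - t) - φ x‖ₑ ^ (2 : ℝ) ∂ν := by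
        refine lintegral_mono fun x => ?_
        exact (ENNReal.rpow_le_rpow (h1 x) (by norm_num)).trans
          (rpow_lintegral_le (Continuous.aemeasurable (by fun_prop)) (by norm_num))
    _ = ∫⁻ t, (∫⁻ x, ‖φ (x - t) - φ x‖ₑ ^ (2 : ℝ)) ∂ν := by
        rw [lintegral_lintegral_swap]
        exact Continuous.aemeasurable (by fun_prop)
    _ = ∫⁻ t, w t * ∫⁻ x, ‖φ (x - t) - φ x‖ₑ ^ (2 : ℝ) := by
        rw [lintegral_withDensity_eq_lintegral_mul _ hwm]
        · rfl
        · refine Measurable.lintegral_prod_right' (f := fun p : RN N × RN N =>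
            ‖φ (p.2 - p.1) - φ p.2‖ₑ ^ (2 : ℝ)) (Continuous.measurable (by fun_prop))
    _ ≤ ∫⁻ t, w t * (ENNReal.ofReal (1 / ((k : ℝ) + 1)) ^ (2 : ℝ) *
          ∫⁻ x, ‖fderiv ℝ φ x‖ₑ ^ (2 : ℝ)) := by
        refine lintegral_mono fun t => ?_
        by_cases ht : (bump N k).normed volume t = 0
        · simp [hw, ht]
        · have ht' : t ∈ ball (0 : RN N) (bump N k).rOut := by
            rw [← (bump N k).support_normed_eq (μ := volume)]; exact ht
          refine mul_le_mul_right ?_ _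
          refine (lintegral_translate_sub_le hφ t).trans ?_
          gcongr
          rw [← ofReal_norm]
          exact ENNReal.ofReal_le_ofReal (mem_ball_zero_iff.1 ht').le
    _ = _ := by
        rw [lintegral_mul_const _ hwm, lintegral_bump, one_mul]

lemma eLpNorm_mollify_sub_le_of_isTest (k : ℕ) {φ : RN N → ℝ} (hφ : IsTest univ φ) :
    eLpNorm (mollify k φ - φ) 2 volume ≤
      ENNReal.ofReal (1 / ((k : ℝ) + 1)) * ∑ i, eLpNorm (pd i φ) 2 volume := by
  have h1 := ENNReal.rpow_le_rpow (lintegral_mollify_sub_le k hφ)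
    (by norm_num : (0 : ℝ) ≤ 1 / 2)
  rw [ENNReal.mul_rpow_of_nonneg _ _ (by norm_num), ← ENNReal.rpow_mul] at h1
  norm_num at h1
  have h2 : eLpNorm (fderiv ℝ φ) 2 volume ≤ ∑ i, eLpNorm (pd i φ) 2 volume := by
    have : eLpNorm (fderiv ℝ φ) 2 volume ≤ eLpNorm (∑ i, fun x => ‖pd i φ x‖) 2 volume :=
      eLpNorm_mono_real fun x => by
        rw [Finset.sum_apply]
        exact norm_le_sum_abs _
    refine this.trans ((eLpNorm_sum_le (fun i _ => (hφ.continuous_pd i).norm.aestronglyMeasurable)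
      one_le_two).trans_eq ?_)
    exact Finset.sum_congr rfl fun i _ => eLpNorm_norm _
  rw [eLpNorm_eq_lintegral_rpow_enorm_toReal (by simp) (by simp)]
  rw [eLpNorm_eq_lintegral_rpow_enorm_toReal (by simp) (by simp)] at h2
  simp only [ENNReal.toReal_ofNat, Pi.sub_apply] at h2 ⊢
  refine (le_of_eq_of_le ?_ h1).trans ?_
  · norm_num
  · norm_num at h2 ⊢
    gcongr

lemma vol_top : vol (⊤ : Opens (RN N)) = volume := by
  rw [vol, Opens.coe_top, Measure.restrict_univ]

/-- The extension by zero of a function with zero trace lies in `W^{1,2}(ℝ^N)`. -/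
lemma IsH1.extend {Ω : Opens (RN N)} {f : RN N → ℝ} {g : Fin N → RN N → ℝ}
    (h : IsH1 Ω univ f g) :
    IsH1 ⊤ univ ((Ω : Set (RN N)).indicator f) fun i => (Ω : Set (RN N)).indicator (g i) := by
  have mΩ : MeasurableSet (Ω : Set (RN N)) := Ω.isOpen.measurableSet
  refine ⟨?_, fun i => ?_, fun i φ hφ => ?_⟩
  · rw [vol_top]; exact (memLp_indicator_iff_restrict mΩ).2 h.memLp
  · rw [vol_top]; exact (memLp_indicator_iff_restrict mΩ).2 (h.memLp_grad i)
  · have := h.rel i φ hφ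
    simp only [vol_top, ← indicator_mul_left]
    rwa [integral_indicator mΩ, integral_indicator mΩ]

/-- The mollification error of a function with zero trace. -/
lemma IsH1.eLpNorm_mollify_sub_le {Ω : Opens (RN N)} (hbdd : Bornology.IsBounded (Ω : Set (RN N)))
    {f : RN N → ℝ} {g : Fin N → RN N → ℝ} (h : IsH1 Ω univ f g) (k : ℕ) :
    eLpNorm (mollify k ((Ω : Set (RN N)).indicator f) - (Ω : Set (RN N)).indicator f) 2 volume ≤
      ENNReal.ofReal (1 / ((k : ℝ) + 1)) * ∑ i, eLpNorm (g i) 2 (vol Ω) := by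
  have mΩ : MeasurableSet (Ω : Set (RN N)) := Ω.isOpen.measurableSet
  set F := (Ω : Set (RN N)).indicator f with hF
  have hFL : MemLp F 2 volume := (memLp_indicator_iff_restrict mΩ).2 h.memLp
  obtain ⟨φ, -, ht, -, h1, -, h3, -⟩ := h.extend.exists_approx hbdd.isCompact_closure
    (fun x _ hx' => indicator_of_notMem (fun hx => hx' (subset_closure hx)) _)
  simp only [vol_top] at h1 h3
  have key : ∀ n, eLpNorm (mollify k F - F) 2 volume ≤ eLpNorm (φ n - F) 2 volume +
      ENNReal.ofReal (1 / ((k : ℝ) + 1)) * ∑ i, eLpNorm (g i) 2 (vol Ω) +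
      eLpNorm (φ n - F) 2 volume := fun n => by
    have mL := (ht n).memLp 2 volume
    have e : mollify k F - F = -mollify k (φ n - F) + (mollify k (φ n) - φ n) + (φ n - F) := by
      rw [mollify_sub k (mL.locallyIntegrable one_le_two) (hFL.locallyIntegrable one_le_two)]
      abel
    have m1 : AEStronglyMeasurable (mollify k (φ n - F)) volume :=
      (contDiff_mollify k ((mL.sub hFL).locallyIntegrable
        one_le_two)).continuous.aestronglyMeasurable
    have m2 : AEStronglyMeasurable (mollify k (φ n) - φ n) volume :=
      (contDiff_mollify k (mL.locallyIntegrable one_le_two)).continuous.aestronglyMeasurable.sub mL.1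
    rw [e]
    refine (eLpNorm_add_le (m1.neg.add m2) (mL.1.sub hFL.1) one_le_two).trans ?_
    gcongr
    refine (eLpNorm_add_le m1.neg m2 one_le_two).trans ?_
    rw [eLpNorm_neg]
    gcongr
    · exact eLpNorm_mollify_le k (mL.1.sub hFL.1) one_le_two (by simp)
    · refine (eLpNorm_mollify_sub_le_of_isTest k (ht n)).trans ?_
      gcongr with i
      refine (h3 i 2 one_le_two (by simp) n).trans_eq ?_
      rw [eLpNorm_indicator_eq_eLpNorm_restrict mΩ]
  refine ge_of_tendsto' (x := atTop) ?_ key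
  simpa using (h1.add_const _).add h1

/-- Rellich's theorem: a sequence of functions with zero trace which is bounded in `W^{1,2}(Ω)`
and converges weakly to zero in `L²` converges to zero in `L²`. Each mollification of the sequence
converges pointwise and boundedly, and the mollification error is uniformly small. -/
lemma tendsto_of_weak {Ω : Opens (RN N)} (hbdd : Bornology.IsBounded (Ω : Set (RN N)))
    {v : ℕ → RN N → ℝ} {w : ℕ → Fin N → RN N → ℝ} (h : ∀ n, IsH1 Ω univ (v n) (w n)) {C : ℝ≥0}
    (hv : ∀ n, eLpNorm (v n) 2 (vol Ω) ≤ C) (hw : ∀ n i, eLpNorm (w n i) 2 (vol Ω) ≤ C)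
    (hweak : ∀ z, MemLp z 2 (vol Ω) →
      Tendsto (fun n => ∫ x, z x * v n x ∂(vol Ω)) atTop (𝓝 0)) :
    Tendsto (fun n => eLpNorm (v n) 2 (vol Ω)) atTop (𝓝 0) := by
  have mΩ : MeasurableSet (Ω : Set (RN N)) := Ω.isOpen.measurableSet
  have : IsFiniteMeasure (vol Ω) := ⟨by simpa using hbdd.measure_lt_top⟩
  let F : ℕ → RN N → ℝ := fun n => (Ω : Set (RN N)).indicator (v n)
  have hFL : ∀ n, MemLp (F n) 2 volume := fun n => (memLp_indicator_iff_restrict mΩ).2 (h n).memLp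
  have hcont : ∀ k n, Continuous (mollify k (F n)) := fun k n =>
    (contDiff_mollify k ((hFL n).locallyIntegrable one_le_two)).continuous
  have hker : ∀ k x, MemLp (fun t => (bump N k).normed volume (x - t)) 2 volume := fun k x =>
    (((bump N k).continuous_normed.comp (continuous_sub_left x)).memLp_of_hasCompactSupport
      ((bump N k).hasCompactSupport_normed.comp_homeomorph (Homeomorph.subLeft x)))
  have happ : ∀ k n x, mollify k (F n) x = ∫ t, (bump N k).normed volume (x - t) * v n t ∂(vol Ω) :=
    fun k n x => by
      rw [mollify_apply', ← integral_indicator mΩ]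
      refine integral_congr_ae (ae_of_all _ fun t => ?_)
      by_cases ht : t ∈ (Ω : Set (RN N)) <;> simp [F, ht]
  have hsq : ∀ n, ∫ x, v n x ^ 2 ∂(vol Ω) ≤ (C : ℝ) ^ 2 := fun n => by
    have := hv n
    rw [eLpNorm_two_eq (h n).memLp, ENNReal.ofReal_le_iff_le_toReal (by simp)] at this
    exact Real.sqrt_le_iff.1 this |>.2
  have hmol : ∀ k, Tendsto (fun n => eLpNorm (mollify k (F n)) 2 (vol Ω)) atTop (𝓝 0) := fun k => by
    set M : ℝ := ∫ t, (bump N k).normed volume t ^ 2 with hM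
    have hM0 : 0 ≤ M := integral_nonneg fun _ => sq_nonneg _
    have hbd : ∀ n x, mollify k (F n) x ^ 2 ≤ M * (C : ℝ) ^ 2 := fun n x => by
      rw [happ]
      refine (integral_mul_sq_le ((hker k x).restrict _) (h n).memLp).trans ?_
      have : ∫ t, (bump N k).normed volume (x - t) ^ 2 ∂(vol Ω) ≤ M := by
        rw [hM, ← integral_sub_left_eq_self (fun t => (bump N k).normed volume t ^ 2) volume x]
        exact setIntegral_le_integral (hker k x).integrable_sq (ae_of_all _ fun _ => sq_nonneg _)
      exact mul_le_mul this (hsq n) (integral_nonneg fun _ => sq_nonneg _) hM0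
    have hmem : ∀ n, MemLp (mollify k (F n)) 2 (vol Ω) := fun n =>
      MemLp.of_bound (hcont k n).aestronglyMeasurable (√(M * (C : ℝ) ^ 2))
        (ae_of_all _ fun x => by
          rw [Real.norm_eq_abs]; exact Real.abs_le_sqrt (hbd n x))
    have h0 : Tendsto (fun n => ∫ x, mollify k (F n) x ^ 2 ∂(vol Ω)) atTop
        (𝓝 (∫ _, (0 : ℝ) ∂(vol Ω))) := by
      refine tendsto_integral_of_dominated_convergence (fun _ => M * (C : ℝ) ^ 2)
        (fun n => ((hcont k n).pow 2).aestronglyMeasurable) (integrable_const _)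
        (fun n => ae_of_all _ fun x => ?_) (ae_of_all _ fun x => ?_)
      · rw [Real.norm_of_nonneg (sq_nonneg _)]; exact hbd n x
      · have := (hweak _ ((hker k x).restrict (Ω : Set (RN N)))).pow 2
        simpa only [happ, zero_pow two_ne_zero] using this
    rw [integral_zero] at h0
    simp only [fun n => eLpNorm_two_eq (hmem n)]
    have := ENNReal.tendsto_ofReal (h0.sqrt)
    simpa using this
  rw [ENNReal.tendsto_atTop_zero]
  intro ε hε
  have hε2 : 0 < ε / 2 := ENNReal.half_pos hε.ne'
  have hk : Tendsto (fun k : ℕ => ENNReal.ofReal (1 / ((k : ℝ) + 1)) * ((N : ℝ≥0∞) * C)) atTop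
      (𝓝 0) := by
    have h1 := ENNReal.tendsto_ofReal (tendsto_one_div_add_atTop_nhds_zero_nat (𝕜 := ℝ))
    have h2 := ENNReal.Tendsto.mul_const (b := (N : ℝ≥0∞) * C) h1
      (Or.inr (ENNReal.mul_ne_top (ENNReal.natCast_ne_top N) ENNReal.coe_ne_top))
    simpa using h2
  obtain ⟨k, hk⟩ := (hk.eventually (ge_mem_nhds hε2)).exists
  obtain ⟨n₀, hn₀⟩ := eventually_atTop.1 ((hmol k).eventually (ge_mem_nhds hε2))
  refine ⟨n₀, fun n hn => ?_⟩
  have e : eLpNorm (v n) 2 (vol Ω) =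
      eLpNorm (mollify k (F n) - (mollify k (F n) - F n)) 2 (vol Ω) := by
    refine eLpNorm_congr_ae ?_
    filter_upwards [ae_restrict_mem mΩ] with x hx
    simp [F, indicator_of_mem hx]
  rw [e]
  refine (eLpNorm_sub_le (hcont k n).aestronglyMeasurable ((hcont k n).aestronglyMeasurable.sub
    (hFL n).1.restrict) one_le_two).trans ?_
  rw [← ENNReal.add_halves ε]
  refine add_le_add (hn₀ n hn) ?_
  refine (eLpNorm_mono_measure _ Measure.restrict_le_self).trans
    (((h n).eLpNorm_mollify_sub_le hbdd k).trans (le_trans ?_ hk))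
  gcongr
  refine (Finset.sum_le_sum fun i _ => hw n i).trans_eq ?_
  simp

/-! ### Weak derivatives and Sobolev spaces -/

section WeakDeriv

variable {Ω : Opens (RN N)} {m : ℕ}

lemma isTest_testFunction (φ : TestFunction Ω ℝ ⊤) : IsTest Ω φ :=
  ⟨contDiff_one_of_smooth φ.contDiff, φ.hasCompactSupport, φ.tsupport_subset⟩

lemma partialDeriv_zero (I : Fin 0 → Fin N) (f : RN N → ℝ) : partialDeriv I f = f := rfl

lemma partialDeriv_succ (I : Fin (m + 1) → Fin N) {f : RN N → ℝ} (hf : ContDiff ℝ ∞ f) :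
    partialDeriv I f = pd (I 0) (partialDeriv (Fin.tail I) f) := by
  ext x
  have hd : DifferentiableAt ℝ (iteratedFDeriv ℝ m f) x :=
    hf.differentiable_iteratedFDeriv (by exact_mod_cast ENat.natCast_lt_top m) x
  exact hd.iteratedFDeriv_succ_apply_left'

lemma contDiff_partialDeriv (I : Fin m → Fin N) {f : RN N → ℝ} (hf : ContDiff ℝ ∞ f) :
    ContDiff ℝ ∞ (partialDeriv I f) := by
  induction m with
  | zero => exact hf
  | succ m ih =>
    rw [partialDeriv_succ I hf]
    exact contDiff_pd (ih (Fin.tail I)) (by simp) _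

lemma pd_partialDeriv (I : Fin m → Fin N) (i : Fin N) {f : RN N → ℝ} (hf : ContDiff ℝ ∞ f) :
    pd i (partialDeriv I f) = partialDeriv I (pd i f) := by
  induction m with
  | zero => rfl
  | succ m ih =>
    rw [partialDeriv_succ I hf, partialDeriv_succ I (contDiff_pd hf (by simp) i), ← ih]
    ext x
    exact pd_comm (contDiff_infty.1 (contDiff_partialDeriv _ hf) 2) _ _ x

/-- The partial derivative of a test function as a test function. -/
def testPd (i : Fin N) (φ : TestFunction Ω ℝ ⊤) : TestFunction Ω ℝ ⊤ where
  toFun := pd i φ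
  contDiff' := contDiff_pd φ.contDiff (by simp) i
  hasCompactSupport' := hasCompactSupport_pd φ.hasCompactSupport i
  tsupport_subset' := (tsupport_pd_subset φ i).trans φ.tsupport_subset

lemma exists_testFunction_partialDeriv (I : Fin m → Fin N) (φ : TestFunction Ω ℝ ⊤) :
    ∃ ψ : TestFunction Ω ℝ ⊤, partialDeriv I φ = ψ := by
  induction m with
  | zero => exact ⟨φ, rfl⟩
  | succ m ih =>
    obtain ⟨ψ, hψ⟩ := ih (Fin.tail I)
    exact ⟨testPd (I 0) ψ, by rw [partialDeriv_succ I φ.contDiff, hψ]; rfl⟩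

lemma memLp_partialDeriv (I : Fin m → Fin N) (φ : TestFunction Ω ℝ ⊤) (p : ℝ≥0∞)
    (μ : Measure (RN N)) [IsFiniteMeasureOnCompacts μ] : MemLp (partialDeriv I φ) p μ := by
  obtain ⟨ψ, hψ⟩ := exists_testFunction_partialDeriv I φ
  rw [hψ]; exact (isTest_testFunction ψ).memLp p μ

lemma partialDeriv_add (I : Fin m → Fin N) (φ ψ : TestFunction Ω ℝ ⊤) (x : RN N) :
    partialDeriv I (φ + ψ : TestFunction Ω ℝ ⊤) x = partialDeriv I φ x + partialDeriv I ψ x := by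
  have := iteratedFDeriv_add_apply (𝕜 := ℝ) (i := m) (x := x)
    (contDiff_infty.1 φ.contDiff m).contDiffAt (contDiff_infty.1 ψ.contDiff m).contDiffAt
  exact congrArg (fun T => T fun j => EuclideanSpace.single (I j) (1 : ℝ)) this

lemma partialDeriv_smul (I : Fin m → Fin N) (c : ℝ) (φ : TestFunction Ω ℝ ⊤) (x : RN N) :
    partialDeriv I (c • φ : TestFunction Ω ℝ ⊤) x = c * partialDeriv I φ x := by
  have := iteratedFDeriv_const_smul_apply (𝕜 := ℝ) (i := m) (x := x) (a := c)
    (contDiff_infty.1 φ.contDiff m).contDiffAt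
  exact congrArg (fun T => T fun j => EuclideanSpace.single (I j) (1 : ℝ)) this

lemma integral_testFunction_mul_partialDeriv (I : Fin m → Fin N) (φ ψ : TestFunction Ω ℝ ⊤) :
    ∫ x, φ x * partialDeriv I ψ x = (-1) ^ m * ∫ x, partialDeriv I φ x * ψ x := by
  induction m generalizing φ with
  | zero => simp [partialDeriv_zero]
  | succ m ih =>
    obtain ⟨χ, hχ⟩ := exists_testFunction_partialDeriv (Fin.tail I) ψ
    rw [partialDeriv_succ I ψ.contDiff, partialDeriv_succ I φ.contDiff, hχ,
      integral_mul_pd (isTest_testFunction φ).contDiff (isTest_testFunction χ).toUniv, ← hχ,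
      pd_partialDeriv _ _ φ.contDiff]
    have := ih (Fin.tail I) (testPd (I 0) φ)
    simp only [testPd, TestFunction.coe_mk] at this
    rw [this, pow_succ]
    ring

lemma setIntegral_mul_testFunction (f : RN N → ℝ) (φ : TestFunction Ω ℝ ⊤) :
    ∫ x, f x * φ x ∂(vol Ω) = ∫ x, f x * φ x :=
  setIntegral_eq_integral_of_forall_compl_eq_zero fun x hx => by
    rw [image_eq_zero_of_notMem_tsupport fun h => hx (φ.tsupport_subset h), mul_zero]

lemma locallyIntegrableOn_of_memLp {f : RN N → ℝ} {p : ℝ≥0∞} (hp : 1 ≤ p) (hf : MemLp f p (vol Ω)) :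
    LocallyIntegrableOn f Ω :=
  locallyIntegrableOn_of_locallyIntegrable_restrict (hf.locallyIntegrable hp)

lemma hasWeakDeriv_testFunction (I : Fin m → Fin N) (φ : TestFunction Ω ℝ ⊤) :
    HasWeakDeriv Ω I φ (partialDeriv I φ) := by
  refine ⟨locallyIntegrableOn_of_memLp le_rfl ((isTest_testFunction φ).memLp 1 _),
    locallyIntegrableOn_of_memLp le_rfl (memLp_partialDeriv I φ 1 _), fun ψ => ?_⟩
  obtain ⟨χ, hχ⟩ := exists_testFunction_partialDeriv I ψ
  rw [hχ, setIntegral_mul_testFunction, setIntegral_mul_testFunction, ← hχ]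
  exact integral_testFunction_mul_partialDeriv I φ ψ

lemma integrable_mul_testFunction {f : RN N → ℝ} (hf : LocallyIntegrableOn f Ω)
    (φ : TestFunction Ω ℝ ⊤) : Integrable (fun x => f x * φ x) (vol Ω) := by
  have hi := hf.integrableOn_compact_subset φ.tsupport_subset φ.hasCompactSupport
  obtain ⟨C, hC, h⟩ := (isTest_testFunction φ).bounded
  have h1 : IntegrableOn (fun x => f x * φ x) (tsupport φ) volume :=
    hi.mul_bdd (c := C) φ.continuous.aestronglyMeasurable (ae_of_all _ fun x => h x)
  have h2 : Integrable (fun x => f x * φ x) volume :=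
    (integrableOn_iff_integrable_of_support_subset fun x hx =>
      subset_tsupport φ (right_ne_zero_of_mul (Function.mem_support.1 hx))).1 h1
  exact h2.integrableOn

namespace HasWeakDeriv

variable {I : Fin m → Fin N} {u u' v v' : RN N → ℝ}

/-- Weak derivatives are unique almost everywhere. -/
lemma ae_eq (h : HasWeakDeriv Ω I u v) (h' : HasWeakDeriv Ω I u v') : v =ᵐ[vol Ω] v' := by
  have := Ω.isOpen.ae_eq_zero_of_integral_contDiff_smul_eq_zero (f := v - v') (μ := volume)
    (h.2.1.sub h'.2.1) fun φ hφ hc hs => by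
      let ψ : TestFunction Ω ℝ ⊤ := ⟨φ, hφ, hc, hs⟩
      have e1 := (h.2.2 ψ).symm.trans (h'.2.2 ψ)
      have e2 := mul_left_cancel₀ (pow_ne_zero m (by norm_num)) e1
      have i1 := integrable_mul_testFunction h.2.1 ψ
      have i2 := integrable_mul_testFunction h'.2.1 ψ
      have e3 := setIntegral_mul_testFunction (v - v') ψ
      simp only [smul_eq_mul, mul_comm (φ _)]
      refine e3.symm.trans ?_
      simp only [Pi.sub_apply, sub_mul]
      rw [integral_sub i1 i2, sub_eq_zero]; exact e2
  have h2 := (ae_restrict_iff' Ω.isOpen.measurableSet).2 this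
  filter_upwards [h2] with x hx
  exact sub_eq_zero.1 hx

lemma sub (h : HasWeakDeriv Ω I u v) (h' : HasWeakDeriv Ω I u' v') :
    HasWeakDeriv Ω I (fun x => u x - u' x) (fun x => v x - v' x) := by
  refine ⟨h.1.sub h'.1, h.2.1.sub h'.2.1, fun φ => ?_⟩
  obtain ⟨χ, hχ⟩ := exists_testFunction_partialDeriv I φ
  have e1 := h.2.2 φ
  have e2 := h'.2.2 φ
  rw [hχ] at e1 e2 ⊢
  simp only [sub_mul]
  rw [integral_sub (integrable_mul_testFunction h.1 χ) (integrable_mul_testFunction h'.1 χ),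
    integral_sub (integrable_mul_testFunction h.2.1 φ) (integrable_mul_testFunction h'.2.1 φ),
    e1, e2, mul_sub]

lemma hasWeakDeriv_weakDeriv (h : HasWeakDeriv Ω I u v) : HasWeakDeriv Ω I u (weakDeriv Ω I u) := by
  have : ∃ v, HasWeakDeriv Ω I u v := ⟨v, h⟩
  rw [weakDeriv, dif_pos this]
  exact this.choose_spec

lemma weakDeriv_ae_eq (h : HasWeakDeriv Ω I u v) : weakDeriv Ω I u =ᵐ[vol Ω] v :=
  h.hasWeakDeriv_weakDeriv.ae_eq h

end HasWeakDeriv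

lemma hasWeakDeriv_zero {u : RN N → ℝ} (hu : LocallyIntegrableOn u Ω) (I : Fin 0 → Fin N) :
    HasWeakDeriv Ω I u u :=
  ⟨hu, hu, fun φ => by simp [partialDeriv_zero]⟩

lemma partialDeriv_one (i : Fin N) {f : RN N → ℝ} (hf : ContDiff ℝ ∞ f) :
    partialDeriv ![i] f = pd i f := partialDeriv_succ _ hf

lemma partialDeriv_two (i j : Fin N) {f : RN N → ℝ} (hf : ContDiff ℝ ∞ f) :
    partialDeriv ![i, j] f = pd i (pd j f) := by
  rw [partialDeriv_succ _ hf, partialDeriv_succ _ hf]; rfl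

namespace MemSobolev

variable {k : ℕ} {p : ℝ≥0∞} {u : RN N → ℝ}

lemma mono {l : ℕ} (h : MemSobolev Ω k p u) (hl : l ≤ k) : MemSobolev Ω l p u :=
  fun m hm I => h m (hm.trans hl) I

lemma hasWeakDeriv (h : MemSobolev Ω k p u) (hm : m ≤ k) (I : Fin m → Fin N) :
    HasWeakDeriv Ω I u (weakDeriv Ω I u) := by
  obtain ⟨v, hv, -⟩ := h m hm I
  exact hv.hasWeakDeriv_weakDeriv

lemma memLp_weakDeriv (h : MemSobolev Ω k p u) (hm : m ≤ k) (I : Fin m → Fin N) :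
    MemLp (weakDeriv Ω I u) p (vol Ω) := by
  obtain ⟨v, hv, hp⟩ := h m hm I
  exact hp.ae_eq hv.weakDeriv_ae_eq.symm

lemma weakDeriv_zero_ae_eq (h : MemSobolev Ω k p u) (I : Fin 0 → Fin N) :
    weakDeriv Ω I u =ᵐ[vol Ω] u :=
  (hasWeakDeriv_zero (h.hasWeakDeriv (Nat.zero_le k) I).1 I).weakDeriv_ae_eq

lemma memLp (h : MemSobolev Ω k p u) : MemLp u p (vol Ω) :=
  (h.memLp_weakDeriv (Nat.zero_le k) ![]).ae_eq (h.weakDeriv_zero_ae_eq _)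

lemma isH1_weakDeriv (h : MemSobolev Ω 2 2 u) (i : Fin N) :
    IsH1 Ω Ω (weakDeriv Ω ![i] u) fun j => weakDeriv Ω ![i, j] u := by
  refine .of_smooth (h.memLp_weakDeriv one_le_two _) (fun i => h.memLp_weakDeriv le_rfl _)
    fun j φ hφ hc hs => ?_
  have h2 := (h.hasWeakDeriv le_rfl ![i, j]).2.2 ⟨φ, hφ, hc, hs⟩
  rw [TestFunction.coe_mk, partialDeriv_two i j hφ] at h2
  have h1 := (h.hasWeakDeriv one_le_two ![i]).2.2 (testPd j ⟨φ, hφ, hc, hs⟩)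
  simp only [testPd, TestFunction.coe_mk] at h1
  rw [partialDeriv_one i (contDiff_pd hφ (by simp) j), h2] at h1
  linarith

lemma weakDeriv_symm (h : MemSobolev Ω 2 2 u) (i j : Fin N) :
    weakDeriv Ω ![i, j] u =ᵐ[vol Ω] weakDeriv Ω ![j, i] u := by
  have h1 := h.hasWeakDeriv le_rfl ![i, j]
  have h2 := h.hasWeakDeriv le_rfl ![j, i]
  refine h1.ae_eq ⟨h2.1, h2.2.1, fun φ => ?_⟩
  rw [← h2.2.2 φ, partialDeriv_two i j φ.contDiff, partialDeriv_two j i φ.contDiff]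
  congr 1; ext x
  rw [pd_comm (contDiff_infty.1 φ.contDiff 2)]

/-- Membership in `W^{k,p}(Ω)` follows from `W^{k,q}(Ω)` and integrability of the derivatives. -/
lemma of_memLp {q : ℝ≥0∞} (h : MemSobolev Ω k q u)
    (hp : ∀ m ≤ k, ∀ I : Fin m → Fin N, MemLp (weakDeriv Ω I u) p (vol Ω)) : MemSobolev Ω k p u :=
  fun m hm I => ⟨_, h.hasWeakDeriv hm I, hp m hm I⟩

end MemSobolev

lemma memSobolev_testFunction (φ : TestFunction Ω ℝ ⊤) (k : ℕ) (p : ℝ≥0∞) :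
    MemSobolev Ω k p φ :=
  fun _ _ I => ⟨_, hasWeakDeriv_testFunction I φ, memLp_partialDeriv I φ p _⟩

lemma weakDeriv_testFunction (I : Fin m → Fin N) (φ : TestFunction Ω ℝ ⊤) :
    weakDeriv Ω I φ =ᵐ[vol Ω] partialDeriv I φ :=
  (hasWeakDeriv_testFunction I φ).weakDeriv_ae_eq

lemma MemSobolev.weakDeriv_sub_testFunction {k : ℕ} {p : ℝ≥0∞} {u : RN N → ℝ}
    (h : MemSobolev Ω k p u) (hm : m ≤ k) (I : Fin m → Fin N) (φ : TestFunction Ω ℝ ⊤) :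
    weakDeriv Ω I (fun x => u x - φ x) =ᵐ[vol Ω] weakDeriv Ω I u - partialDeriv I φ :=
  ((h.hasWeakDeriv hm I).sub (hasWeakDeriv_testFunction I φ)).weakDeriv_ae_eq

lemma weakDeriv_of_ae_eq_zero {u : RN N → ℝ} (hl : LocallyIntegrableOn u Ω)
    (hu : u =ᵐ[vol Ω] 0) (I : Fin m → Fin N) : weakDeriv Ω I u =ᵐ[vol Ω] 0 := by
  refine HasWeakDeriv.weakDeriv_ae_eq ⟨hl, locallyIntegrableOn_zero, fun φ => ?_⟩
  rw [integral_eq_zero_of_ae (hu.mono fun x hx => by simp only [hx, Pi.zero_apply, zero_mul])]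
  simp

lemma eLpNorm_weakDeriv_le_sobolevNorm {k : ℕ} {p : ℝ≥0∞} (u : RN N → ℝ) (hm : m ≤ k)
    (I : Fin m → Fin N) : eLpNorm (weakDeriv Ω I u) p (vol Ω) ≤ sobolevNorm Ω k p u := by
  rw [sobolevNorm]
  refine le_trans ?_ (Finset.single_le_sum (fun _ _ => zero_le)
    (Finset.mem_range.2 (Nat.lt_succ_of_le hm)))
  exact Finset.single_le_sum (f := fun I => eLpNorm (weakDeriv Ω I u) p (vol Ω))
    (fun _ _ => zero_le) (Finset.mem_univ I)

namespace MemSobolevZero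

variable {k : ℕ} {p : ℝ≥0∞} {u : RN N → ℝ}

lemma mono {l : ℕ} (h : MemSobolevZero Ω k p u) (hl : l ≤ k) : MemSobolevZero Ω l p u := by
  refine ⟨h.1.mono hl, fun ε hε => ?_⟩
  obtain ⟨φ, hφ⟩ := h.2 ε hε
  refine ⟨φ, lt_of_le_of_lt ?_ hφ⟩
  exact Finset.sum_le_sum_of_subset (Finset.range_mono (by omega))

/-- Approximation by test functions in `W^{k,p}(Ω)`. -/
lemma exists_seq (h : MemSobolevZero Ω k p u) :
    ∃ φ : ℕ → TestFunction Ω ℝ ⊤, ∀ m ≤ k, ∀ I : Fin m → Fin N,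
      Tendsto (fun n => eLpNorm (partialDeriv I (φ n) - weakDeriv Ω I u) p (vol Ω)) atTop
          (𝓝 0) := by
  have hpos : ∀ n : ℕ, (0 : ℝ≥0∞) < ((n : ℝ≥0∞) + 1)⁻¹ := fun n => by simp
  choose φ hφ using fun n : ℕ => h.2 _ (hpos n)
  refine ⟨φ, fun m hm I => ?_⟩
  have h0 : Tendsto (fun n : ℕ => ((n : ℝ≥0∞) + 1)⁻¹) atTop (𝓝 0) := by
    have := (tendsto_add_atTop_iff_nat 1).2 ENNReal.tendsto_inv_nat_nhds_zero
    simpa using this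
  refine tendsto_of_tendsto_of_tendsto_of_le_of_le tendsto_const_nhds h0 (fun _ => zero_le)
    fun n => ?_
  simp only
  rw [← neg_sub, eLpNorm_neg, ← eLpNorm_congr_ae (h.1.weakDeriv_sub_testFunction hm I (φ n))]
  exact (eLpNorm_weakDeriv_le_sobolevNorm _ hm I).trans (hφ n).le

/-- Functions in `W^{1,2}_0(Ω)` have zero trace in the sense of integration by parts. -/
lemma isH1_univ (h : MemSobolevZero Ω 1 2 u) : IsH1 Ω univ u fun i => weakDeriv Ω ![i] u := by
  refine ⟨h.1.memLp, fun i => h.1.memLp_weakDeriv le_rfl _, fun i ψ hψ => ?_⟩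
  obtain ⟨φ, hφ⟩ := h.exists_seq
  have h0 : Tendsto (fun n => eLpNorm (⇑(φ n) - u) 2 (vol Ω)) atTop (𝓝 0) := by
    refine (hφ 0 (by norm_num) ![]).congr fun n => eLpNorm_congr_ae ?_
    rw [partialDeriv_zero]
    exact (EventuallyEq.refl _ _).sub (h.1.weakDeriv_zero_ae_eq _)
  have h1 := hφ 1 le_rfl ![i]
  have t1 := tendsto_integral_mul h.1.memLp (hψ.memLp_pd i 2 _)
    (fun n => (isTest_testFunction (φ n)).memLp 2 _) (fun _ => hψ.memLp_pd i 2 _) h0 (by simp)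
  have t2 := tendsto_integral_mul (h.1.memLp_weakDeriv le_rfl ![i]) (hψ.memLp 2 _)
    (fun n => memLp_partialDeriv ![i] (φ n) 2 _) (fun _ => hψ.memLp 2 _) h1 (by simp)
  refine tendsto_nhds_unique t1 (t2.neg.congr fun n => ?_)
  have e1 : ∀ f : RN N → ℝ, (∀ x ∉ tsupport (φ n), f x = 0) →
      ∫ x, f x ∂(vol Ω) = ∫ x, f x := fun f hf =>
    setIntegral_eq_integral_of_forall_compl_eq_zero fun x hx =>
      hf x fun h => hx ((φ n).tsupport_subset h)
  rw [partialDeriv_one i (φ n).contDiff, e1, e1]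
  · have := integral_mul_pd hψ.contDiff (isTest_testFunction (φ n)).toUniv i
    simp only [mul_comm] at this ⊢
    linarith
  · intro x hx; rw [image_eq_zero_of_notMem_tsupport hx, zero_mul]
  · intro x hx
    rw [image_eq_zero_of_notMem_tsupport (f := pd i (φ n))
      fun h => hx (tsupport_pd_subset _ _ h), zero_mul]

end MemSobolevZero

lemma memSobolevZero_testFunction (φ : TestFunction Ω ℝ ⊤) (k : ℕ) (p : ℝ≥0∞) :
    MemSobolevZero Ω k p φ := by
  refine ⟨memSobolev_testFunction φ k p, fun ε hε => ⟨φ, ?_⟩⟩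
  have : sobolevNorm Ω k p (fun x => φ x - φ x) = 0 := by
    refine Finset.sum_eq_zero fun m _ => Finset.sum_eq_zero fun I _ => ?_
    simp only [sub_self]
    rw [eLpNorm_congr_ae (weakDeriv_of_ae_eq_zero locallyIntegrableOn_zero
      (EventuallyEq.refl _ (0 : RN N → ℝ)) I), eLpNorm_zero]
  rwa [this]

end WeakDeriv

/-! ### Weak compactness -/

/-- Bounded sequences in a separable Hilbert space have weakly convergent subsequences. -/
lemma exists_weak_subseq {E : Type*} [NormedAddCommGroup E] [InnerProductSpace ℝ E]
    [CompleteSpace E] [SeparableSpace E] {x : ℕ → E} {C : ℝ} (hx : ∀ n, ‖x n‖ ≤ C) :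
    ∃ (y : E) (ψ : ℕ → ℕ), StrictMono ψ ∧
      ∀ z, Tendsto (fun n => inner ℝ (x (ψ n)) z) atTop (𝓝 (inner ℝ y z)) := by
  let T := InnerProductSpace.toDual ℝ E
  obtain ⟨F, -, ψ, hψ, hF⟩ := WeakDual.isSeqCompact_closedBall ℝ E (0 : StrongDual ℝ E) C
    (x := fun n => StrongDual.toWeakDual (T (x n)))
    (fun n => by
      simp only [mem_preimage, mem_closedBall_zero_iff]
      exact (T.norm_map (x n)).trans_le (hx n))
  refine ⟨T.symm (WeakDual.toStrongDual F), ψ, hψ, fun z => ?_⟩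
  have h1 := ((WeakDual.eval_continuous z).tendsto F).comp hF
  rw [InnerProductSpace.toDual_symm_apply]
  exact h1

section Jets

variable {Ω : Opens (RN N)} {k : ℕ} {u v : RN N → ℝ}

/-- The multi-indices of order at most `k`, as lists of directions. -/
abbrev JetIndex (N k : ℕ) : Type := Σ m : Fin (k + 1), (Fin m → Fin N)

/-- The Hilbert space which contains `W^{k,2}(Ω)` via the collection of all derivatives. -/
abbrev JetSpace (Ω : Opens (RN N)) (k : ℕ) : Type := PiLp 2 fun _ : JetIndex N k => Lp ℝ 2 (vol Ω)

/-- All weak derivatives of order at most `k`. -/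
def MemSobolev.jet (h : MemSobolev Ω k 2 u) : JetSpace Ω k :=
  WithLp.toLp 2 fun s => (h.memLp_weakDeriv (Nat.lt_succ_iff.1 s.1.2) s.2).toLp _

lemma MemSobolev.inner_jet (h : MemSobolev Ω k 2 u) (y : JetSpace Ω k) :
    inner ℝ h.jet y = ∑ s : JetIndex N k, ∫ x, y s x * weakDeriv Ω s.2 u x ∂(vol Ω) := by
  rw [PiLp.inner_apply]
  refine Finset.sum_congr rfl fun s _ => ?_
  rw [integral_mul_eq_inner (Lp.memLp (y s)) (h.memLp_weakDeriv (Nat.lt_succ_iff.1 s.1.2) s.2),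
    Lp.toLp_coeFn]
  rfl

/-- The jets of test functions. -/
def testJets (Ω : Opens (RN N)) (k : ℕ) : Submodule ℝ (JetSpace Ω k) where
  carrier := {x | ∃ φ : TestFunction Ω ℝ ⊤, ∀ s : JetIndex N k, x s =ᵐ[vol Ω] partialDeriv s.2 φ}
  add_mem' := by
    rintro x y ⟨φ, hφ⟩ ⟨ψ, hψ⟩
    refine ⟨φ + ψ, fun s => ?_⟩
    filter_upwards [hφ s, hψ s, Lp.coeFn_add (x s) (y s)] with z h1 h2 h3
    rw [partialDeriv_add, ← h1, ← h2]
    exact h3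
  zero_mem' := by
    refine ⟨(0 : ℝ) • 0, fun s => ?_⟩
    filter_upwards [Lp.coeFn_zero ℝ 2 (vol Ω)] with z hz
    rw [partialDeriv_smul, zero_mul]
    exact hz
  smul_mem' := by
    rintro c x ⟨φ, hφ⟩
    refine ⟨c • φ, fun s => ?_⟩
    filter_upwards [hφ s, Lp.coeFn_smul c (x s)] with z h1 h3
    rw [partialDeriv_smul, ← h1]
    exact h3

lemma MemSobolevZero.jet_mem_closure (h : MemSobolevZero Ω k 2 u) :
    h.1.jet ∈ (testJets Ω k).topologicalClosure := by
  obtain ⟨φ, hφ⟩ := h.exists_seq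
  let x : ℕ → JetSpace Ω k := fun n => WithLp.toLp 2 fun s =>
    (memLp_partialDeriv s.2 (φ n) 2 (vol Ω)).toLp _
  refine mem_closure_of_tendsto (b := atTop) (f := x) ?_ (Eventually.of_forall fun n => ?_)
  · refine ((PiLp.continuous_toLp 2 _).tendsto _).comp (tendsto_pi_nhds.2 fun s => ?_)
    rw [Lp.tendsto_Lp_iff_tendsto_eLpNorm'']
    exact hφ _ (Nat.lt_succ_iff.1 s.1.2) s.2
  · exact ⟨φ n, fun s => MemLp.coeFn_toLp (memLp_partialDeriv s.2 (φ n) 2 _)⟩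

lemma memSobolevZero_of_jet_mem_closure (h : MemSobolev Ω k 2 u)
    (hc : h.jet ∈ (testJets Ω k).topologicalClosure) : MemSobolevZero Ω k 2 u := by
  refine ⟨h, fun ε hε => ?_⟩
  obtain ⟨x, hx, hlim⟩ := mem_closure_iff_seq_limit.1 hc
  choose φ hφ using hx
  have h0 : Tendsto (fun n => sobolevNorm Ω k 2 fun x => u x - φ n x) atTop (𝓝 0) := by
    have : Tendsto (fun n => ∑ m ∈ Finset.range (k + 1), ∑ I : Fin m → Fin N,
        eLpNorm (weakDeriv Ω I fun x => u x - φ n x) 2 (vol Ω)) atTop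
        (𝓝 (∑ m ∈ Finset.range (k + 1), ∑ I : Fin m → Fin N, 0)) := by
      refine tendsto_finsetSum _ fun m hm => tendsto_finsetSum _ fun I _ => ?_
      have hm := Finset.mem_range.1 hm
      let s : JetIndex N k := ⟨⟨m, hm⟩, I⟩
      have h1 := ((PiLp.continuous_apply 2 _ s).tendsto _).comp hlim
      rw [Lp.tendsto_Lp_iff_tendsto_eLpNorm'] at h1
      refine h1.congr fun n => ?_
      rw [← eLpNorm_neg, neg_sub]
      refine eLpNorm_congr_ae ?_
      refine EventuallyEq.trans ?_ (h.weakDeriv_sub_testFunction (Nat.lt_succ_iff.1 hm) I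
          (φ n)).symm
      exact (MemLp.coeFn_toLp (h.memLp_weakDeriv (Nat.lt_succ_iff.1 hm) I)).sub (hφ n s)
    simp only [Finset.sum_const_zero] at this
    exact this
  obtain ⟨n, hn⟩ := (h0.eventually (gt_mem_nhds hε)).exists
  exact ⟨φ n, hn⟩

/-- `W^{k,2}_0(Ω)` is weakly closed in `W^{k,2}(Ω)`. -/
lemma memSobolevZero_of_weak {u : ℕ → RN N → ℝ} (hu : ∀ n, MemSobolevZero Ω k 2 (u n))
    (hv : MemSobolev Ω k 2 v) (hweak : ∀ m ≤ k, ∀ (I : Fin m → Fin N) z, MemLp z 2 (vol Ω) →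
      Tendsto (fun n => ∫ x, z x * weakDeriv Ω I (u n) x ∂(vol Ω)) atTop
        (𝓝 (∫ x, z x * weakDeriv Ω I v x ∂(vol Ω)))) :
    MemSobolevZero Ω k 2 v := by
  refine memSobolevZero_of_jet_mem_closure hv ?_
  rw [← Submodule.orthogonal_orthogonal_eq_closure, Submodule.mem_orthogonal']
  intro y hy
  have h1 : Tendsto (fun n => inner ℝ (hu n).1.jet y) atTop (𝓝 (inner ℝ hv.jet y)) := by
    simp only [MemSobolev.inner_jet]
    exact tendsto_finsetSum _ fun s _ => hweak _ (Nat.lt_succ_iff.1 s.1.2) s.2 _ (Lp.memLp (y s))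
  refine tendsto_nhds_unique h1 (tendsto_const_nhds.congr fun n => ?_)
  have h2 := (hu n).jet_mem_closure
  rw [← Submodule.orthogonal_orthogonal_eq_closure, Submodule.mem_orthogonal'] at h2
  exact (h2 y hy).symm

/-- Bounded sequences in `W^{k,2}(Ω)` have weakly convergent subsequences. -/
lemma exists_weak_limit {u : ℕ → RN N → ℝ} (hu : ∀ n, MemSobolev Ω k 2 (u n)) {C : ℝ≥0}
    (hC : ∀ n, ∀ m ≤ k, ∀ I : Fin m → Fin N, eLpNorm (weakDeriv Ω I (u n)) 2 (vol Ω) ≤ C) :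
    ∃ (v : RN N → ℝ) (ψ : ℕ → ℕ), StrictMono ψ ∧ MemSobolev Ω k 2 v ∧
      ∀ m ≤ k, ∀ (I : Fin m → Fin N) z, MemLp z 2 (vol Ω) →
        Tendsto (fun n => ∫ x, z x * weakDeriv Ω I (u (ψ n)) x ∂(vol Ω)) atTop
          (𝓝 (∫ x, z x * weakDeriv Ω I v x ∂(vol Ω))) := by
  classical
  have hb : ∀ n, ‖(hu n).jet‖ ≤ √(∑ _ : JetIndex N k, (C : ℝ) ^ 2) := fun n => by
    rw [PiLp.norm_eq_of_L2]
    refine Real.sqrt_le_sqrt (Finset.sum_le_sum fun s _ => ?_)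
    refine pow_le_pow_left₀ (norm_nonneg _) ?_ 2
    rw [MemSobolev.jet]
    simp only
    rw [Lp.norm_toLp]
    exact ENNReal.toReal_le_coe_of_le_coe (hC n _ (Nat.lt_succ_iff.1 s.1.2) s.2)
  have : Fact ((2 : ℝ≥0∞) ≠ ⊤) := ⟨by simp⟩
  have : SecondCountableTopology (Lp ℝ 2 (vol Ω)) := Lp.SecondCountableTopology
  have : SeparableSpace (Lp ℝ 2 (vol Ω)) := inferInstance
  have : SeparableSpace (JetIndex N k → Lp ℝ 2 (vol Ω)) := inferInstance
  have : SeparableSpace (JetSpace Ω k) :=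
    (WithLp.toLp_surjective 2).denseRange.separableSpace (PiLp.continuous_toLp 2 _)
  obtain ⟨y, ψ, hψ, hy⟩ := exists_weak_subseq hb
  -- weak convergence of each derivative, from test vectors with one nonzero component
  have hw : ∀ (s : JetIndex N k) z, MemLp z 2 (vol Ω) →
      Tendsto (fun n => ∫ x, z x * weakDeriv Ω s.2 (u (ψ n)) x ∂(vol Ω)) atTop
        (𝓝 (∫ x, z x * y s x ∂(vol Ω))) := fun s z hz => by
    have h1 := hy (WithLp.toLp 2 (Pi.single s (hz.toLp z)))
    have e : ∀ w : JetSpace Ω k, inner ℝ w (WithLp.toLp 2 (Pi.single s (hz.toLp z))) =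
        inner ℝ (w s) (hz.toLp z) := fun w => by
      rw [PiLp.inner_apply, Finset.sum_eq_single s]
      · simp
      · intro t _ hts; simp [Pi.single_eq_of_ne hts]
      · simp
    simp only [e] at h1
    rw [integral_mul_eq_inner hz (Lp.memLp (y s)), Lp.toLp_coeFn]
    refine h1.congr fun n => ?_
    rw [integral_mul_eq_inner hz ((hu (ψ n)).memLp_weakDeriv (Nat.lt_succ_iff.1 s.1.2) s.2)]
    rfl
  set s₀ : JetIndex N k := ⟨⟨0, by omega⟩, ![]⟩ with hs₀
  have hwd : ∀ m (hm : m ≤ k) (I : Fin m → Fin N),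
      HasWeakDeriv Ω I (y s₀) (y ⟨⟨m, Nat.lt_succ_of_le hm⟩, I⟩) := fun m hm I => by
    refine ⟨locallyIntegrableOn_of_memLp one_le_two (Lp.memLp _),
      locallyIntegrableOn_of_memLp one_le_two (Lp.memLp _), fun φ => ?_⟩
    have t1 := hw s₀ _ (memLp_partialDeriv I φ 2 _)
    have t2 := (hw ⟨⟨m, Nat.lt_succ_of_le hm⟩, I⟩ _
      ((isTest_testFunction φ).memLp 2 _)).const_mul ((-1) ^ m)
    simp only [mul_comm _ (weakDeriv _ _ _ _), mul_comm _ ((y _ : RN N → ℝ) _)] at t1 t2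
    refine tendsto_nhds_unique t1 (t2.congr fun n => ?_)
    rw [← ((hu (ψ n)).hasWeakDeriv hm I).2.2 φ]
    refine integral_congr_ae ?_
    filter_upwards [(hu (ψ n)).weakDeriv_zero_ae_eq ![]] with x hx
    exact congrArg (· * partialDeriv I φ x) hx.symm
  refine ⟨y s₀, ψ, hψ, fun m hm I => ⟨_, hwd m hm I, Lp.memLp _⟩, fun m hm I z hz => ?_⟩
  have := hw ⟨⟨m, Nat.lt_succ_of_le hm⟩, I⟩ z hz
  rwa [← integral_congr_ae ((hwd m hm I).weakDeriv_ae_eq.mono fun x hx => by simp only [hx] :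
    (fun x => z x * weakDeriv Ω I (y s₀) x) =ᵐ[vol Ω] _)] at this

end Jets

/-! ### Coercivity of the energy -/

section Energy

variable {Ω : Opens (RN N)} {bc : BoundaryCondition} {u : RN N → ℝ}

lemma isFiniteMeasure_vol (hbdd : Bornology.IsBounded (Ω : Set (RN N))) :
    IsFiniteMeasure (vol Ω) := ⟨by simpa using hbdd.measure_lt_top⟩

lemma memSobolev_of_mem_spaceX (h : u ∈ spaceX Ω bc) : MemSobolev Ω 2 2 u := by
  cases bc with
  | dirichlet => exact h.1
  | navier => exact h.1

lemma memSobolevZero_of_mem_spaceX (h : u ∈ spaceX Ω bc) : MemSobolevZero Ω 1 2 u := by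
  cases bc with
  | dirichlet => exact MemSobolevZero.mono h one_le_two
  | navier => exact h.2

lemma mem_spaceX_of_mem_energySpace (h : u ∈ energySpace Ω bc) : u ∈ spaceX Ω bc := by
  rw [energySpace] at h
  split_ifs at h
  · exact h
  · exact h.1

lemma testFunction_mem_energySpace (φ : TestFunction Ω ℝ ⊤) : ⇑φ ∈ energySpace Ω bc := by
  have hX : ⇑φ ∈ spaceX Ω bc := by
    cases bc with
    | dirichlet => exact memSobolevZero_testFunction φ 2 2
    | navier => exact ⟨memSobolev_testFunction φ 2 2, memSobolevZero_testFunction φ 1 2⟩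
  rw [energySpace]
  split_ifs
  · exact hX
  · exact ⟨hX, memSobolev_testFunction φ 1 6⟩

lemma norm_sq_weakGrad (u : RN N → ℝ) (x : RN N) :
    ‖weakGrad Ω u x‖ ^ 2 = ∑ i, weakDeriv Ω ![i] u x ^ 2 := by
  rw [EuclideanSpace.real_norm_sq_eq]; rfl

lemma abs_weakDeriv_le (u : RN N → ℝ) (i : Fin N) (x : RN N) :
    |weakDeriv Ω ![i] u x| ≤ ‖weakGrad Ω u x‖ :=
  PiLp.norm_apply_le (weakGrad Ω u x) i

lemma memLp_norm_weakGrad {p : ℝ≥0∞} (h : ∀ i, MemLp (weakDeriv Ω ![i] u) p (vol Ω)) :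
    MemLp (fun x => ‖weakGrad Ω u x‖) p (vol Ω) := by
  have hs : MemLp (fun x => ∑ i, |weakDeriv Ω ![i] u x|) p (vol Ω) :=
    memLp_finsetSum _ fun i _ => (h i).abs
  refine hs.of_le ?_ (ae_of_all _ fun x => ?_)
  · have : AEStronglyMeasurable (fun x => √(∑ i, weakDeriv Ω ![i] u x ^ 2)) (vol Ω) :=
      Real.continuous_sqrt.comp_aestronglyMeasurable
        (Finset.aestronglyMeasurable_fun_sum _ fun i _ => (h i).1.pow 2)
    refine this.congr (ae_of_all _ fun x => ?_)
    simp only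
    rw [← norm_sq_weakGrad, Real.sqrt_sq (norm_nonneg _)]
  · rw [norm_norm, Real.norm_of_nonneg (Finset.sum_nonneg fun _ _ => abs_nonneg _)]
    refine le_of_sq_le_sq ?_ (Finset.sum_nonneg fun _ _ => abs_nonneg _)
    rw [norm_sq_weakGrad]
    refine (Finset.sum_le_sum fun i _ => (sq_abs _).ge).trans ?_
    exact Finset.sum_sq_le_sq_sum_of_nonneg fun _ _ => abs_nonneg _

/-- The gradient of a function in the energy space is in `L⁶`: for `N ≤ 3` by the Sobolev
inequality, otherwise by definition. -/
lemma memLp_six_weakDeriv {ρ : RN N → ℝ} {c : ℝ}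
    (hρ : IsDefining Ω ρ c) (h : u ∈ energySpace Ω bc) (i : Fin N) :
    MemLp (weakDeriv Ω ![i] u) 6 (vol Ω) := by
  by_cases hN : N ≤ 3
  · exact hρ.memLp_six hN
      ((memSobolev_of_mem_spaceX (mem_spaceX_of_mem_energySpace h)).isH1_weakDeriv i)
  · rw [energySpace, if_neg hN] at h
    exact h.2.memLp_weakDeriv le_rfl ![i]

lemma memLp_weakLaplacian (h : MemSobolev Ω 2 2 u) : MemLp (weakLaplacian Ω u) 2 (vol Ω) :=
  memLp_finsetSum _ fun i _ => h.memLp_weakDeriv le_rfl ![i, i]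

lemma energyWellDefined (hbdd : Bornology.IsBounded (Ω : Set (RN N))) {ρ : RN N → ℝ} {c : ℝ}
    (hρ : IsDefining Ω ρ c) (h : u ∈ energySpace Ω bc) : EnergyWellDefined Ω u := by
  have := isFiniteMeasure_vol hbdd
  have h6 := memLp_norm_weakGrad (memLp_six_weakDeriv hρ h)
  have key : ∀ n : ℕ, n ≠ 0 → (n : ℝ≥0∞) ≤ 6 → IntegrableOn (fun x => ‖weakGrad Ω u x‖ ^ n) Ω :=
    fun n hn hn6 => by
      have := (h6.mono_exponent hn6).integrable_norm_pow hn
      simp only [norm_norm] at this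
      exact this
  refine ⟨?_, key 2 two_ne_zero (by norm_num), key 4 four_ne_zero (by norm_num),
    key 6 (by norm_num) (by norm_num)⟩
  simp only [sq_abs]
  exact (memLp_weakLaplacian
    (memSobolev_of_mem_spaceX (mem_spaceX_of_mem_energySpace h))).integrable_sq

/-- The density of the gradient part of the energy, shifted so as to be nonnegative. -/
def density (κ τ t : ℝ) : ℝ := τ ^ 2 / 2 * t ^ 2 - κ / 4 * t ^ 4 + κ / 12 * t ^ 6 + 2 * κ

lemma continuous_density (κ τ : ℝ) : Continuous (density κ τ) := by
  unfold density; fun_prop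

/-- The sextic term absorbs the quartic one: `t⁶ / 24 - t⁴ / 4 + 2 ≥ 0`. -/
lemma le_density {κ : ℝ} (hκ : 0 ≤ κ) (τ t : ℝ) : κ / 24 * t ^ 6 ≤ density κ τ t := by
  have h1 : 0 ≤ t ^ 6 / 24 - t ^ 4 / 4 + 2 := by
    -- the polynomial is `(t² - 4)² (t² + 2) / 24` plus a nonnegative constant
    nlinarith [mul_nonneg (sq_nonneg (t ^ 2 - 4)) (by positivity : 0 ≤ t ^ 2 + 2)]
  have h2 := mul_nonneg hκ h1
  have h3 : 0 ≤ τ ^ 2 / 2 * t ^ 2 := by positivity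
  rw [density]
  linarith

lemma density_nonneg {κ : ℝ} (hκ : 0 ≤ κ) (τ t : ℝ) : 0 ≤ density κ τ t :=
  le_trans (by positivity) (le_density hκ τ t)

variable {κ τ : ℝ}

lemma EnergyWellDefined.integrable_density (hbdd : Bornology.IsBounded (Ω : Set (RN N)))
    (h : EnergyWellDefined Ω u) : Integrable (fun x => density κ τ ‖weakGrad Ω u x‖) (vol Ω) := by
  have := isFiniteMeasure_vol hbdd
  obtain ⟨-, h2, h4, h6⟩ := h
  exact (((h2.const_mul _).sub (h4.const_mul _)).add (h6.const_mul _)).add (integrable_const _)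

lemma EnergyWellDefined.energy₂_eq (hbdd : Bornology.IsBounded (Ω : Set (RN N)))
    (h : EnergyWellDefined Ω u) :
    energy₂ Ω κ τ u = 1 / 2 * (∫ x, weakLaplacian Ω u x ^ 2 ∂(vol Ω)) +
      (∫ x, density κ τ ‖weakGrad Ω u x‖ ∂(vol Ω)) - 2 * κ * (vol Ω).real univ := by
  have := isFiniteMeasure_vol hbdd
  obtain ⟨-, h2, h4, h6⟩ := h
  have i2 : Integrable (fun x => τ ^ 2 / 2 * ‖weakGrad Ω u x‖ ^ 2) (vol Ω) := h2.const_mul _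
  have i4 : Integrable (fun x => κ / 4 * ‖weakGrad Ω u x‖ ^ 4) (vol Ω) := h4.const_mul _
  have i6 : Integrable (fun x => κ / 12 * ‖weakGrad Ω u x‖ ^ 6) (vol Ω) := h6.const_mul _
  have i24 : Integrable (fun x => τ ^ 2 / 2 * ‖weakGrad Ω u x‖ ^ 2 -
    κ / 4 * ‖weakGrad Ω u x‖ ^ 4) (vol Ω) := i2.sub i4
  have i246 : Integrable (fun x => τ ^ 2 / 2 * ‖weakGrad Ω u x‖ ^ 2 -
    κ / 4 * ‖weakGrad Ω u x‖ ^ 4 + κ / 12 * ‖weakGrad Ω u x‖ ^ 6) (vol Ω) := i24.add i6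
  simp only [density]
  rw [integral_add i246 (integrable_const _), integral_add i24 i6, integral_sub i2 i4,
    integral_const_mul, integral_const_mul, integral_const_mul, integral_const, energy₂]
  simp only [sq_abs, smul_eq_mul]
  ring

/-- The energy is coercive: a bound on the energy bounds the second derivatives in `L²` and the
gradient in `L⁶`. -/
lemma exists_bound_of_energy (hN : 1 ≤ N) (hbdd : Bornology.IsBounded (Ω : Set (RN N)))
    {ρ : RN N → ℝ} {c : ℝ} (hρ : IsDefining Ω ρ c) (hκ : 0 < κ) (M : ℝ) :
    ∃ C : ℝ≥0, ∀ u ∈ energySpace Ω bc, energy₂ Ω κ τ u ≤ M →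
      (∀ m ≤ 2, ∀ I : Fin m → Fin N, eLpNorm (weakDeriv Ω I u) 2 (vol Ω) ≤ C) ∧
      ∀ i, eLpNorm (weakDeriv Ω ![i] u) 6 (vol Ω) ≤ C := by
  have := isFiniteMeasure_vol hbdd
  obtain ⟨C₁, hC₁, hess⟩ := hρ.hessian_estimate hbdd
  obtain ⟨C₂, hC₂⟩ := IsH1.poincare hbdd ⟨0, hN⟩ 0
  set V : ℝ := (vol Ω).real univ with hV
  have hV0 : 0 ≤ V := measureReal_nonneg
  -- the bounds for `∫ |Δu|²`, `∫ |∇u|⁶`, `∫ |∇u|²` and `∫ |D²u|²` are `A`, `S`, `B` and `D`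
  set A : ℝ := 2 * (|M| + 2 * κ * V) with hA
  set S : ℝ := 24 / κ * (|M| + 2 * κ * V) with hS
  have hA0 : 0 ≤ A := by positivity
  have hS0 : 0 ≤ S := by positivity
  set B : ℝ := S + V with hB
  have hB0 : 0 ≤ B := by positivity
  set D : ℝ := C₁ * (A + B) with hD
  have hD0 : 0 ≤ D := by positivity
  set C : ℝ≥0 := C₂ * (√B).toNNReal + (√B).toNNReal + (√D).toNNReal + (S ^ (1 / 6 : ℝ)).toNNReal
    with hC
  have hle : ∀ {a : ℝ≥0∞} {b : ℝ}, a ≤ ENNReal.ofReal b → b.toNNReal ≤ C → a ≤ C :=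
    fun ha hb => ha.trans (ENNReal.coe_le_coe.2 hb)
  have l1 : (√B).toNNReal ≤ C := by
    rw [hC, add_comm (C₂ * _), add_assoc, add_assoc]; exact le_self_add
  have l2 : (√D).toNNReal ≤ C := by
    rw [hC, add_comm _ (√D).toNNReal, add_assoc]; exact le_self_add
  have l3 : (S ^ (1 / 6 : ℝ)).toNNReal ≤ C := le_add_self
  have l4 : C₂ * (√B).toNNReal ≤ C := by
    rw [hC, add_assoc, add_assoc]; exact le_self_add
  refine ⟨C, fun u hu hE => ?_⟩
  have hX := mem_spaceX_of_mem_energySpace hu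
  have h22 := memSobolev_of_mem_spaceX hX
  have hwd := energyWellDefined hbdd hρ hu
  have hg6 := memLp_six_weakDeriv hρ hu
  have hZ := (memSobolevZero_of_mem_spaceX hX).isH1_univ
  rw [hwd.energy₂_eq hbdd] at hE
  have i1 := hwd.integrable_density hbdd (κ := κ) (τ := τ)
  have d0 : 0 ≤ ∫ x, density κ τ ‖weakGrad Ω u x‖ ∂(vol Ω) :=
    integral_nonneg fun x => density_nonneg hκ.le τ _
  have d1 : κ / 24 * ∫ x, ‖weakGrad Ω u x‖ ^ 6 ∂(vol Ω) ≤
      ∫ x, density κ τ ‖weakGrad Ω u x‖ ∂(vol Ω) := by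
    rw [← integral_const_mul]
    exact integral_mono (hwd.2.2.2.const_mul _) i1 fun x => le_density hκ.le τ _
  have d2 : 0 ≤ ∫ x, weakLaplacian Ω u x ^ 2 ∂(vol Ω) := integral_nonneg fun _ => sq_nonneg _
  have hMle := le_abs_self M
  have bA : ∫ x, weakLaplacian Ω u x ^ 2 ∂(vol Ω) ≤ A := by rw [hA]; linarith
  have bS : ∫ x, ‖weakGrad Ω u x‖ ^ 6 ∂(vol Ω) ≤ S := by
    have : κ / 24 * ∫ x, ‖weakGrad Ω u x‖ ^ 6 ∂(vol Ω) ≤ |M| + 2 * κ * V := by linarith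
    calc _ = 24 / κ * (κ / 24 * ∫ x, ‖weakGrad Ω u x‖ ^ 6 ∂(vol Ω)) := by field_simp
      _ ≤ _ := mul_le_mul_of_nonneg_left this (by positivity)
  have bB : ∫ x, ‖weakGrad Ω u x‖ ^ 2 ∂(vol Ω) ≤ B := by
    have : ∫ x, ‖weakGrad Ω u x‖ ^ 2 ∂(vol Ω) ≤ ∫ x, (‖weakGrad Ω u x‖ ^ 6 + 1) ∂(vol Ω) := by
      refine integral_mono hwd.2.1 (hwd.2.2.2.add (integrable_const _)) fun x => ?_
      simp only
      generalize ‖weakGrad Ω u x‖ = t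
      nlinarith [mul_nonneg (sq_nonneg (t ^ 2 - 1)) (by positivity : 0 ≤ t ^ 2 + 2)]
    rw [integral_add hwd.2.2.2 (integrable_const _), integral_const] at this
    simp only [smul_eq_mul, mul_one] at this
    rw [hB]; linarith
  have bsum : ∑ i, ∫ x, weakDeriv Ω ![i] u x ^ 2 ∂(vol Ω) ≤ B := by
    rw [← integral_finsetSum _ fun i _ => (hZ.memLp_grad i).integrable_sq]
    simpa only [norm_sq_weakGrad] using bB
  have b1 : ∀ i, ∫ x, weakDeriv Ω ![i] u x ^ 2 ∂(vol Ω) ≤ B := fun i =>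
    (Finset.single_le_sum (f := fun i => ∫ x, weakDeriv Ω ![i] u x ^ 2 ∂(vol Ω))
      (fun _ _ => integral_nonneg fun _ => sq_nonneg _) (Finset.mem_univ i)).trans bsum
  have b2 : ∀ i j, ∫ x, weakDeriv Ω ![i, j] u x ^ 2 ∂(vol Ω) ≤ D := fun i j => by
    have := hess u _ _ hZ h22.isH1_weakDeriv h22.weakDeriv_symm
    refine le_trans ?_ (this.trans (mul_le_mul_of_nonneg_left (add_le_add bA bsum) hC₁))
    have n0 : ∀ i j, 0 ≤ ∫ x, weakDeriv Ω ![i, j] u x ^ 2 ∂(vol Ω) := fun _ _ =>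
      integral_nonneg fun _ => sq_nonneg _
    exact (Finset.single_le_sum (f := fun j => ∫ x, weakDeriv Ω ![i, j] u x ^ 2 ∂(vol Ω))
      (fun j _ => n0 i j) (Finset.mem_univ j)).trans
      (Finset.single_le_sum (f := fun i => ∑ j, ∫ x, weakDeriv Ω ![i, j] u x ^ 2 ∂(vol Ω))
        (fun i _ => Finset.sum_nonneg fun j _ => n0 i j) (Finset.mem_univ i))
  refine ⟨fun m hm I => ?_, fun i => ?_⟩
  · interval_cases m
    · rw [eLpNorm_congr_ae (h22.weakDeriv_zero_ae_eq I)]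
      have h1 := (hC₂ u _ hZ (by simpa using hZ.memLp_grad _)).2
      simp only [zero_add, mul_one, Nat.cast_ofNat] at h1
      refine h1.trans ?_
      refine (mul_le_mul_right (eLpNorm_two_le (hZ.memLp_grad _) (b1 _)) _).trans ?_
      change (C₂ : ℝ≥0∞) * ((√B).toNNReal : ℝ≥0∞) ≤ C
      exact_mod_cast l4
    · rw [show I = ![I 0] by ext j; fin_cases j; rfl]
      exact hle (eLpNorm_two_le (hZ.memLp_grad _) (b1 _)) l1
    · rw [show I = ![I 0, I 1] by ext j; fin_cases j <;> rfl]
      exact hle (eLpNorm_two_le (h22.memLp_weakDeriv le_rfl _) (b2 _ _)) l2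
  · refine hle (eLpNorm_six_le (hg6 i) (M := S) (le_trans ?_ bS)) l3
    refine integral_mono ?_ hwd.2.2.2 fun x => ?_
    · have := (hg6 i).integrable_norm_pow (p := 6) (by norm_num)
      simpa only [Real.norm_eq_abs, Even.pow_abs (by decide : Even 6)] using this
    · simp only
      rw [← Even.pow_abs (by decide : Even 6)]
      exact pow_le_pow_left₀ (abs_nonneg _) (abs_weakDeriv_le u i x) 6

end Energy

/-! ### Existence of a minimizer -/

section Minimizer

variable {Ω : Opens (RN N)} {bc : BoundaryCondition} {u : RN N → ℝ}

/-- Integration by parts against a function in `W^{1,2}_0(Ω)`. -/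
lemma MemSobolevZero.integral_mul_weakDeriv (h : MemSobolevZero Ω 1 2 u) {b : RN N → ℝ}
    {b' : Fin N → RN N → ℝ} (hb : IsH1 Ω Ω b b') (i : Fin N) :
    ∫ x, b x * weakDeriv Ω ![i] u x ∂(vol Ω) = -∫ x, b' i x * u x ∂(vol Ω) := by
  obtain ⟨φ, hφ⟩ := h.exists_seq
  have h0 : Tendsto (fun n => eLpNorm (⇑(φ n) - u) 2 (vol Ω)) atTop (𝓝 0) := by
    refine (hφ 0 (by norm_num) ![]).congr fun n => eLpNorm_congr_ae ?_
    rw [partialDeriv_zero]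
    exact (EventuallyEq.refl _ _).sub (h.1.weakDeriv_zero_ae_eq _)
  have t1 := tendsto_integral_mul_const hb.memLp (h.1.memLp_weakDeriv le_rfl ![i])
    (fun n => memLp_partialDeriv ![i] (φ n) 2 _) (hφ 1 le_rfl ![i])
  have t2 := tendsto_integral_mul_const (hb.memLp_grad i) h.1.memLp
    (fun n => (isTest_testFunction (φ n)).memLp 2 _) h0
  refine tendsto_nhds_unique t1 (t2.neg.congr fun n => ?_)
  rw [partialDeriv_one i (φ n).contDiff, hb.rel i _ (isTest_testFunction (φ n))]

/-- Lower semicontinuity of integrals of nonnegative functions under convergence almost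
everywhere, with upper bounds which converge. -/
lemma integral_le_of_tendsto_ae {α : Type*} [MeasurableSpace α] {μ : Measure α} {f : α → ℝ}
    {F : ℕ → α → ℝ} (hF : ∀ n, Integrable (F n) μ) (h0 : ∀ n x, 0 ≤ F n x)
    (hlim : ∀ᵐ x ∂μ, Tendsto (fun n => F n x) atTop (𝓝 (f x))) {b : ℕ → ℝ} {l : ℝ}
    (hb : ∀ n, ∫ x, F n x ∂μ ≤ b n) (hl : Tendsto b atTop (𝓝 l)) : ∫ x, f x ∂μ ≤ l := by
  have hf0 : 0 ≤ᵐ[μ] f := hlim.mono fun x hx => ge_of_tendsto' hx fun n => h0 n x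
  have hl0 : 0 ≤ l := ge_of_tendsto' hl fun n => (integral_nonneg (h0 n)).trans (hb n)
  have hm := aestronglyMeasurable_of_tendsto_ae atTop (fun n => (hF n).1) hlim
  rw [integral_eq_lintegral_of_nonneg_ae hf0 hm]
  refine ENNReal.toReal_le_of_le_ofReal hl0 ?_
  calc ∫⁻ x, ENNReal.ofReal (f x) ∂μ
      = ∫⁻ x, liminf (fun n => ENNReal.ofReal (F n x)) atTop ∂μ :=
        lintegral_congr_ae (hlim.mono fun x hx => (ENNReal.tendsto_ofReal hx).liminf_eq.symm)
    _ ≤ liminf (fun n => ∫⁻ x, ENNReal.ofReal (F n x) ∂μ) atTop :=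
        lintegral_liminf_le' fun n => (hF n).1.aemeasurable.ennreal_ofReal
    _ ≤ liminf (fun n => ENNReal.ofReal (b n)) atTop := by
        refine liminf_le_liminf (Eventually.of_forall fun n => ?_)
        rw [← ofReal_integral_eq_lintegral_ofReal (hF n) (ae_of_all _ (h0 n))]
        exact ENNReal.ofReal_le_ofReal (hb n)
    _ = ENNReal.ofReal l := (ENNReal.tendsto_ofReal hl).liminf_eq

/-- Along a bounded sequence in `W^{2,2}(Ω) ∩ W^{1,2}_0(Ω)` which converges weakly, the gradients
converge in `L²`. The functions converge by Rellich's theorem, and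
`∫ |∂_i v|² = -∫ v ∂_i∂_i v` for `v = u_n - u`. -/
lemma tendsto_weakDeriv_of_weak (hbdd : Bornology.IsBounded (Ω : Set (RN N))) {u : ℕ → RN N → ℝ}
    {v : RN N → ℝ} (hu : ∀ n, MemSobolev Ω 2 2 (u n)) (hu0 : ∀ n, MemSobolevZero Ω 1 2 (u n))
    (hv : MemSobolev Ω 2 2 v) (hv0 : MemSobolevZero Ω 1 2 v) {C : ℝ≥0}
    (hC : ∀ n, ∀ m ≤ 2, ∀ I : Fin m → Fin N, eLpNorm (weakDeriv Ω I (u n)) 2 (vol Ω) ≤ C)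
    (hweak : ∀ m ≤ 2, ∀ (I : Fin m → Fin N) z, MemLp z 2 (vol Ω) →
      Tendsto (fun n => ∫ x, z x * weakDeriv Ω I (u n) x ∂(vol Ω)) atTop
        (𝓝 (∫ x, z x * weakDeriv Ω I v x ∂(vol Ω)))) (i : Fin N) :
    Tendsto (fun n => eLpNorm (weakDeriv Ω ![i] (u n) - weakDeriv Ω ![i] v) 2 (vol Ω))
      atTop (𝓝 0) := by
  have hvfin : ∃ C' : ℝ≥0, ∀ m ≤ 2, ∀ I : Fin m → Fin N,
      eLpNorm (weakDeriv Ω I v) 2 (vol Ω) ≤ C' := by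
    have : sobolevNorm Ω 2 2 v ≠ ⊤ := by
      refine ENNReal.sum_ne_top.2 fun m hm => ENNReal.sum_ne_top.2 fun I _ => ?_
      exact (hv.memLp_weakDeriv (Nat.lt_succ_iff.1 (Finset.mem_range.1 hm)) I).2.ne
    refine ⟨(sobolevNorm Ω 2 2 v).toNNReal, fun m hm I => ?_⟩
    rw [ENNReal.coe_toNNReal this]
    exact eLpNorm_weakDeriv_le_sobolevNorm v hm I
  obtain ⟨C', hC'⟩ := hvfin
  have hd : ∀ n, ∀ m ≤ 2, ∀ I : Fin m → Fin N,
      eLpNorm (weakDeriv Ω I (u n) - weakDeriv Ω I v) 2 (vol Ω) ≤ (C + C' : ℝ≥0) := fun n m hm I =>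
    (eLpNorm_sub_le ((hu n).memLp_weakDeriv hm I).1 (hv.memLp_weakDeriv hm I).1 one_le_two).trans
      (by push_cast; exact add_le_add (hC n m hm I) (hC' m hm I))
  have e0 : ∀ n, (u n - v) =ᵐ[vol Ω] weakDeriv Ω ![] (u n) - weakDeriv Ω ![] v := fun n =>
    ((hu n).weakDeriv_zero_ae_eq _).symm.sub (hv.weakDeriv_zero_ae_eq _).symm
  have h0 : Tendsto (fun n => eLpNorm (u n - v) 2 (vol Ω)) atTop (𝓝 0) := by
    refine tendsto_of_weak hbdd (w := fun n i => weakDeriv Ω ![i] (u n) - weakDeriv Ω ![i] v)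
      (C := C + C') (fun n => (hu0 n).isH1_univ.sub hv0.isH1_univ) (fun n => ?_)
      (fun n i => hd n 1 one_le_two _) fun z hz => ?_
    · rw [eLpNorm_congr_ae (e0 n)]
      exact hd n 0 (by norm_num) _
    · have t := (hweak 0 (by norm_num) ![] z hz).sub_const
        (∫ x, z x * weakDeriv Ω ![] v x ∂(vol Ω))
      rw [sub_self] at t
      refine t.congr fun n => ?_
      rw [← integral_sub
        (integrable_mul_of_L2 hz ((hu n).memLp_weakDeriv (by norm_num) ![]))
        (integrable_mul_of_L2 hz (hv.memLp_weakDeriv (by norm_num) ![]))]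
      refine integral_congr_ae ((e0 n).mono fun x hx => ?_)
      simp only [hx, Pi.sub_apply, mul_sub]
  have hm : ∀ n, MemLp (weakDeriv Ω ![i] (u n) - weakDeriv Ω ![i] v) 2 (vol Ω) := fun n =>
    ((hu n).memLp_weakDeriv one_le_two _).sub (hv.memLp_weakDeriv one_le_two _)
  have hm2 : ∀ n, MemLp (weakDeriv Ω ![i, i] (u n) - weakDeriv Ω ![i, i] v) 2 (vol Ω) := fun n =>
    ((hu n).memLp_weakDeriv le_rfl _).sub (hv.memLp_weakDeriv le_rfl _)
  have hm0 : ∀ n, MemLp (u n - v) 2 (vol Ω) := fun n => (hu n).memLp.sub hv.memLp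
  have key : ∀ n, ∫ x, (weakDeriv Ω ![i] (u n) - weakDeriv Ω ![i] v) x ^ 2 ∂(vol Ω) ≤
      ((C + C' : ℝ≥0) : ℝ) * √(∫ x, (u n - v) x ^ 2 ∂(vol Ω)) := fun n => by
    have hb := ((hu n).isH1_weakDeriv i).sub (hv.isH1_weakDeriv i)
    have k1 := (hu0 n).integral_mul_weakDeriv hb i
    have k2 := hv0.integral_mul_weakDeriv hb i
    have e1 : ∫ x, (weakDeriv Ω ![i] (u n) - weakDeriv Ω ![i] v) x ^ 2 ∂(vol Ω) =
        -∫ x, (weakDeriv Ω ![i, i] (u n) - weakDeriv Ω ![i, i] v) x * (u n - v) x ∂(vol Ω) := by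
      simp only [sq, Pi.sub_apply, mul_sub (weakDeriv Ω ![i] (u n) _ - _),
        mul_sub (weakDeriv Ω ![i, i] (u n) _ - _)]
      rw [integral_sub (integrable_mul_of_L2 hb.memLp ((hu n).memLp_weakDeriv one_le_two _))
        (integrable_mul_of_L2 hb.memLp (hv.memLp_weakDeriv one_le_two _)),
        integral_sub (integrable_mul_of_L2 (hb.memLp_grad i) (hu n).memLp)
        (integrable_mul_of_L2 (hb.memLp_grad i) hv.memLp), k1, k2]
      ring
    rw [e1]
    refine (neg_le_abs _).trans ((Real.abs_le_sqrt (integral_mul_sq_le (hm2 n) (hm0 n))).trans ?_)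
    rw [Real.sqrt_mul (integral_nonneg fun _ => sq_nonneg _)]
    refine mul_le_mul_of_nonneg_right ?_ (Real.sqrt_nonneg _)
    have := hd n 2 le_rfl ![i, i]
    rw [eLpNorm_two_eq (hm2 n), ENNReal.ofReal_le_iff_le_toReal (by simp)] at this
    exact this
  have h1 : Tendsto (fun n => √(∫ x, (u n - v) x ^ 2 ∂(vol Ω))) atTop (𝓝 0) := by
    have := (ENNReal.tendsto_toReal ENNReal.zero_ne_top).comp h0
    refine this.congr fun n => ?_
    rw [comp_apply, eLpNorm_two_eq (hm0 n), ENNReal.toReal_ofReal (Real.sqrt_nonneg _)]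
  have h2 := squeeze_zero (fun n => integral_nonneg fun _ => sq_nonneg _) key
    (by simpa using h1.const_mul ((C + C' : ℝ≥0) : ℝ))
  simp only [fun n => eLpNorm_two_eq (hm n)]
  simpa using ENNReal.tendsto_ofReal h2.sqrt

/-- Finitely many sequences converging in `L²` have a common subsequence converging almost
everywhere. -/
lemma exists_subseq_tendsto_ae {α ι : Type*} [Fintype ι] [MeasurableSpace α] {μ : Measure α}
    {f : ι → α → ℝ} {F : ℕ → ι → α → ℝ} (hf : ∀ i, MemLp (f i) 2 μ) (hF : ∀ n i, MemLp (F n i) 2 μ)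
    (h : ∀ i, Tendsto (fun n => eLpNorm (F n i - f i) 2 μ) atTop (𝓝 0)) :
    ∃ χ : ℕ → ℕ, StrictMono χ ∧
      ∀ᵐ x ∂μ, ∀ i, Tendsto (fun n => F (χ n) i x) atTop (𝓝 (f i x)) := by
  obtain ⟨D, hD⟩ : ∃ D : ℕ → α → ℝ, D = fun n => ∑ i, fun x => |(F n i - f i) x| := ⟨_, rfl⟩
  have hm : ∀ n i, MemLp (fun x => |(F n i - f i) x|) 2 μ := fun n i => ((hF n i).sub (hf i)).abs
  have hDm : ∀ n, AEStronglyMeasurable (D n) μ := fun n => by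
    rw [hD]; exact Finset.aestronglyMeasurable_sum _ fun i _ => (hm n i).1
  have hD0 : Tendsto (fun n => eLpNorm (D n - 0) 2 μ) atTop (𝓝 0) := by
    have h1 : Tendsto (fun n => ∑ i, eLpNorm (F n i - f i) 2 μ) atTop (𝓝 0) := by
      have := tendsto_finsetSum Finset.univ fun i _ => h i
      simpa using this
    refine tendsto_of_tendsto_of_tendsto_of_le_of_le tendsto_const_nhds h1 (fun _ => zero_le)
      fun n => ?_
    simp only [sub_zero, hD]
    refine (eLpNorm_sum_le (fun i _ => (hm n i).1) one_le_two).trans_eq ?_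
    exact Finset.sum_congr rfl fun i _ => eLpNorm_norm (F n i - f i)
  have hDμ : TendstoInMeasure μ D atTop (0 : α → ℝ) :=
    tendstoInMeasure_of_tendsto_eLpNorm (p := 2) two_ne_zero hDm aestronglyMeasurable_zero hD0
  obtain ⟨χ, hχ, h⟩ := hDμ.exists_seq_tendsto_ae
  refine ⟨χ, hχ, h.mono fun x hx i => ?_⟩
  rw [tendsto_iff_norm_sub_tendsto_zero]
  refine squeeze_zero (fun _ => norm_nonneg _) (fun n => ?_) hx
  simp only [hD, Finset.sum_apply]
  exact Finset.single_le_sum (f := fun i => |(F (χ n) i - f i) x|) (fun _ _ => abs_nonneg _)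
    (Finset.mem_univ i)

/-- Weak convergence of all derivatives up to the second order. -/
def WeakTendsto (Ω : Opens (RN N)) (u : ℕ → RN N → ℝ) (v : RN N → ℝ) : Prop :=
  ∀ m ≤ 2, ∀ (I : Fin m → Fin N) z, MemLp z 2 (vol Ω) →
    Tendsto (fun n => ∫ x, z x * weakDeriv Ω I (u n) x ∂(vol Ω)) atTop
      (𝓝 (∫ x, z x * weakDeriv Ω I v x ∂(vol Ω)))

variable {u : ℕ → RN N → ℝ} {v : RN N → ℝ}

lemma mem_spaceX_of_weak (hu : ∀ n, u n ∈ spaceX Ω bc) (hv : MemSobolev Ω 2 2 v)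
    (hweak : WeakTendsto Ω u v) : v ∈ spaceX Ω bc := by
  cases bc with
  | dirichlet => exact memSobolevZero_of_weak hu hv hweak
  | navier =>
    exact ⟨hv, memSobolevZero_of_weak (fun n => (hu n).2) (hv.mono one_le_two)
      fun m hm => hweak m (hm.trans one_le_two)⟩

lemma mem_energySpace_of_memLp_six (hN : 1 ≤ N) (hbdd : Bornology.IsBounded (Ω : Set (RN N)))
    (hv : v ∈ spaceX Ω bc) (h6 : ∀ i, MemLp (weakDeriv Ω ![i] v) 6 (vol Ω)) :
    v ∈ energySpace Ω bc := by
  have h22 := memSobolev_of_mem_spaceX hv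
  rw [energySpace]
  split_ifs with h3
  · exact hv
  · refine ⟨hv, (h22.mono one_le_two).of_memLp fun m hm I => ?_⟩
    interval_cases m
    · obtain ⟨K, hK⟩ := IsH1.poincare hbdd ⟨0, hN⟩ 2
      have e : (((2 * (2 + 1) : ℕ) : ℝ≥0∞)) = 6 := by norm_num
      rw [e] at hK
      exact (hK v _ (memSobolevZero_of_mem_spaceX hv).isH1_univ (h6 _)).1.ae_eq
        (h22.weakDeriv_zero_ae_eq I).symm
    · rw [show I = ![I 0] by ext j; fin_cases j; rfl]
      exact h6 _

lemma WeakTendsto.tendsto_weakLaplacian (hu : ∀ n, MemSobolev Ω 2 2 (u n))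
    (hv : MemSobolev Ω 2 2 v) (hweak : WeakTendsto Ω u v) {z : RN N → ℝ} (hz : MemLp z 2 (vol Ω)) :
    Tendsto (fun n => ∫ x, z x * weakLaplacian Ω (u n) x ∂(vol Ω)) atTop
      (𝓝 (∫ x, z x * weakLaplacian Ω v x ∂(vol Ω))) := by
  have e : ∀ w, MemSobolev Ω 2 2 w → ∫ x, z x * weakLaplacian Ω w x ∂(vol Ω) =
      ∑ i, ∫ x, z x * weakDeriv Ω ![i, i] w x ∂(vol Ω) := fun w hw => by
    rw [← integral_finsetSum _ fun i _ =>
      integrable_mul_of_L2 hz (hw.memLp_weakDeriv le_rfl ![i, i])]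
    refine integral_congr_ae (ae_of_all _ fun x => ?_)
    simp only [← Finset.mul_sum]; rfl
  rw [e v hv]
  simp only [fun n => e (u n) (hu n)]
  exact tendsto_finsetSum _ fun i _ => hweak 2 le_rfl ![i, i] _ hz

variable {κ τ : ℝ}

/-- The energy is lower semicontinuous along sequences in the energy space which converge weakly
and whose gradients converge almost everywhere. -/
lemma energy₂_le_of_tendsto (hbdd : Bornology.IsBounded (Ω : Set (RN N))) {ρ : RN N → ℝ} {c : ℝ}
    (hρ : IsDefining Ω ρ c) (hκ : 0 ≤ κ) (hu : ∀ n, u n ∈ energySpace Ω bc)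
    (hv : v ∈ energySpace Ω bc) (hweak : WeakTendsto Ω u v)
    (hae : ∀ᵐ x ∂(vol Ω), ∀ i, Tendsto (fun n => weakDeriv Ω ![i] (u n) x) atTop
      (𝓝 (weakDeriv Ω ![i] v x))) {l : ℝ}
    (hl : Tendsto (fun n => energy₂ Ω κ τ (u n)) atTop (𝓝 l)) : energy₂ Ω κ τ v ≤ l := by
  have hu22 : ∀ n, MemSobolev Ω 2 2 (u n) := fun n =>
    memSobolev_of_mem_spaceX (mem_spaceX_of_mem_energySpace (hu n))
  have hv22 := memSobolev_of_mem_spaceX (mem_spaceX_of_mem_energySpace hv)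
  have hLv := memLp_weakLaplacian hv22
  have hLu : ∀ n, MemLp (weakLaplacian Ω (u n)) 2 (vol Ω) := fun n => memLp_weakLaplacian (hu22 n)
  -- weak lower semicontinuity of the square of the `L²` norm, from `2ab - a² ≤ b²`
  have hA : ∀ n, 2 * (∫ x, weakLaplacian Ω v x * weakLaplacian Ω (u n) x ∂(vol Ω)) -
      ∫ x, weakLaplacian Ω v x ^ 2 ∂(vol Ω) ≤
        ∫ x, weakLaplacian Ω (u n) x ^ 2 ∂(vol Ω) := fun n => by
    rw [← integral_const_mul, ← integral_sub ((integrable_mul_of_L2 hLv (hLu n)).const_mul 2)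
      hLv.integrable_sq]
    refine integral_mono (((integrable_mul_of_L2 hLv (hLu n)).const_mul 2).sub hLv.integrable_sq)
      (hLu n).integrable_sq fun x => ?_
    simp only
    nlinarith [sq_nonneg (weakLaplacian Ω v x - weakLaplacian Ω (u n) x)]
  have hLw := hweak.tendsto_weakLaplacian hu22 hv22 hLv
  have hwd : ∀ n, EnergyWellDefined Ω (u n) := fun n => energyWellDefined hbdd hρ (hu n)
  have hlim : ∀ᵐ x ∂(vol Ω), Tendsto (fun n => density κ τ ‖weakGrad Ω (u n) x‖) atTop
      (𝓝 (density κ τ ‖weakGrad Ω v x‖)) := hae.mono fun x hx => by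
    refine ((continuous_density κ τ).tendsto _).comp (Tendsto.norm ?_)
    exact ((PiLp.continuous_toLp 2 _).tendsto _).comp (tendsto_pi_nhds.2 hx)
  have hb : ∀ n, ∫ x, density κ τ ‖weakGrad Ω (u n) x‖ ∂(vol Ω) ≤
      energy₂ Ω κ τ (u n) + 2 * κ * (vol Ω).real univ -
      1 / 2 * (2 * (∫ x, weakLaplacian Ω v x * weakLaplacian Ω (u n) x ∂(vol Ω)) -
        ∫ x, weakLaplacian Ω v x ^ 2 ∂(vol Ω)) := fun n => by
    have h1 := (hwd n).energy₂_eq hbdd (κ := κ) (τ := τ)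
    have h2 := hA n
    linarith
  have hdens := integral_le_of_tendsto_ae (fun n => (hwd n).integrable_density hbdd)
    (fun n x => density_nonneg hκ τ _) hlim hb
    ((hl.add_const _).sub (((hLw.const_mul 2).sub_const _).const_mul (1 / 2)))
  rw [(energyWellDefined hbdd hρ hv).energy₂_eq hbdd]
  simp only [← sq] at hdens
  linarith

lemma bddBelow_energy₂ (hbdd : Bornology.IsBounded (Ω : Set (RN N))) {ρ : RN N → ℝ} {c : ℝ}
    (hρ : IsDefining Ω ρ c) (hκ : 0 ≤ κ) : BddBelow (energy₂ Ω κ τ '' energySpace Ω bc) := by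
  refine ⟨-(2 * κ * (vol Ω).real univ), ?_⟩
  rintro _ ⟨v, hv, rfl⟩
  rw [(energyWellDefined hbdd hρ hv).energy₂_eq hbdd]
  have d1 : 0 ≤ ∫ x, density κ τ ‖weakGrad Ω v x‖ ∂(vol Ω) :=
    integral_nonneg fun x => density_nonneg hκ τ _
  have d2 : 0 ≤ ∫ x, weakLaplacian Ω v x ^ 2 ∂(vol Ω) := integral_nonneg fun _ => sq_nonneg _
  linarith

/-- The direct method: a minimizing sequence is bounded by coercivity, and the energy of its weak
limit is the infimum. -/
theorem exists_minimizer (hN : 1 ≤ N) (hbdd : Bornology.IsBounded (Ω : Set (RN N)))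
    {ρ : RN N → ℝ} {c : ℝ} (hρ : IsDefining Ω ρ c) (hκ : 0 < κ) :
    ∃ u ∈ energySpace Ω bc, ∀ v ∈ energySpace Ω bc, energy₂ Ω κ τ u ≤ energy₂ Ω κ τ v := by
  have hne : (energy₂ Ω κ τ '' energySpace Ω bc).Nonempty :=
    ⟨_, ⟨_, testFunction_mem_energySpace (0 : TestFunction Ω ℝ ⊤), rfl⟩⟩
  have hbelow := bddBelow_energy₂ (bc := bc) (τ := τ) hbdd hρ hκ.le
  obtain ⟨e, -, he, hmem⟩ := exists_seq_tendsto_sInf hne hbelow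
  choose u hu hue using hmem
  obtain ⟨M, hM⟩ := he.bddAbove_range
  obtain ⟨C, hC⟩ := exists_bound_of_energy (bc := bc) (τ := τ) hN hbdd hρ hκ M
  have hC2 : ∀ n, ∀ m ≤ 2, ∀ I : Fin m → Fin N, eLpNorm (weakDeriv Ω I (u n)) 2 (vol Ω) ≤ C :=
    fun n => (hC (u n) (hu n) (by rw [hue]; exact hM (mem_range_self n))).1
  have hC6 : ∀ n i, eLpNorm (weakDeriv Ω ![i] (u n)) 6 (vol Ω) ≤ C :=
    fun n => (hC (u n) (hu n) (by rw [hue]; exact hM (mem_range_self n))).2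
  have huX : ∀ n, u n ∈ spaceX Ω bc := fun n => mem_spaceX_of_mem_energySpace (hu n)
  have hu22 : ∀ n, MemSobolev Ω 2 2 (u n) := fun n => memSobolev_of_mem_spaceX (huX n)
  obtain ⟨v, ψ, hψ, hv, hweak⟩ := exists_weak_limit hu22 hC2
  have hvX : v ∈ spaceX Ω bc := mem_spaceX_of_weak (fun n => huX (ψ n)) hv hweak
  have hstrong := tendsto_weakDeriv_of_weak hbdd (fun n => hu22 (ψ n))
    (fun n => memSobolevZero_of_mem_spaceX (huX (ψ n))) hv (memSobolevZero_of_mem_spaceX hvX)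
    (fun n => hC2 (ψ n)) hweak
  obtain ⟨χ, hχ, hae⟩ := exists_subseq_tendsto_ae
    (fun i => hv.memLp_weakDeriv one_le_two ![i])
    (fun n i => (hu22 (ψ n)).memLp_weakDeriv one_le_two ![i]) hstrong
  have hvE : v ∈ energySpace Ω bc := mem_energySpace_of_memLp_six hN hbdd hvX fun i =>
    (memLp_of_tendsto_ae (fun n => ((hu22 _).memLp_weakDeriv one_le_two ![i]).1)
      (fun n => hC6 (ψ (χ n)) i) ENNReal.coe_ne_top (hae.mono fun x hx => hx i)).1
  refine ⟨v, hvE, fun w hw => le_trans ?_ (csInf_le hbelow ⟨w, hw, rfl⟩)⟩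
  refine energy₂_le_of_tendsto hbdd hρ hκ.le (fun n => hu (ψ (χ n))) hvE
    (fun m hm I z hz => (hweak m hm I z hz).comp hχ.tendsto_atTop) hae ?_
  exact (he.comp (hψ.comp hχ).tendsto_atTop).congr fun n => (hue _).symm

end Minimizer

/-! ### Negative energy -/

section NegativeEnergy

variable {Ω : Opens (RN N)}

lemma energy₂_eq_zero_of_ae_eq_zero {u : RN N → ℝ} (hu : MemSobolev Ω 2 2 u)
    (h0 : u =ᵐ[vol Ω] 0) (κ τ : ℝ) : energy₂ Ω κ τ u = 0 := by
  have hl := (hu.hasWeakDeriv (Nat.zero_le 2) ![]).1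
  have hL : weakLaplacian Ω u =ᵐ[vol Ω] 0 := by
    have : ∀ᵐ x ∂(vol Ω), ∀ i, weakDeriv Ω ![i, i] u x = 0 :=
      ae_all_iff.2 fun i => weakDeriv_of_ae_eq_zero hl h0 ![i, i]
    filter_upwards [this] with x hx
    simp [weakLaplacian, hx]
  have hG : ∀ᵐ x ∂(vol Ω), ‖weakGrad Ω u x‖ = 0 := by
    have : ∀ᵐ x ∂(vol Ω), ∀ i, weakDeriv Ω ![i] u x = 0 :=
      ae_all_iff.2 fun i => weakDeriv_of_ae_eq_zero hl h0 ![i]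
    filter_upwards [this] with x hx
    rw [← sq_eq_zero_iff, norm_sq_weakGrad]
    simp [hx]
  have e1 : ∫ x, |weakLaplacian Ω u x| ^ 2 ∂(vol Ω) = 0 :=
    integral_eq_zero_of_ae (hL.mono fun x hx => by simp [hx])
  have e2 : ∀ n ≠ 0, ∫ x, ‖weakGrad Ω u x‖ ^ n ∂(vol Ω) = 0 := fun n hn =>
    integral_eq_zero_of_ae (hG.mono fun x hx => by simp [hx, hn])
  rw [energy₂, e1, e2 2 two_ne_zero, e2 4 four_ne_zero, e2 6 (by norm_num)]
  ring

/-- The energy along a ray spanned by a test function. -/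
lemma energy₂_smul_testFunction (φ : TestFunction Ω ℝ ⊤) (s κ τ : ℝ) :
    energy₂ Ω κ τ (s • φ : TestFunction Ω ℝ ⊤) =
      1 / 2 * (s ^ 2 * ∫ x, |weakLaplacian Ω φ x| ^ 2 ∂(vol Ω)) +
      τ ^ 2 / 2 * (s ^ 2 * ∫ x, ‖weakGrad Ω φ x‖ ^ 2 ∂(vol Ω)) -
      κ / 4 * (s ^ 4 * ∫ x, ‖weakGrad Ω φ x‖ ^ 4 ∂(vol Ω)) +
      κ / 12 * (s ^ 6 * ∫ x, ‖weakGrad Ω φ x‖ ^ 6 ∂(vol Ω)) := by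
  have hw : ∀ {m : ℕ} (I : Fin m → Fin N), ∀ᵐ x ∂(vol Ω),
      weakDeriv Ω I (s • φ : TestFunction Ω ℝ ⊤) x = s * weakDeriv Ω I φ x := fun I => by
    filter_upwards [weakDeriv_testFunction I (s • φ), weakDeriv_testFunction I φ] with x h1 h2
    rw [h1, h2, partialDeriv_smul]
  have hL : ∀ᵐ x ∂(vol Ω), weakLaplacian Ω (s • φ : TestFunction Ω ℝ ⊤) x =
      s * weakLaplacian Ω φ x := by
    filter_upwards [ae_all_iff.2 fun i : Fin N => hw ![i, i]] with x hx
    simp only [weakLaplacian, hx, Finset.mul_sum]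
  have hG : ∀ᵐ x ∂(vol Ω), ‖weakGrad Ω (s • φ : TestFunction Ω ℝ ⊤) x‖ ^ 2 =
      s ^ 2 * ‖weakGrad Ω φ x‖ ^ 2 := by
    filter_upwards [ae_all_iff.2 fun i : Fin N => hw ![i]] with x hx
    simp only [norm_sq_weakGrad, hx, mul_pow, Finset.mul_sum]
  have eL : ∫ x, |weakLaplacian Ω (s • φ : TestFunction Ω ℝ ⊤) x| ^ 2 ∂(vol Ω) =
      s ^ 2 * ∫ x, |weakLaplacian Ω φ x| ^ 2 ∂(vol Ω) := by
    rw [← integral_const_mul]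
    refine integral_congr_ae (hL.mono fun x hx => ?_)
    simp only [hx, sq_abs, mul_pow]
  have eG : ∀ n : ℕ, ∫ x, ‖weakGrad Ω (s • φ : TestFunction Ω ℝ ⊤) x‖ ^ (2 * n) ∂(vol Ω) =
      s ^ (2 * n) * ∫ x, ‖weakGrad Ω φ x‖ ^ (2 * n) ∂(vol Ω) := fun n => by
    rw [← integral_const_mul]
    refine integral_congr_ae (hG.mono fun x hx => ?_)
    simp only
    rw [pow_mul, hx, mul_pow, pow_mul, pow_mul]
  rw [energy₂, eL, eG 1, eG 2, eG 3]

/-- A bump function has a nonzero gradient in `L⁴`, by Poincaré's inequality. -/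
lemma exists_testFunction_integral_pow_pos (hN : 1 ≤ N)
    (hbdd : Bornology.IsBounded (Ω : Set (RN N))) (hne : (Ω : Set (RN N)).Nonempty) :
    ∃ φ : TestFunction Ω ℝ ⊤, 0 < ∫ x, ‖weakGrad Ω φ x‖ ^ 4 ∂(vol Ω) := by
  obtain ⟨x₀, hx₀⟩ := hne
  obtain ⟨r, hr, hball⟩ := Metric.isOpen_iff.1 Ω.isOpen x₀ hx₀
  let β : ContDiffBump x₀ := ⟨r / 4, r / 2, by positivity, by linarith⟩
  let φ : TestFunction Ω ℝ ⊤ := ⟨β, β.contDiff, β.hasCompactSupport, by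
    rw [β.tsupport_eq]; exact (closedBall_subset_ball (by simp only [β]; linarith)).trans hball⟩
  refine ⟨φ, ?_⟩
  have ht := isTest_testFunction φ
  obtain ⟨R, hR⟩ := hbdd.subset_closedBall 0
  have hP := poincare_test ⟨0, hN⟩ 1 (ht.mono hR)
  simp only [Nat.reduceMul, Nat.reduceAdd] at hP
  have h1 : 0 < ∫ x, φ x ^ 4 := by
    refine (φ.continuous.pow 4).integral_pos_of_hasCompactSupport_nonneg_nonzero
      ((φ.hasCompactSupport.comp_left (g := fun y : ℝ => y ^ 4) (by simp)))
      (fun x => by positivity) (x := x₀) ?_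
    have : φ x₀ = 1 := β.one_of_mem_closedBall (mem_closedBall_self (by simp only [β]; positivity))
    simp [this]
  have h2 : ∫ x, pd ⟨0, hN⟩ φ x ^ 4 ≤ ∫ x, ‖weakGrad Ω φ x‖ ^ 4 ∂(vol Ω) := by
    rw [← setIntegral_eq_integral_of_forall_compl_eq_zero (s := (Ω : Set (RN N)))
      (f := fun x => pd ⟨0, hN⟩ φ x ^ 4) fun x hx => by
        rw [image_eq_zero_of_notMem_tsupport (f := pd ⟨0, hN⟩ φ)
          fun h => hx (φ.tsupport_subset (tsupport_pd_subset _ _ h)), zero_pow four_ne_zero]]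
    have hm := memLp_norm_weakGrad (Ω := Ω) (u := φ) (p := ((4 : ℕ) : ℝ≥0∞)) fun i =>
      (memLp_partialDeriv ![i] φ _ _).ae_eq (weakDeriv_testFunction ![i] φ).symm
    have hi := hm.integrable_norm_pow four_ne_zero
    simp only [norm_norm] at hi
    refine integral_mono_of_nonneg (ae_of_all _ fun x => by positivity) hi ?_
    filter_upwards [weakDeriv_testFunction ![⟨0, hN⟩] φ] with x hx
    rw [partialDeriv_one _ φ.contDiff] at hx
    rw [← hx, ← Even.pow_abs (by decide : Even 4)]
    exact pow_le_pow_left₀ (abs_nonneg _) (abs_weakDeriv_le φ _ x) 4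
  by_contra hcon
  have h3 : ∫ x, pd ⟨0, hN⟩ φ x ^ 4 ≤ 0 := h2.trans (not_lt.1 hcon)
  have h4 : ∫ x, pd ⟨0, hN⟩ φ x ^ 4 = 0 :=
    le_antisymm h3 (integral_nonneg fun x => by positivity)
  rw [h4, mul_zero] at hP
  linarith

/-- For large `κ` the energy is negative at a suitable multiple of a test function. -/
lemma exists_energy₂_neg (hN : 1 ≤ N) (hbdd : Bornology.IsBounded (Ω : Set (RN N)))
    (hne : (Ω : Set (RN N)).Nonempty) (τ : ℝ) :
    ∃ κ₀ : ℝ, 0 < κ₀ ∧ ∀ κ, κ₀ ≤ κ → ∃ φ : TestFunction Ω ℝ ⊤, energy₂ Ω κ τ φ < 0 := by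
  obtain ⟨φ, hφ⟩ := exists_testFunction_integral_pow_pos hN hbdd hne
  have hE := energy₂_smul_testFunction φ
  have hA : 0 ≤ ∫ x, |weakLaplacian Ω φ x| ^ 2 ∂(vol Ω) := integral_nonneg fun _ => by positivity
  have hB : 0 ≤ ∫ x, ‖weakGrad Ω φ x‖ ^ 2 ∂(vol Ω) := integral_nonneg fun _ => by positivity
  have hS : 0 ≤ ∫ x, ‖weakGrad Ω φ x‖ ^ 6 ∂(vol Ω) := integral_nonneg fun _ => by positivity
  generalize ∫ x, |weakLaplacian Ω φ x| ^ 2 ∂(vol Ω) = A at *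
  generalize ∫ x, ‖weakGrad Ω φ x‖ ^ 2 ∂(vol Ω) = B at *
  generalize ∫ x, ‖weakGrad Ω φ x‖ ^ 4 ∂(vol Ω) = F at *
  generalize ∫ x, ‖weakGrad Ω φ x‖ ^ 6 ∂(vol Ω) = S at *
  -- the quartic term dominates the sextic one for small multiples
  set q : ℝ := F / (S + 1) with hq
  have hq0 : 0 < q := by positivity
  have hqS : q * S ≤ F := by
    rw [hq, div_mul_eq_mul_div, div_le_iff₀ (by positivity)]; nlinarith
  set P : ℝ := 1 / 2 * A + τ ^ 2 / 2 * B with hP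
  have hP0 : 0 ≤ P := by positivity
  refine ⟨6 * P / (q * F) + 1, by positivity, fun κ hκ => ⟨√q • φ, ?_⟩⟩
  have e2 : √q ^ 2 = q := Real.sq_sqrt hq0.le
  have e4 : √q ^ 4 = q ^ 2 := by rw [show 4 = 2 * 2 by norm_num, pow_mul, e2]
  have e6 : √q ^ 6 = q ^ 3 := by rw [show 6 = 2 * 3 by norm_num, pow_mul, e2]
  rw [hE, e2, e4, e6]
  have hκ0 : 0 < κ := lt_of_lt_of_le (by positivity) hκ
  have h1 : 6 * P < κ * (q * F) := by
    rw [← div_lt_iff₀ (by positivity)]; linarith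
  have h2 : κ / 12 * (q ^ 3 * S) ≤ κ / 12 * (q ^ 2 * F) := by
    refine mul_le_mul_of_nonneg_left ?_ (by positivity)
    nlinarith [mul_le_mul_of_nonneg_left hqS (sq_nonneg q)]
  have h3 := mul_lt_mul_of_pos_left h1 hq0
  have h4 : 1 / 2 * (q * A) + τ ^ 2 / 2 * (q * B) = q * P := by rw [hP]; ring
  nlinarith

end NegativeEnergy

end

end Zakharov

theorem proposition6 (N : ℕ) (hN : 1 ≤ N)
    (Ω : TopologicalSpace.Opens (Zakharov.RN N))
    (hconn : IsConnected (Ω : Set (Zakharov.RN N)))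
    (hbdd : Bornology.IsBounded (Ω : Set (Zakharov.RN N)))
    (η : NNReal) (hη0 : 0 < η) (hη1 : η < 1)
    (hbdry : Zakharov.HasHolderBoundary 4 η Ω)
    (bc : Zakharov.BoundaryCondition)
    (hball : bc = Zakharov.BoundaryCondition.navier → Zakharov.UniformOuterBall Ω)
    (ω : ℝ) :
    (∀ v ∈ Zakharov.energySpace Ω bc, Zakharov.EnergyWellDefined Ω v) ∧
    ∃ κ₀ : ℝ, 0 < κ₀ ∧ ∀ κ : ℝ, κ₀ ≤ κ →
      ∃ u ∈ Zakharov.energySpace Ω bc,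
        (¬ u =ᵐ[MeasureTheory.volume.restrict (Ω : Set (Zakharov.RN N))] 0) ∧
        (∀ v ∈ Zakharov.energySpace Ω bc,
          Zakharov.energy₂ Ω κ ω u ≤ Zakharov.energy₂ Ω κ ω v) ∧
        Zakharov.energy₂ Ω κ ω u < 0 := by
  obtain ⟨ρ, c, hρ⟩ := Zakharov.exists_isDefining hbdd hbdry
  refine ⟨fun v hv => Zakharov.energyWellDefined hbdd hρ hv, ?_⟩
  obtain ⟨κ₀, hκ₀, hneg⟩ := Zakharov.exists_energy₂_neg hN hbdd hconn.nonempty ω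
  refine ⟨κ₀, hκ₀, fun κ hκ => ?_⟩
  obtain ⟨u, hu, hmin⟩ := Zakharov.exists_minimizer (bc := bc) (τ := ω) hN hbdd hρ (hκ₀.trans_le hκ)
  obtain ⟨φ, hφ⟩ := hneg κ hκ
  have hlt := (hmin _ (Zakharov.testFunction_mem_energySpace φ)).trans_lt hφ
  refine ⟨u, hu, fun h0 => ?_, hmin, hlt⟩
  have h22 := Zakharov.memSobolev_of_mem_spaceX (Zakharov.mem_spaceX_of_mem_energySpace hu)
  exact hlt.ne (Zakharov.energy₂_eq_zero_of_ae_eq_zero h22 h0 κ ω)
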